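/- **Setting.** There are $N$ agents. Agent $i$ chooses $x_i\in\mathbb R^n$; write $\boldsymbol x=(x_1,\dots,x_N)$, $\boldsymbol x_{-i}=(x_j)_{j\ne i}$. Let $\Omega_i\subseteq\mathbb R^n$, $\boldsymbol\Omega=\prod_i\Omega_i$, $g(\boldsymbol x)=\sum_{i}g_i(x_i)$ with $g_i:\mathbb R^n\to\mathbb R^m$, and $\boldsymbol{\mathcal X}=\{\boldsymbol x\in\boldsymbol\Omega: g(\boldsymbol x)\le 0\}$. Let $J_i:\mathbb R^{nN}\times\mathbb R^d\to\mathbb R$ be measurable, let $\xi$ be a random vector in $\mathbb R^d$ with law $P$, $\mathbb J_i(\boldsymbol x)=\mathbb E[J_i(\boldsymbol x,\xi)]$ and $\mathbb F(\boldsymbol x)=(\mathbb E[\nabla_{x_i}J_i(\boldsymbol x,\xi)])_{i}$. A point $\boldsymbol x^*\in\boldsymbol{\mathcal X}$ is a *stochastic generalized Nash equilibrium* (SGNE) if for every $i$ one has $\mathbb J_i(\boldsymbol x^*)\le\mathbb J_i(y,\boldsymbol x^*_{-i})$ for all $y$ with $(y,\boldsymbol x^*_{-i})\in\boldsymbol{\mathcal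 X}$. It is a *variational* SGNE (v-SGNE) if moreover $\langle\mathbb F(\boldsymbol x^*),\boldsymbol x-\boldsymbol x^*\rangle\ge0$ for all $\boldsymbol x\in\boldsymbol{\mathcal X}$; this inequality is called the variational inequality. **Assumptions on the game.** 1. Each $\Omega_i$ is nonempty, closed and convex, and there is $\bar{\boldsymbol x}\in\boldsymbol\Omega$ with $g(\bar{\boldsymbol x})<0$ componentwise (Slater). 2. Each $g_i$ is differentiable with convex components, $g$ is Lipschitz continuous, and $\nabla g$ is bounded on $\boldsymbol{\mathcal X}$. 3. For $\boldsymbol x\in\boldsymbol\Omega$: $J_i(\boldsymbol x,\xi)$ is integrable, $J_i(\cdot,\boldsymbol x_{-i},s)$ is differentiable at $x_i$ for every $s$, and near $x_i$ the function $J_i(\cdot,\boldsymbol x_{-i},\xi)$ is Lipschitz with a constant $C(\xi)$, $\mathbb E|C(\xi)|<\infty$ (so that gradient and expectation commute). 4. For every $i$ and every $\boldsymbol x\in\boldsymbol{\mathcal X}$ the function $\mathbb J_i(\cdot,\boldsymbol x_{-i})$ is convex and continuously differentiable on $\Omega_i$. 5. The variational inequality has at least one solution in $\boldsymbol{\mathcal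 X}$. 6. $\mathbb F$ is monotone and Lipschitz continuous on $\boldsymbol\Omega$. **Algorithm.** Let $\mathcal G^\lambda$ be a connected undirected graph on the agents with symmetric weights $w_{ij}$, where $w_{ij}>0$ if $ij$ is an edge and $w_{ij}=0$ otherwise. Let $\gamma_i,\nu_i,\tau_i>0$. Let $\alpha^k=(k+\eta)^{-a}$ with $\eta>0$, and let $\epsilon^k_j=(k+\zeta_j)^{-b}$ with $\zeta_j>0$, $j=1,\dots,nN+2Nm$, be one regularization parameter for each scalar coordinate of $(\boldsymbol x,\boldsymbol z,\boldsymbol\lambda)$, where $a,b\in(0,1)$, $a>b$, $a+b<1$. Put $\epsilon^k_{\min}=\min_j\epsilon^k_j$, and let $\varepsilon^k_{x_i},\varepsilon^k_{z_i},\varepsilon^k_{\lambda_i}$ be the diagonal matrices of the parameters belonging to $x_i,z_i,\lambda_i$. From a random initial state with $x_i^0\in\Omega_i$, $z_i^0\in\mathbb R^m$, $\lambda_i^0\in\mathbb R^m_{\ge0}$, iterate $$x_i^{k+1}=\operatorname{proj}_{\Omega_i}\{x_i^k-\alpha^k\gamma_i(\nabla_{x_i}J_i(\boldsymbol x^k,\xi_i^k)+\nabla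 g_i(x_i^k)^\top\lambda_i^k+\varepsilon^k_{x_i}x_i^k)\},$$ $$z_i^{k+1}=z_i^k-\alpha^k\nu_i\Big(\sum_jw_{ij}(\lambda_i^k-\lambda_j^k)+\varepsilon^k_{z_i}z_i^k\Big),$$ $$\lambda_i^{k+1}=\operatorname{proj}_{\mathbb R^m_{\ge0}}\Big\{\lambda_i^k+\alpha^k\tau_i\Big(g_i(x_i^k)-\varepsilon^k_{\lambda_i}\lambda_i^k+\sum_jw_{ij}[(z_i^k-z_j^k)-(\lambda_i^k-\lambda_j^k)]\Big)\Big\},$$ where the samples $\xi_i^k$ ($k\ge0$, $1\le i\le N$) are i.i.d. with law $P$ and independent of the initial state. **Assumption on the error.** Let $\mathcal F_k$ be the $\sigma$-algebra generated by the initial state and the samples $\xi_i^j$ with $j<k$. Let $\delta_i^k=\mathbb F_i(\boldsymbol x^k)-\nabla_{x_i}J_i(\boldsymbol x^k,\xi_i^k)$ and $\|\Delta^k\|_\Phi^2=\sum_i\gamma_i^{-1}\|\delta_i^k\|^2$. Almost surely, $$\lim_{k\to\infty}\frac{\alpha^k}{\epsilon^k_{\min}}\,\mathbb E[\|\Delta^k\|_\Phi^2\mid\mathcal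 F_k]=0\qquad\text{and}\qquad\sum_{k\ge0}(\alpha^k)^2\,\mathbb E[\|\Delta^k\|_\Phi^2\mid\mathcal F_k]<\infty.$$ **Theorem.** Under these assumptions there is a v-SGNE $\boldsymbol x^*$ such that $\boldsymbol x^k\to\boldsymbol x^*$ almost surely. -/

import Mathlib

open MeasureTheory ProbabilityTheory Filter Topology
open scoped ENNReal

noncomputable section

/-- Euclidean space of dimension `p`. -/
abbrev Vec (p : ℕ) : Type := EuclideanSpace ℝ (Fin p)

/-- Collections of one vector of dimension `p` for each of the `N` agents. -/
abbrev Profile (N p : ℕ) : Type := Fin N → Vec p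

/-- The Euclidean inner product of two stacked vectors. -/
def stackInner {N p : ℕ} (v w : Profile N p) : ℝ := ∑ i, inner ℝ (v i) (w i)

/-- The Euclidean norm of a stacked vector. -/
def stackNorm {N p : ℕ} (v : Profile N p) : ℝ := Real.sqrt (∑ i, ‖v i‖ ^ 2)

/-- The data of a stochastic game with shared separable constraints: local sets `Ω i`, constraint
functions `g i`, sample costs `J i x s` and the law `P` of the uncertainty. -/
structure SGNEP (N n m d : ℕ) where
  Ω : Fin N → Set (Vec n)
  g : Fin N → Vec n → Vec m
  J : Fin N → Profile N n → Vec d → ℝ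
  P : Measure (Vec d)

namespace SGNEP

variable {N n m d : ℕ} (S : SGNEP N n m d)

/-- The product of the local sets. -/
def localSet : Set (Profile N n) := {x | ∀ i, x i ∈ S.Ω i}

/-- The aggregate constraint function `g(x) = ∑ i, g i (x i)`. -/
def coupling (x : Profile N n) : Vec m := ∑ i, S.g i (x i)

/-- The collective feasible set. -/
def feasible : Set (Profile N n) := {x | x ∈ S.localSet ∧ ∀ l, S.coupling x l ≤ 0}

/-- The expected cost of agent `i`. -/
def cost (i : Fin N) (x : Profile N n) : ℝ := ∫ s, S.J i x s ∂S.P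

/-- The gradient of the sample cost `J i (·, s)` with respect to the own variable of agent `i`. -/
def partialGrad (i : Fin N) (x : Profile N n) (s : Vec d) : Vec n :=
  gradient (fun y => S.J i (Function.update x i y) s) (x i)

/-- The pseudogradient mapping: the expected own-variable gradients, stacked. -/
def F (x : Profile N n) : Profile N n := fun i => ∫ s, S.partialGrad i x s ∂S.P

/-- `x` solves the variational inequality of the feasible set and the pseudogradient. -/
def IsSVISolution (x : Profile N n) : Prop :=
  x ∈ S.feasible ∧ ∀ y ∈ S.feasible, 0 ≤ stackInner (S.F x) (y - x)

/-- `x` is a stochastic generalized Nash equilibrium. -/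
def IsSGNE (x : Profile N n) : Prop :=
  x ∈ S.feasible ∧ ∀ i, ∀ y, Function.update x i y ∈ S.feasible →
    S.cost i x ≤ S.cost i (Function.update x i y)

/-- `x` is a variational stochastic generalized Nash equilibrium. -/
def IsVSGNE (x : Profile N n) : Prop := S.IsSGNE x ∧ S.IsSVISolution x

/-- Closed convex nonempty local sets, and Slater's constraint qualification. -/
structure ConstraintQualification : Prop where
  nonempty : ∀ i, (S.Ω i).Nonempty
  closed : ∀ i, IsClosed (S.Ω i)
  convex : ∀ i, Convex ℝ (S.Ω i)
  slater : ∃ x ∈ S.localSet, ∀ l, S.coupling x l < 0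

/-- Separable coupling constraints: convex differentiable `g i`, Lipschitz `g`, and gradient of `g`
bounded on the feasible set (blockwise, which is the same up to the constant). -/
structure ConvexCoupling : Prop where
  convex : ∀ i l, ConvexOn ℝ Set.univ (fun y => S.g i y l)
  differentiable : ∀ i, Differentiable ℝ (S.g i)
  lipschitz : ∃ ℓ > 0, ∀ x y : Profile N n,
    ‖S.coupling x - S.coupling y‖ ≤ ℓ * stackNorm (x - y)
  gradient_bounded : ∃ B : ℝ, ∀ x ∈ S.feasible, ∀ i, ‖fderiv ℝ (S.g i) (x i)‖ ≤ B

/-- Standing regularity of the sample costs, under which the expected costs are well defined and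
differentiation in the own variable commutes with the expectation. -/
structure RegularSampleCost : Prop where
  measurable : ∀ i, Measurable (fun q : Profile N n × Vec d => S.J i q.1 q.2)
  integrable : ∀ i, ∀ x ∈ S.localSet, Integrable (S.J i x) S.P
  differentiable : ∀ i, ∀ x ∈ S.localSet, ∀ s,
    DifferentiableAt ℝ (fun y => S.J i (Function.update x i y) s) (x i)
  locally_lipschitz : ∀ i, ∀ x ∈ S.localSet, ∃ C : Vec d → ℝ, Integrable C S.P ∧
    ∃ r > 0, ∀ᵐ s ∂S.P, ∀ y ∈ Metric.ball (x i) r, ∀ y' ∈ Metric.ball (x i) r,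
      |S.J i (Function.update x i y) s - S.J i (Function.update x i y') s| ≤ C s * ‖y - y'‖

/-- The expected cost of each agent is convex and continuously differentiable in the own variable,
whenever the variables of the other agents come from a feasible profile. -/
structure ConvexCost : Prop where
  convex : ∀ i, ∀ x ∈ S.feasible,
    ConvexOn ℝ (S.Ω i) (fun y => S.cost i (Function.update x i y))
  differentiable : ∀ i, ∀ x ∈ S.feasible, ∀ y ∈ S.Ω i,
    DifferentiableAt ℝ (fun y => S.cost i (Function.update x i y)) y
  continuous_gradient : ∀ i, ∀ x ∈ S.feasible,
    ContinuousOn (gradient fun y => S.cost i (Function.update x i y)) (S.Ω i)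

/-- The pseudogradient is monotone and Lipschitz continuous (on the product of the local sets). -/
structure MonotoneLipschitz : Prop where
  monotone : ∀ x ∈ S.localSet, ∀ y ∈ S.localSet, 0 ≤ stackInner (S.F x - S.F y) (x - y)
  lipschitz : ∃ ℓ > 0, ∀ x ∈ S.localSet, ∀ y ∈ S.localSet,
    stackNorm (S.F x - S.F y) ≤ ℓ * stackNorm (x - y)

end SGNEP

/-- `w` is a symmetric weighted adjacency matrix of the undirected graph `G`. -/
structure IsWeightMatrix {N : ℕ} (G : SimpleGraph (Fin N)) (w : Fin N → Fin N → ℝ) : Prop where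
  symm : ∀ i j, w i j = w j i
  pos : ∀ i j, G.Adj i j → 0 < w i j
  zero : ∀ i j, ¬ G.Adj i j → w i j = 0

/-- The Euclidean projection onto `C` (meaningful for nonempty closed convex `C`). -/
def proj {p : ℕ} (C : Set (Vec p)) (x : Vec p) : Vec p :=
  Classical.epsilon fun y => y ∈ C ∧ ∀ z ∈ C, ‖y - x‖ ≤ ‖z - x‖

/-- The nonnegative orthant. -/
def orthant (p : ℕ) : Set (Vec p) := {v | ∀ l, 0 ≤ v l}

/-- Stacked primal, auxiliary and dual variables `(x, z, lam)`. -/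
abbrev State (N n m : ℕ) : Type := Profile N n × Profile N m × Profile N m

/-- The scalar coordinates of a state; there are `n N + 2 N m` of them. -/
abbrev Coord (N n m : ℕ) : Type := (Fin N × Fin n) ⊕ (Fin N × Fin m) ⊕ (Fin N × Fin m)

/-- The parameters of the algorithm: exponents and offsets of the step sizes and of the
regularization, agentwise step scalings and communication weights. -/
structure Params (N n m : ℕ) where
  a : ℝ
  b : ℝ
  η : ℝ
  ζ : Coord N n m → ℝ
  γ : Fin N → ℝ
  ν : Fin N → ℝ
  τ : Fin N → ℝ
  w : Fin N → Fin N → ℝ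

namespace Params

variable {N n m : ℕ} (p : Params N n m)

/-- The step sizes. -/
def α (k : ℕ) : ℝ := ((k : ℝ) + p.η) ^ (-p.a)

/-- The regularization of coordinate `c`. -/
def ε (k : ℕ) (c : Coord N n m) : ℝ := ((k : ℝ) + p.ζ c) ^ (-p.b)

/-- The smallest regularization at iteration `k`. -/
def εmin (k : ℕ) : ℝ := ⨅ c, p.ε k c

/-- The conditions on the parameters. -/
structure Valid : Prop where
  a_mem : p.a ∈ Set.Ioo (0 : ℝ) 1
  b_mem : p.b ∈ Set.Ioo (0 : ℝ) 1
  add_lt : p.a + p.b < 1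
  lt : p.b < p.a
  η_pos : 0 < p.η
  ζ_pos : ∀ c, 0 < p.ζ c
  γ_pos : ∀ i, 0 < p.γ i
  ν_pos : ∀ i, 0 < p.ν i
  τ_pos : ∀ i, 0 < p.τ i

end Params

/-- The coordinatewise product of a vector with regularization parameters. -/
def tik {p : ℕ} (e : Fin p → ℝ) (v : Vec p) : Vec p := WithLp.toLp 2 fun l => e l * v l

namespace SGNEP

variable {N n m d : ℕ} (S : SGNEP N n m d) (p : Params N n m)

/-- One iteration of the algorithm from the state `u`, agent `i` using the single sample `s i`. -/
def step (k : ℕ) (s : Fin N → Vec d) (u : State N n m) : State N n m :=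
  let x := u.1
  let z := u.2.1
  let lam := u.2.2
  (fun i => proj (S.Ω i) (x i - (p.α k * p.γ i) •
      (S.partialGrad i x (s i) + ContinuousLinearMap.adjoint (fderiv ℝ (S.g i) (x i)) (lam i)
        + tik (fun l => p.ε k (.inl (i, l))) (x i))),
   fun i => z i - (p.α k * p.ν i) •
      (∑ j, p.w i j • (lam i - lam j) + tik (fun l => p.ε k (.inr (.inl (i, l)))) (z i)),
   fun i => proj (orthant m) (lam i + (p.α k * p.τ i) •
      (S.g i (x i) - tik (fun l => p.ε k (.inr (.inr (i, l)))) (lam i)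
        + ∑ j, p.w i j • ((z i - z j) - (lam i - lam j)))))

variable {Θ : Type*} (X₀ : Θ → State N n m) (ξ : ℕ → Fin N → Θ → Vec d)

/-- The iterates of the algorithm, from the random initial state `X₀` and with the samples `ξ`. -/
def iterates : ℕ → Θ → State N n m
  | 0, θ => X₀ θ
  | k + 1, θ => S.step p k (fun i => ξ k i θ) (iterates k θ)

/-- The stochastic error of iteration `k` (its dual components vanish). -/
def error (k : ℕ) (θ : Θ) : Profile N n := fun i =>
  S.F (S.iterates p X₀ ξ k θ).1 i - S.partialGrad i (S.iterates p X₀ ξ k θ).1 (ξ k i θ)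

/-- The squared norm of the stochastic error induced by the matrix `Φ = diag(γ⁻¹, ν⁻¹, τ⁻¹)`. -/
def errorSq (k : ℕ) (θ : Θ) : ℝ := ∑ i, (p.γ i)⁻¹ * ‖S.error p X₀ ξ k θ i‖ ^ 2

end SGNEP

/-- The information available at iteration `k`: the initial state and the samples already used to
compute the iterates up to the `k`-th one. -/
abbrev info {N n m d : ℕ} {Θ : Type*} (X₀ : Θ → State N n m) (ξ : ℕ → Fin N → Θ → Vec d) (k : ℕ) :
    MeasurableSpace Θ :=
  MeasurableSpace.comap X₀ inferInstance ⊔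
    ⨆ (j : ℕ) (_ : j < k) (i : Fin N), MeasurableSpace.comap (ξ j i) inferInstance

/-- The random initial state is admissible, the samples are i.i.d. with law `P`, and they are
independent of the initial state. -/
structure IsSampling {N n m d : ℕ} (S : SGNEP N n m d) {Θ : Type*} [MeasurableSpace Θ]
    (μ : Measure Θ) (X₀ : Θ → State N n m) (ξ : ℕ → Fin N → Θ → Vec d) : Prop where
  measurable_init : Measurable X₀
  init_primal : ∀ θ i, (X₀ θ).1 i ∈ S.Ω i
  init_dual : ∀ θ i, (X₀ θ).2.2 i ∈ orthant m
  measurable_sample : ∀ k i, Measurable (ξ k i)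
  law : ∀ k i, μ.map (ξ k i) = S.P
  indep : iIndepFun (fun (q : ℕ × Fin N) θ => ξ q.1 q.2 θ) μ
  indep_init : IndepFun X₀ (fun θ (q : ℕ × Fin N) => ξ q.1 q.2 θ) μ

/-- The asymptotic conditions on the stochastic error. The conditional second moment is the
`[0, ∞]`-valued conditional expectation, so that no integrability is presupposed. -/
structure ErrorConditions {N n m d : ℕ} (S : SGNEP N n m d) (p : Params N n m) {Θ : Type*}
    [MeasurableSpace Θ] (μ : Measure Θ) (X₀ : Θ → State N n m) (ξ : ℕ → Fin N → Θ → Vec d) :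
    Prop where
  ratio : ∀ᵐ θ ∂μ, Tendsto (fun k => ENNReal.ofReal (p.α k / p.εmin k) *
    condLExp (info X₀ ξ k) μ (fun θ' => ENNReal.ofReal (S.errorSq p X₀ ξ k θ')) θ) atTop (𝓝 0)
  summable : ∀ᵐ θ ∂μ, ∑' k, ENNReal.ofReal (p.α k ^ 2) *
    condLExp (info X₀ ξ k) μ (fun θ' => ENNReal.ofReal (S.errorSq p X₀ ξ k θ')) θ < ∞

end

/-! The optimality system of the variational inequality is written as an equilibrium problem: find
`u` in `dom` with `lagBif w u v ≥ 0` for all `v` in `dom`. Here `lagBif` is monotone, convex in `v`,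
and involves the constraints through the values of `g` only. Its equilibria carry consensus
multipliers and a variational primal part (`isSVISolution_of_lagBif_nonneg`). Conversely, Slater's
condition and solvability of Laplacian equations on a connected graph extend every variational
solution to an equilibrium (`exists_lagBif_nonneg`).

Monotonicity alone gives no contraction, so the iterates are compared with a moving target: the
solutions `y k` of the problems regularized with the parameters `ε k`. These exist
(`exists_regularized`). Since all parameters are asymptotically equal to one rate `κ`, the `y k`
converge to the equilibrium of least Euclidean norm (`exists_tendsto_regularized`), and consecutive
ones differ by `O(1/k)` (`exists_distSq_drift_le`).

Let `v k` be the squared weighted distance from the `k`-th iterate to `y k`. One iteration contracts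
it by `1 - ρ k`, where `ρ k` is proportional to `α k * κ k`, up to second order terms, the drift and
the noise (`exists_tracking_recursion`). The contractions have a divergent sum because `a + b < 1`.
The terms of size `α²` are negligible relative to `ρ` because `b < a`. The drift costs `1 / (ρ k²)`,
negligible relative to `ρ` again because `a + b < 1`.

The linear noise term is conditionally centred, but its variance grows with `v k`, on which no
moment bound is known. Divided by `δ + v k` it has conditional second moments bounded by a multiple
of `α²` times those of the error, which are summable. So the normalized series converges almost
surely (`ae_exists_tendsto_sum_noise`). Multiplying `v k + δ` by the exponential of the remainder of
that series removes the noise from the recursion. What is left is a pathwise argument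
(`tendsto_zero_of_recursion`) bounding `v k` eventually by a multiple of `δ`, for each `δ =
1/(q+1)`. Hence the iterates follow `y k` to its deterministic limit. -/

/-! ### Separation theorem for finite families of convex functions. -/

/-- Theorem of the alternative for finitely many convex functions: if they are nowhere
simultaneously negative on a convex set, some convex combination of them is nonnegative there. -/
theorem exists_stdSimplex_sum_nonneg {E ι : Type*} [AddCommGroup E] [Module ℝ E] [Fintype ι]
    {C : Set E} (hne : C.Nonempty) {f : ι → E → ℝ} (hf : ∀ i, ConvexOn ℝ C (f i))
    (hC : Convex ℝ C)
    (h : ∀ y ∈ C, ∃ i, 0 ≤ f i y) :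
    ∃ q ∈ stdSimplex ℝ ι, ∀ y ∈ C, 0 ≤ ∑ i, q i * f i y := by
  classical
  -- The vectors strictly above some value vector `(f i y)` form an open convex set, and the
  -- hypothesis says exactly that it misses the origin.
  set D : Set (ι → ℝ) := {c | ∃ y ∈ C, ∀ i, f i y < c i} with hD
  have hDo : IsOpen D := by
    have : D = ⋃ y ∈ C, ⋂ i, {c : ι → ℝ | f i y < c i} := by
      ext c; simp [hD]
    rw [this]
    refine isOpen_biUnion fun y _ => isOpen_iInter_of_finite fun i => ?_
    exact isOpen_lt continuous_const (continuous_apply i)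
  have hDc : Convex ℝ D := by
    rintro c ⟨y, hy, hyc⟩ c' ⟨y', hy', hyc'⟩ s t hs ht hst
    refine ⟨s • y + t • y', hC hy hy' hs ht hst, fun i => ?_⟩
    have h1 := (hf i).2 hy hy' hs ht hst
    have h2 : s * f i y + t * f i y' < s * c i + t * c' i := by
      rcases hs.eq_or_lt with rfl | hs
      · have : t = 1 := by linarith
        subst this
        simpa using hyc' i
      · have := mul_lt_mul_of_pos_left (hyc i) hs
        have := mul_le_mul_of_nonneg_left (hyc' i).le ht
        linarith
    simpa using h1.trans_lt (by simpa using h2)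
  have h0 : (0 : ι → ℝ) ∉ D := by
    rintro ⟨y, hy, hyc⟩
    obtain ⟨i, hi⟩ := h y hy
    exact absurd (hyc i) (by simpa using hi)
  obtain ⟨F, hF⟩ := geometric_hahn_banach_point_open hDc hDo h0
  have hF0 : ∀ c ∈ D, 0 < F c := by simpa using hF
  set r : ι → ℝ := fun i => F (Pi.single i 1) with hr
  have hFr : ∀ c, F c = ∑ i, r i * c i := by
    intro c
    conv_lhs => rw [← Finset.univ_sum_single c]
    rw [map_sum]
    refine Finset.sum_congr rfl fun i _ => ?_
    have : Pi.single i (c i) = c i • (Pi.single i 1 : ι → ℝ) := by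
      rw [← Pi.single_smul]; simp
    rw [this, map_smul, smul_eq_mul, mul_comm]
  have hle : ∀ y ∈ C, 0 ≤ ∑ i, r i * f i y := by
    intro y hy
    have : Tendsto (fun δ : ℝ => ∑ i, r i * (f i y + δ)) (𝓝[>] 0)
        (𝓝 (∑ i, r i * (f i y + 0))) := by
      refine Tendsto.mono_left (Continuous.tendsto ?_ 0) nhdsWithin_le_nhds
      fun_prop
    simp only [add_zero] at this
    refine ge_of_tendsto this ?_
    filter_upwards [self_mem_nhdsWithin] with δ hδ
    have := hF0 (fun i => f i y + δ) ⟨y, hy, fun i => by simpa using hδ⟩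
    rw [hFr] at this
    exact this.le
  obtain ⟨y₀, hy₀⟩ := hne
  have hr0 : ∀ i, 0 ≤ r i := by
    intro i
    by_contra hi
    push Not at hi
    have hpos : ∀ t : ℝ, 0 ≤ t →
        0 < F (fun j => f j y₀ + 1) + t * r i := by
      intro t ht
      have := hF0 ((fun j => f j y₀ + 1) + t • Pi.single i 1) ⟨y₀, hy₀, fun j => by
        rcases eq_or_ne j i with rfl | hj
        · simp; linarith
        · simp [hj]⟩
      rw [map_add, map_smul] at this
      exact this
    set A := F (fun j => f j y₀ + 1)
    have hA : 0 < A := by simpa using hpos 0 le_rfl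
    -- At this `t` the affine function `A + t * r i` vanishes, although it should be positive.
    have := hpos (A / -r i) (div_nonneg hA.le (by linarith))
    have h2 : A / -r i * r i = -A := by
      rw [div_neg, neg_mul, div_mul_cancel₀ _ hi.ne]
    linarith
  have hsum : 0 < ∑ i, r i := by
    refine (Finset.sum_nonneg fun i _ => hr0 i).lt_of_ne fun h => ?_
    have hz := (Finset.sum_eq_zero_iff_of_nonneg fun i _ => hr0 i).1 h.symm
    have := hF0 (fun j => f j y₀ + 1) ⟨y₀, hy₀, fun j => by simp⟩
    rw [hFr, Finset.sum_eq_zero] at this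
    · exact this.false
    · intro i hi
      rw [hz i hi, zero_mul]
  refine ⟨fun i => r i / ∑ j, r j, ⟨fun i => div_nonneg (hr0 i) hsum.le, ?_⟩, fun y hy => ?_⟩
  · rw [← Finset.sum_div, div_self hsum.ne']
  · have : ∑ i, r i / (∑ j, r j) * f i y = (∑ i, r i * f i y) / ∑ j, r j := by
      rw [Finset.sum_div]
      exact Finset.sum_congr rfl fun i _ => by ring
    rw [this]
    exact div_nonneg (hle y hy) hsum.le

/-! ### Monotone equilibrium problems and their Tikhonov regularization. -/

/-- Monotone bifunctions on a closed convex set, convex and continuous in the second argument and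
continuous in the first one. -/
structure IsMonotoneBifunction {E : Type*} [NormedAddCommGroup E] [NormedSpace ℝ E]
    (C : Set E) (B : E → E → ℝ) : Prop where
  nonempty : C.Nonempty
  closed : IsClosed C
  convex : Convex ℝ C
  diag : ∀ u ∈ C, B u u = 0
  monotone : ∀ u ∈ C, ∀ v ∈ C, B u v + B v u ≤ 0
  convexOn : ∀ u ∈ C, ConvexOn ℝ C (B u)
  continuousOn_left : ∀ v ∈ C, ContinuousOn (fun u => B u v) C
  continuousOn_right : ∀ u ∈ C, ContinuousOn (B u) C

theorem exists_pos_forall_le {ι : Type*} [Finite ι] (e : ι → ℝ) (he : ∀ c, 0 < e c) :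
    ∃ r > 0, ∀ c, r ≤ e c := by
  rcases isEmpty_or_nonempty ι with h | h
  · exact ⟨1, one_pos, fun c => h.elim c⟩
  · obtain ⟨c, hc⟩ := Finite.exists_min e
    exact ⟨e c, he c, hc⟩

theorem norm_sq_le_sum_sq {ι : Type*} [Fintype ι] (w : ι → ℝ) : ‖w‖ ^ 2 ≤ ∑ c, w c ^ 2 := by
  have hS : 0 ≤ ∑ c, w c ^ 2 := Finset.sum_nonneg fun c _ => sq_nonneg _
  have : ‖w‖ ≤ Real.sqrt (∑ c, w c ^ 2) := by
    refine (pi_norm_le_iff_of_nonneg (Real.sqrt_nonneg _)).2 fun c => ?_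
    refine Real.abs_le_sqrt ?_
    exact Finset.single_le_sum (f := fun c => w c ^ 2) (fun c _ => sq_nonneg _) (Finset.mem_univ c)
  calc ‖w‖ ^ 2 ≤ Real.sqrt (∑ c, w c ^ 2) ^ 2 := by gcongr
    _ = _ := Real.sq_sqrt hS

namespace IsMonotoneBifunction

variable {E ι : Type*} [NormedAddCommGroup E] [NormedSpace ℝ E] [Fintype ι]
  {C : Set E} {B : E → E → ℝ}

/-- On the unit ball around `v` compactness gives a minimum. Beyond it, the point of the segment at
distance one from `v` and convexity, with `B v v = 0`, bound `B v y` below by that minimum times the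
distance. A quadratic regularization therefore dominates `B v` at infinity. -/
theorem exists_linear_lower_bound [FiniteDimensional ℝ E] (hB : IsMonotoneBifunction C B) {v : E}
    (hv : v ∈ C) : ∃ m : ℝ, 0 ≤ m ∧ ∀ y ∈ C, -(m * (1 + ‖y - v‖)) ≤ B v y := by
  have hK : IsCompact (C ∩ Metric.closedBall v 1) :=
    (isCompact_closedBall v 1).inter_left hB.closed
  obtain ⟨y₀, -, hy₀⟩ := hK.exists_isMinOn ⟨v, hv, by simp⟩
    ((hB.continuousOn_right v hv).mono Set.inter_subset_left)
  have hmin : ∀ y ∈ C, ‖y - v‖ ≤ 1 → B v y₀ ≤ B v y := fun y hy h =>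
    hy₀ ⟨hy, by simpa [dist_eq_norm] using h⟩
  refine ⟨|B v y₀|, abs_nonneg _, fun y hy => ?_⟩
  have habs := neg_abs_le (B v y₀)
  have hn := norm_nonneg (y - v)
  have ha := abs_nonneg (B v y₀)
  rcases le_or_gt ‖y - v‖ 1 with h | h
  · have := hmin y hy h
    nlinarith
  · have hpos : 0 < ‖y - v‖ := by linarith
    set t := ‖y - v‖⁻¹ with ht
    have ht0 : 0 < t := inv_pos.2 hpos
    have ht1 : t ≤ 1 := inv_le_one_of_one_le₀ h.le
    have hw := hB.convex hv hy (sub_nonneg.2 ht1) ht0.le (by ring)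
    have hc := (hB.convexOn v hv).2 hv hy (sub_nonneg.2 ht1) ht0.le (by ring)
    have hwn : ‖(1 - t) • v + t • y - v‖ ≤ 1 := by
      have : (1 - t) • v + t • y - v = t • (y - v) := by module
      rw [this, norm_smul, Real.norm_of_nonneg ht0.le, ht, inv_mul_cancel₀ hpos.ne']
    have h1 := hmin _ hw hwn
    rw [hB.diag v hv] at hc
    simp only [smul_eq_mul, mul_zero, zero_add] at hc
    have h2 : ‖y - v‖ * (t * B v y) = B v y := by
      rw [← mul_assoc, ht, mul_inv_cancel₀ hpos.ne', one_mul]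
    have h3 : ‖y - v‖ * B v y₀ ≤ ‖y - v‖ * (t * B v y) := by gcongr; linarith
    rw [h2] at h3
    nlinarith

/-- Existence for the regularized equilibrium problem in the weak (Minty) form. -/
theorem exists_minty_regularized (hB : IsMonotoneBifunction C B) (φ : E ≃L[ℝ] (ι → ℝ))
    {e : ι → ℝ} (he : ∀ c, 0 < e c) :
    ∃ y ∈ C, ∀ v ∈ C, B v y ≤ ∑ c, e c * φ y c * (φ v c - φ y c) := by
  classical
  have : FiniteDimensional ℝ E := φ.symm.toLinearEquiv.finiteDimensional
  set f : E → E → ℝ := fun v y => B v y - ∑ c, e c * φ y c * (φ v c - φ y c) with hf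
  have hcont : ∀ v ∈ C, ContinuousOn (f v) C := fun v hv =>
    (hB.continuousOn_right v hv).sub (Continuous.continuousOn (by fun_prop))
  have hconv : ∀ v ∈ C, ConvexOn ℝ C (f v) := by
    intro v hv
    have hq : ConvexOn ℝ C (fun y => -∑ c, e c * φ y c * (φ v c - φ y c)) := by
      refine ⟨hB.convex, fun x _ y _ a b ha hb hab => ?_⟩
      have h : ∑ c, a * b * e c * (φ x c - φ y c) ^ 2 =
          a * (-∑ c, e c * φ x c * (φ v c - φ x c)) + b * (-∑ c, e c * φ y c * (φ v c - φ y c))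
          - (-∑ c, e c * φ (a • x + b • y) c * (φ v c - φ (a • x + b • y) c)) := by
        obtain rfl : b = 1 - a := by linarith
        rw [← Finset.sum_neg_distrib, ← Finset.sum_neg_distrib, ← Finset.sum_neg_distrib,
          Finset.mul_sum, Finset.mul_sum, ← Finset.sum_add_distrib, ← Finset.sum_sub_distrib]
        refine Finset.sum_congr rfl fun c _ => ?_
        simp only [map_add, map_smul, Pi.add_apply, Pi.smul_apply, smul_eq_mul]
        ring
      have h0 : 0 ≤ ∑ c, a * b * e c * (φ x c - φ y c) ^ 2 :=
        Finset.sum_nonneg fun c _ => by have := (he c).le; positivity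
      simp only [smul_eq_mul]
      linarith
    have h : f v = B v + fun y => -∑ c, e c * φ y c * (φ v c - φ y c) := by
      funext y
      simp only [hf, Pi.add_apply, sub_eq_add_neg]
    rw [h]
    exact (hB.convexOn v hv).add hq
  obtain ⟨v₀, hv₀⟩ := hB.nonempty
  -- The slack `1/(q+1)` provides the strict inequality needed for a contradiction below;
  -- intersecting over all `q` removes it.
  let K : C × ℕ → Set E := fun q => {y | y ∈ C ∧ f q.1 y ≤ 1 / ((q.2 : ℝ) + 1)}
  have hKc : ∀ q, IsClosed (K q) := fun q =>
    (hcont q.1 q.1.2).preimage_isClosed_of_isClosed hB.closed isClosed_Iic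
  have hKb : IsCompact (K (⟨v₀, hv₀⟩, 0)) := by
    obtain ⟨m, hm0, hm⟩ := hB.exists_linear_lower_bound hv₀
    obtain ⟨r, hr, hre⟩ := exists_pos_forall_le e he
    obtain ⟨A, hA⟩ : ∃ A : ℝ, A = ‖(φ.symm : (ι → ℝ) →L[ℝ] E)‖ := ⟨_, rfl⟩
    have hA0 : 0 ≤ A := hA ▸ norm_nonneg _
    have hle : ∀ w : E, ‖w‖ ≤ A * ‖φ w‖ := by
      intro w
      have := (φ.symm : (ι → ℝ) →L[ℝ] E).le_opNorm (φ w)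
      rw [hA]
      simpa using this
    set S := ∑ c, e c * |φ v₀ c| with hS
    have hS0 : 0 ≤ S := Finset.sum_nonneg fun c _ => mul_nonneg (he c).le (abs_nonneg _)
    refine Metric.isCompact_of_isClosed_isBounded (hKc _) ?_
    refine (Metric.isBounded_iff_subset_closedBall v₀).2 ⟨A * ((1 + m + (m * A + S)) / r + 1), ?_⟩
    rintro y ⟨hy, hfy⟩
    rw [Metric.mem_closedBall, dist_eq_norm]
    refine (hle _).trans ?_
    gcongr
    set N := ‖φ (y - v₀)‖ with hN
    have hN0 : 0 ≤ N := norm_nonneg _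
    have h1 := hm y hy
    have h2 : m * ‖y - v₀‖ ≤ m * (A * N) := by gcongr; exact hle _
    simp only [hf, CharP.cast_eq_zero, zero_add, div_one] at hfy
    have h3 : r * N ^ 2 - S * N ≤ -∑ c, e c * φ y c * (φ v₀ c - φ y c) := by
      calc r * N ^ 2 - S * N ≤ r * ∑ c, (φ (y - v₀) c) ^ 2 - ∑ c, e c * |φ v₀ c| * N := by
            rw [hS, Finset.sum_mul]
            gcongr
            exact norm_sq_le_sum_sq _
        _ = ∑ c, (r * (φ (y - v₀) c) ^ 2 - e c * |φ v₀ c| * N) := by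
            rw [Finset.mul_sum, Finset.sum_sub_distrib]
        _ ≤ ∑ c, -(e c * φ y c * (φ v₀ c - φ y c)) := by
            refine Finset.sum_le_sum fun c _ => ?_
            have h4 : |φ (y - v₀) c| ≤ N := norm_le_pi_norm (φ (y - v₀)) c
            have h5 : φ y c = φ v₀ c + φ (y - v₀) c := by simp
            have h6 : -(|φ v₀ c| * N) ≤ φ v₀ c * φ (y - v₀) c := by
              have := neg_abs_le (φ v₀ c * φ (y - v₀) c)
              rw [abs_mul] at this
              have h7 : |φ v₀ c| * |φ (y - v₀) c| ≤ |φ v₀ c| * N := by gcongr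
              linarith
            rw [h5]
            have h8 := mul_le_mul_of_nonneg_right (hre c) (sq_nonneg (φ (y - v₀) c))
            have h9 := mul_le_mul_of_nonneg_left h6 (he c).le
            nlinarith
        _ = _ := Finset.sum_neg_distrib _
    -- The regularization grows like `r N²` and the rest at most linearly; the leading `1` is the
    -- slack of the index `0`. For `N > 1` this forces `r N` below the sum of the coefficients,
    -- whence the radius.
    have h4 : r * N ^ 2 ≤ (1 + m) + (m * A + S) * N := by nlinarith
    by_contra hcon
    push Not at hcon
    have hx : 0 ≤ (1 + m + (m * A + S)) / r := by positivity
    have h5 : 1 + m + (m * A + S) < r * N := by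
      have : (1 + m + (m * A + S)) / r < N := by linarith
      rwa [div_lt_iff₀ hr, mul_comm N] at this
    have h6 : 1 < N := by linarith
    have : 0 ≤ m * A := by positivity
    nlinarith
  -- If finitely many sublevel sets had no common point, the theorem of the alternative would give
  -- weights `p` for which the combination of the `f v - slack` is nonnegative on all of `C`. At the
  -- barycentre `y` of the points `v` it is negative: convexity bounds the `B` part by a double sum
  -- that monotonicity makes nonpositive, the regularization averages to zero, and the slack is
  -- positive.
  have hfin : ∀ u : Finset (C × ℕ), (K (⟨v₀, hv₀⟩, 0) ∩ ⋂ q ∈ u, K q).Nonempty := by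
    intro u
    set I := insert ((⟨v₀, hv₀⟩, 0) : C × ℕ) u with hI
    by_contra hcon
    have hneg : ∀ y ∈ C, ∃ q : I, 0 ≤ f q.1.1 y - 1 / ((q.1.2 : ℝ) + 1) := by
      intro y hy
      by_contra h
      push Not at h
      refine hcon ⟨y, ⟨hy, ?_⟩, ?_⟩
      · exact (sub_neg.1 (h ⟨_, Finset.mem_insert_self _ _⟩)).le
      · simp only [Set.mem_iInter]
        exact fun q hq => ⟨hy, (sub_neg.1 (h ⟨q, Finset.mem_insert_of_mem hq⟩)).le⟩
    obtain ⟨p, ⟨hp0, hp1⟩, hp⟩ := exists_stdSimplex_sum_nonneg (C := C) ⟨v₀, hv₀⟩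
      (f := fun (q : I) y => f q.1.1 y - 1 / ((q.1.2 : ℝ) + 1))
      (fun q => by
        simp only [sub_eq_add_neg]
        exact (hconv _ q.1.1.2).add_const _) hB.convex hneg
    set y := ∑ q : I, p q • (q.1.1 : E) with hy
    have hyC : y ∈ C := hB.convex.sum_mem (fun q _ => hp0 q) hp1 fun q _ => q.1.1.2
    have h1 := hp y hyC
    have h2 : ∑ q : I, p q * B q.1.1 y ≤ 0 := by
      have h3 : ∀ q : I, p q * B q.1.1 y ≤ ∑ q' : I, p q * p q' * B q.1.1 q'.1.1 := by
        intro q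
        have := (hB.convexOn q.1.1 q.1.1.2).map_sum_le (t := Finset.univ) (w := p)
          (p := fun q' : I => (q'.1.1 : E)) (fun q' _ => hp0 q') hp1 (fun q' _ => q'.1.1.2)
        calc p q * B q.1.1 y ≤ p q * ∑ q' : I, p q' • B q.1.1 q'.1.1 :=
              mul_le_mul_of_nonneg_left this (hp0 q)
          _ = _ := by
              rw [Finset.mul_sum]
              exact Finset.sum_congr rfl fun _ _ => by rw [smul_eq_mul]; ring
      have h4 : ∑ q : I, p q * B q.1.1 y ≤ ∑ q : I, ∑ q' : I, p q * p q' * B q.1.1 q'.1.1 :=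
        Finset.sum_le_sum fun q _ => h3 q
      have h5 : ∑ q : I, ∑ q' : I, p q * p q' * B q.1.1 q'.1.1 =
          ∑ q : I, ∑ q' : I, p q * p q' * B q'.1.1 q.1.1 := by
        rw [Finset.sum_comm]
        exact Finset.sum_congr rfl fun _ _ => Finset.sum_congr rfl fun _ _ => by ring
      have h6 : ∑ q : I, ∑ q' : I, p q * p q' * B q.1.1 q'.1.1 +
          ∑ q : I, ∑ q' : I, p q * p q' * B q'.1.1 q.1.1 ≤ 0 := by
        rw [← Finset.sum_add_distrib]
        refine Finset.sum_nonpos fun q _ => ?_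
        rw [← Finset.sum_add_distrib]
        refine Finset.sum_nonpos fun q' _ => ?_
        rw [← mul_add]
        exact mul_nonpos_of_nonneg_of_nonpos (mul_nonneg (hp0 q) (hp0 q'))
          (hB.monotone _ q.1.1.2 _ q'.1.1.2)
      linarith
    have h3 : ∑ q : I, p q * ∑ c, e c * φ y c * (φ (q.1.1 : E) c - φ y c) = 0 := by
      have hyc : ∀ c, ∑ q : I, p q * (φ (q.1.1 : E) c - φ y c) = 0 := by
        intro c
        simp only [mul_sub, Finset.sum_sub_distrib]
        rw [← Finset.sum_mul, hp1, one_mul, hy, map_sum, Finset.sum_apply, sub_eq_zero]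
        exact Finset.sum_congr rfl fun q _ => by simp
      simp only [Finset.mul_sum]
      rw [Finset.sum_comm]
      refine Finset.sum_eq_zero fun c _ => ?_
      rw [← mul_zero (e c * φ y c), ← hyc c, Finset.mul_sum]
      exact Finset.sum_congr rfl fun q _ => by ring
    have h4 : 0 < ∑ q : I, p q * (1 / ((q.1.2 : ℝ) + 1)) := by
      obtain ⟨q, hq⟩ : ∃ q, 0 < p q := by
        by_contra h
        push Not at h
        have := Finset.sum_nonpos fun q (_ : q ∈ Finset.univ) => h q
        linarith
      refine Finset.sum_pos' (fun q _ => mul_nonneg (hp0 q) (by positivity))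
        ⟨q, Finset.mem_univ _, by positivity⟩
    have h5 : ∑ q : I, p q * (f q.1.1 y - 1 / ((q.1.2 : ℝ) + 1)) =
        ∑ q : I, p q * B q.1.1 y - ∑ q : I, p q * ∑ c, e c * φ y c * (φ (q.1.1 : E) c - φ y c) -
          ∑ q : I, p q * (1 / ((q.1.2 : ℝ) + 1)) := by
      rw [← Finset.sum_sub_distrib, ← Finset.sum_sub_distrib]
      exact Finset.sum_congr rfl fun q _ => by simp only [hf]; ring
    linarith
  obtain ⟨y, ⟨hyC, -⟩, hy⟩ := hKb.inter_iInter_nonempty K hKc hfin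
  refine ⟨y, hyC, fun v hv => ?_⟩
  have h0 : f v y ≤ 0 := by
    refine ge_of_tendsto tendsto_one_div_add_atTop_nhds_zero_nat (Eventually.of_forall fun n => ?_)
    exact (Set.mem_iInter.1 hy (⟨v, hv⟩, n)).2
  exact sub_nonpos.1 h0

/-- Existence for the regularized equilibrium problem. -/
theorem exists_regularized (hB : IsMonotoneBifunction C B) (φ : E ≃L[ℝ] (ι → ℝ))
    {e : ι → ℝ} (he : ∀ c, 0 < e c) :
    ∃ y ∈ C, ∀ v ∈ C, 0 ≤ B y v + ∑ c, e c * φ y c * (φ v c - φ y c) := by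
  obtain ⟨y, hy, hmin⟩ := hB.exists_minty_regularized φ he
  refine ⟨y, hy, fun v hv => ?_⟩
  have hseg : ∀ t ∈ Set.Ioo (0 : ℝ) 1, (1 - t) • y + t • v ∈ C := fun t ht =>
    hB.convex hy hv (by linarith [ht.2]) ht.1.le (by ring)
  -- Minty's argument: `0 = B w w` is at most the convex combination of `B w y` and `B w v`; the
  -- weak inequality at `w` bounds `B w y` by `t` times the regularization, and `t` divides out.
  have hineq : ∀ t ∈ Set.Ioo (0 : ℝ) 1, 0 ≤ B ((1 - t) • y + t • v) v +
      (1 - t) * ∑ c, e c * φ y c * (φ v c - φ y c) := by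
    intro t ht
    set w := (1 - t) • y + t • v with hw
    have h1 := (hB.convexOn w (hseg t ht)).2 hy hv (sub_nonneg.2 ht.2.le) ht.1.le
      (sub_add_cancel 1 t)
    rw [← hw, hB.diag w (hseg t ht)] at h1
    have h2 := hmin w (hseg t ht)
    have h3 : ∑ c, e c * φ y c * (φ w c - φ y c) = t * ∑ c, e c * φ y c * (φ v c - φ y c) := by
      rw [Finset.mul_sum]
      refine Finset.sum_congr rfl fun c _ => ?_
      simp only [hw, map_add, map_smul, Pi.add_apply, Pi.smul_apply, smul_eq_mul]
      ring
    rw [h3] at h2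
    simp only [smul_eq_mul] at h1
    have h4 : (1 - t) * B w y ≤ (1 - t) * (t * ∑ c, e c * φ y c * (φ v c - φ y c)) :=
      mul_le_mul_of_nonneg_left h2 (by linarith [ht.2])
    have h5 : 0 ≤ t * (B w v + (1 - t) * ∑ c, e c * φ y c * (φ v c - φ y c)) := by nlinarith
    exact nonneg_of_mul_nonneg_right h5 ht.1
  have hIoo : Set.Ioo (0 : ℝ) 1 ∈ 𝓝[>] (0 : ℝ) := Ioo_mem_nhdsGT one_pos
  have htend : Tendsto (fun t : ℝ => (1 - t) • y + t • v) (𝓝[>] 0) (𝓝[C] y) := by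
    refine tendsto_nhdsWithin_iff.2 ⟨?_, by filter_upwards [hIoo] with t ht using hseg t ht⟩
    have : Continuous fun t : ℝ => (1 - t) • y + t • v := by fun_prop
    simpa using (this.tendsto 0).mono_left nhdsWithin_le_nhds
  have h1 := ((hB.continuousOn_left v hv) y hy).tendsto.comp htend
  have h2 : Tendsto (fun t : ℝ => (1 - t) * ∑ c, e c * φ y c * (φ v c - φ y c)) (𝓝[>] 0)
      (𝓝 ((1 - 0) * ∑ c, e c * φ y c * (φ v c - φ y c))) :=
    (Continuous.tendsto (by fun_prop) 0).mono_left nhdsWithin_le_nhds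
  rw [sub_zero, one_mul] at h2
  refine ge_of_tendsto (h1.add h2) ?_
  filter_upwards [hIoo] with t ht using hineq t ht

/-- A regularized solution is closer to the origin, in the weighted sense, than any solution. -/
theorem sum_mul_sub_nonneg (hB : IsMonotoneBifunction C B) (φ : E ≃L[ℝ] (ι → ℝ))
    {e : ι → ℝ} {y u : E} (hy : y ∈ C) (hu : u ∈ C) (hus : ∀ v ∈ C, 0 ≤ B u v)
    (hys : ∀ v ∈ C, 0 ≤ B y v + ∑ c, e c * φ y c * (φ v c - φ y c)) :
    0 ≤ ∑ c, e c * φ y c * (φ u c - φ y c) := by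
  linarith [hys u hu, hus y hy, hB.monotone y hy u hu]

/-- Two regularized solutions differ by at most the relative difference of the parameters. -/
theorem sum_sq_sub_le (hB : IsMonotoneBifunction C B) (φ : E ≃L[ℝ] (ι → ℝ))
    {e e' : ι → ℝ} {y y' : E} (hy : y ∈ C) (hy' : y' ∈ C)
    (hys : ∀ v ∈ C, 0 ≤ B y v + ∑ c, e c * φ y c * (φ v c - φ y c))
    (hys' : ∀ v ∈ C, 0 ≤ B y' v + ∑ c, e' c * φ y' c * (φ v c - φ y' c))
    {r D : ℝ} (hr : 0 < r) (hre : ∀ c, r ≤ e' c) (hD : ∀ c, |e c - e' c| ≤ D) :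
    r ^ 2 * ∑ c, (φ y' c - φ y c) ^ 2 ≤ D ^ 2 * ∑ c, φ y c ^ 2 := by
  have h1 := hys y' hy'
  have h2 := hys' y hy
  have h3 := hB.monotone y hy y' hy'
  -- With `x = φ y' - φ y`, the sum on the left is at most the cross term `(e - e') * φ y * x`;
  -- Young's inequality splits it so that half of `r * x²` is absorbed.
  have h4 : ∑ c, e c * φ y c * (φ y' c - φ y c) + ∑ c, e' c * φ y' c * (φ y c - φ y' c) +
      r * ∑ c, (φ y' c - φ y c) ^ 2 ≤ ∑ c, (r / 2 * (φ y' c - φ y c) ^ 2 + D ^ 2 / (2 * r) * φ y c ^ 2) := by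
    rw [← Finset.sum_add_distrib, Finset.mul_sum, ← Finset.sum_add_distrib]
    refine Finset.sum_le_sum fun c _ => ?_
    set x := φ y' c - φ y c with hx
    have hx' : φ y' c = φ y c + x := by rw [hx]; ring
    have h5 : r * x ^ 2 ≤ e' c * x ^ 2 := mul_le_mul_of_nonneg_right (hre c) (sq_nonneg _)
    have h6 : (e c - e' c) * φ y c * x ≤ r / 2 * x ^ 2 + D ^ 2 / (2 * r) * φ y c ^ 2 := by
      have h7 : (e c - e' c) ^ 2 ≤ D ^ 2 := sq_le_sq' (by linarith [(abs_le.1 (hD c)).1])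
        (abs_le.1 (hD c)).2
      have h8 : r / 2 * x ^ 2 + D ^ 2 / (2 * r) * φ y c ^ 2 - (e c - e' c) * φ y c * x =
          ((r * x - (e c - e' c) * φ y c) ^ 2 + (D ^ 2 - (e c - e' c) ^ 2) * φ y c ^ 2) /
            (2 * r) := by
        field_simp
        ring
      have h9 : 0 ≤ ((r * x - (e c - e' c) * φ y c) ^ 2 +
          (D ^ 2 - (e c - e' c) ^ 2) * φ y c ^ 2) / (2 * r) := by
        have := mul_nonneg (sub_nonneg.2 h7) (sq_nonneg (φ y c))
        positivity
      linarith
    rw [hx']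
    nlinarith
  rw [Finset.sum_add_distrib (f := fun c => r / 2 * (φ y' c - φ y c) ^ 2), ← Finset.mul_sum,
    ← Finset.mul_sum] at h4
  have h5 : r / 2 * ∑ c, (φ y' c - φ y c) ^ 2 ≤ D ^ 2 / (2 * r) * ∑ c, φ y c ^ 2 := by linarith
  have h6 := mul_le_mul_of_nonneg_left h5 (by positivity : 0 ≤ 2 * r)
  have h7 : 2 * r * (r / 2 * ∑ c, (φ y' c - φ y c) ^ 2) = r ^ 2 * ∑ c, (φ y' c - φ y c) ^ 2 := by
    ring
  have h8 : 2 * r * (D ^ 2 / (2 * r) * ∑ c, φ y c ^ 2) = D ^ 2 * ∑ c, φ y c ^ 2 := by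
    field_simp
  linarith

/-- Convergence of the Tikhonov trajectory. -/
theorem exists_tendsto_regularized (hB : IsMonotoneBifunction C B) (φ : E ≃L[ℝ] (ι → ℝ))
    {e : ℕ → ι → ℝ} {κ : ℕ → ℝ} (hκ : ∀ k, 0 < κ k) (hκ0 : Tendsto κ atTop (𝓝 0))
    (heκ : ∀ c, Tendsto (fun k => e k c / κ k) atTop (𝓝 1))
    {y : ℕ → E} (hy : ∀ k, y k ∈ C)
    (hys : ∀ k, ∀ v ∈ C, 0 ≤ B (y k) v + ∑ c, e k c * φ (y k) c * (φ v c - φ (y k) c))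
    {u : E} (hu : u ∈ C) (hus : ∀ v ∈ C, 0 ≤ B u v) :
    ∃ l ∈ C, (∀ v ∈ C, 0 ≤ B l v) ∧ Tendsto y atTop (𝓝 l) := by
  have he0 : ∀ c, Tendsto (fun k => e k c) atTop (𝓝 0) := by
    intro c
    have := (heκ c).mul hκ0
    simp only [one_mul] at this
    refine this.congr fun k => ?_
    rw [div_mul_cancel₀ _ (hκ k).ne']
  -- Every cluster point is an equilibrium and satisfies the inequality characterizing the point of
  -- least Euclidean norm among the equilibria: dividing by `κ` turns the weights into ones in the
  -- limit.
  have hcluster : ∀ (ψ : ℕ → ℕ) (l : E), Tendsto ψ atTop atTop →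
      Tendsto (fun j => y (ψ j)) atTop (𝓝 l) → l ∈ C ∧ (∀ v ∈ C, 0 ≤ B l v) ∧
      ∀ w ∈ C, (∀ v ∈ C, 0 ≤ B w v) → 0 ≤ ∑ c, φ l c * (φ w c - φ l c) := by
    intro ψ l hψ hl
    have hlC : l ∈ C := hB.closed.mem_of_tendsto hl (Eventually.of_forall fun j => hy _)
    have hφ : ∀ c, Tendsto (fun j => φ (y (ψ j)) c) atTop (𝓝 (φ l c)) := fun c =>
      (((continuous_apply c).comp φ.continuous).tendsto l).comp hl
    refine ⟨hlC, fun v hv => ?_, fun w hw hws => ?_⟩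
    · have h1 : Tendsto (fun j => B (y (ψ j)) v) atTop (𝓝 (B l v)) :=
        ((hB.continuousOn_left v hv) l hlC).tendsto.comp
          (tendsto_nhdsWithin_iff.2 ⟨hl, Eventually.of_forall fun j => hy _⟩)
      have h2 : Tendsto (fun j => ∑ c, e (ψ j) c * φ (y (ψ j)) c * (φ v c - φ (y (ψ j)) c)) atTop
          (𝓝 (∑ c, 0 * φ l c * (φ v c - φ l c))) :=
        tendsto_finsetSum _ fun c _ => (((he0 c).comp hψ).mul (hφ c)).mul ((hφ c).const_sub _)
      have h3 := h1.add h2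
      simp only [zero_mul, Finset.sum_const_zero, add_zero] at h3
      exact ge_of_tendsto h3 (Eventually.of_forall fun j => hys _ v hv)
    · have h2 : Tendsto (fun j => ∑ c, e (ψ j) c / κ (ψ j) * φ (y (ψ j)) c *
          (φ w c - φ (y (ψ j)) c)) atTop (𝓝 (∑ c, 1 * φ l c * (φ w c - φ l c))) :=
        tendsto_finsetSum _ fun c _ => (((heκ c).comp hψ).mul (hφ c)).mul ((hφ c).const_sub _)
      simp only [one_mul] at h2
      refine ge_of_tendsto h2 (Eventually.of_forall fun j => ?_)
      have h3 := hB.sum_mul_sub_nonneg φ (hy (ψ j)) hw hws (hys (ψ j))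
      have h4 : ∑ c, e (ψ j) c / κ (ψ j) * φ (y (ψ j)) c * (φ w c - φ (y (ψ j)) c) =
          (∑ c, e (ψ j) c * φ (y (ψ j)) c * (φ w c - φ (y (ψ j)) c)) / κ (ψ j) := by
        rw [Finset.sum_div]
        exact Finset.sum_congr rfl fun c _ => by ring
      rw [h4]
      exact div_nonneg h3 (hκ _).le
  -- Eventually the weights lie between `κ/2` and `2κ`, so that `e * y * (u - y) ≤ κ * u² - κ/4 *
  -- y²`; the ratio of the two coefficients is the `4`.
  set R := Real.sqrt (4 * ∑ c, φ u c ^ 2) with hR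
  have hbd : ∀ᶠ k in atTop, y k ∈ φ ⁻¹' Metric.closedBall 0 R := by
    have h1 : ∀ᶠ k in atTop, ∀ c, e k c / κ k ∈ Set.Ioo (1 / 2 : ℝ) 2 :=
      eventually_all.2 fun c => (heκ c).eventually (Ioo_mem_nhds (by norm_num) (by norm_num))
    filter_upwards [h1] with k hk
    have h2 := hB.sum_mul_sub_nonneg φ (hy k) hu hus (hys k)
    have h3 : ∑ c, φ (y k) c ^ 2 ≤ 4 * ∑ c, φ u c ^ 2 := by
      have h4 : 0 ≤ ∑ c, (-(κ k / 4) * φ (y k) c ^ 2 + κ k * φ u c ^ 2) := by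
        refine h2.trans (Finset.sum_le_sum fun c _ => ?_)
        have h5 := (lt_div_iff₀ (hκ k)).1 (hk c).1
        have h6 := (div_lt_iff₀ (hκ k)).1 (hk c).2
        have h7 : 0 ≤ e k c := by linarith [hκ k]
        have h8 := mul_nonneg h7 (sq_nonneg (φ (y k) c - φ u c))
        have h9 := mul_nonneg (sub_nonneg.2 h5.le) (sq_nonneg (φ (y k) c))
        have h10 := mul_nonneg (sub_nonneg.2 h6.le) (sq_nonneg (φ u c))
        nlinarith
      rw [Finset.sum_add_distrib, ← Finset.mul_sum, ← Finset.mul_sum] at h4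
      have : 0 ≤ κ k * (4 * ∑ c, φ u c ^ 2 - ∑ c, φ (y k) c ^ 2) := by linarith
      have := nonneg_of_mul_nonneg_right this (hκ k)
      linarith
    simp only [Set.mem_preimage, Metric.mem_closedBall, dist_zero_right]
    exact Real.le_sqrt_of_sq_le ((norm_sq_le_sum_sq _).trans h3)
  have hK : IsCompact (φ ⁻¹' Metric.closedBall 0 R) :=
    φ.toHomeomorph.isCompact_preimage.2 (isCompact_closedBall _ _)
  obtain ⟨l, -, ψ, hψ, hl⟩ := hK.tendsto_subseq' hbd.frequently
  obtain ⟨hlC, hls, hlm⟩ := hcluster ψ l hψ.tendsto_atTop hl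
  refine ⟨l, hlC, hls, tendsto_of_subseq_tendsto fun ns hns => ?_⟩
  obtain ⟨l', -, ms, hms, hl'⟩ := hK.tendsto_subseq' (hns.eventually hbd).frequently
  obtain ⟨hlC', hls', hlm'⟩ := hcluster (ns ∘ ms) l' (hns.comp hms.tendsto_atTop) hl'
  have h1 := hlm l' hlC' hls'
  have h2 := hlm' l hlC hls
  -- Two cluster points are each tested in the inequality of the other; the sum of both is minus
  -- their squared distance.
  have h3 : ∑ c, (φ l c - φ l' c) ^ 2 ≤ 0 := by
    have : ∑ c, (φ l c - φ l' c) ^ 2 =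
        -(∑ c, φ l c * (φ l' c - φ l c) + ∑ c, φ l' c * (φ l c - φ l' c)) := by
      rw [← Finset.sum_add_distrib, ← Finset.sum_neg_distrib]
      exact Finset.sum_congr rfl fun c _ => by ring
    linarith
  have h4 : l = l' := by
    refine φ.injective (funext fun c => ?_)
    have := (Finset.sum_eq_zero_iff_of_nonneg fun c _ => sq_nonneg (φ l c - φ l' c)).1
      (le_antisymm h3 (Finset.sum_nonneg fun c _ => sq_nonneg _)) c (Finset.mem_univ c)
    exact sub_eq_zero.1 (pow_eq_zero_iff two_ne_zero |>.1 this)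
  exact ⟨ms, h4 ▸ hl'⟩

end IsMonotoneBifunction

/-! ### Deterministic recursions. -/

/-- Adding the tail of the series `s` to `W` absorbs the perturbation. Once the tail is below `r/2`,
the sum minus `r/2` obeys the homogeneous recursion and is dominated by the exponential of minus the
partial sums of `a`. The maximum with `0` in the bound is there because `W` may be negative. -/
theorem eventually_le_of_le_one_sub_mul_add {W a s : ℕ → ℝ} (ha0 : ∀ k, 0 ≤ a k)
    (ha1 : ∀ k, a k ≤ 1) (ha : Tendsto (fun k => ∑ j ∈ Finset.range k, a j) atTop atTop)
    (hs : Summable s) (hs0 : ∀ k, 0 ≤ s k)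
    (hW : ∀ᶠ k in atTop, W (k + 1) ≤ (1 - a k) * W k + s k) {r : ℝ} (hr : 0 < r) :
    ∀ᶠ k in atTop, W k ≤ r := by
  set T : ℕ → ℝ := fun k => ∑' j, s j - ∑ j ∈ Finset.range k, s j with hT
  have hT0 : Tendsto T atTop (𝓝 0) := by
    have := hs.hasSum.tendsto_sum_nat.const_sub (∑' j, s j)
    rwa [sub_self] at this
  have hTn : ∀ k, 0 ≤ T k := fun k => sub_nonneg.2 (hs.sum_le_tsum _ fun j _ => hs0 j)
  have hTs : ∀ k, T (k + 1) = T k - s k := fun k => by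
    simp only [hT, Finset.sum_range_succ]; ring
  obtain ⟨K, hK⟩ := eventually_atTop.1 (hW.and (hT0.eventually (ge_mem_nhds (half_pos hr))))
  set Y : ℕ → ℝ := fun k => W k + T k - r / 2 with hY
  have hYs : ∀ k, K ≤ k → Y (k + 1) ≤ (1 - a k) * Y k := by
    intro k hk
    obtain ⟨h1, h2⟩ := hK k hk
    have h3 := mul_le_mul_of_nonneg_left h2 (ha0 k)
    simp only [hY, hTs]
    nlinarith
  set A := ∑ j ∈ Finset.range K, a j with hA
  have hbd : ∀ k, K ≤ k →
      Y k ≤ max (Y K) 0 * Real.exp (A - ∑ j ∈ Finset.range k, a j) := by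
    intro k hk
    induction k, hk using Nat.le_induction with
    | base => simp [hA]
    | succ k hk ih =>
      have h1 : 1 - a k ≤ Real.exp (-a k) := by
        have := Real.add_one_le_exp (-a k); linarith
      calc Y (k + 1) ≤ (1 - a k) * Y k := hYs k hk
        _ ≤ (1 - a k) * (max (Y K) 0 * Real.exp (A - ∑ j ∈ Finset.range k, a j)) :=
            mul_le_mul_of_nonneg_left ih (sub_nonneg.2 (ha1 k))
        _ ≤ Real.exp (-a k) * (max (Y K) 0 * Real.exp (A - ∑ j ∈ Finset.range k, a j)) := by
            gcongr
        _ = _ := by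
            rw [Finset.sum_range_succ, mul_left_comm, ← Real.exp_add]
            ring_nf
  have hlim : Tendsto (fun k => max (Y K) 0 * Real.exp (A - ∑ j ∈ Finset.range k, a j)) atTop
      (𝓝 0) := by
    have h1 : Tendsto (fun k => A - ∑ j ∈ Finset.range k, a j) atTop atBot := by
      simp only [sub_eq_add_neg]
      exact tendsto_atBot_add_const_left _ A (tendsto_neg_atTop_atBot.comp ha)
    simpa using (Real.tendsto_exp_atBot.comp h1).const_mul (max (Y K) 0)
  filter_upwards [eventually_ge_atTop K, hlim.eventually (ge_mem_nhds (half_pos hr))] with k hk h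
  have h1 := (hbd k hk).trans h
  have h2 := hTn k
  simp only [hY] at h1
  linarith

/-- A perturbed contraction recursion tends to zero if the perturbations are a relatively small
part, a summable part, and a part whose normalized series converge. -/
theorem tendsto_zero_of_recursion {v θ c M s : ℕ → ℝ} (hv : ∀ k, 0 ≤ v k) (hθ0 : ∀ k, 0 < θ k)
    (hθ1 : ∀ k, θ k ≤ 1) (hθ : Tendsto (fun k => ∑ j ∈ Finset.range k, θ j) atTop atTop)
    (hc : Tendsto (fun k => c k / θ k) atTop (𝓝 0))
    (hs : Summable s) (hs0 : ∀ k, 0 ≤ s k)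
    (hrec : ∀ k, v (k + 1) ≤ (1 - θ k) * v k + c k * (1 + v k) + M k + s k)
    (hM : ∀ q : ℕ, ∃ l, Tendsto (fun k => ∑ j ∈ Finset.range k, M j / (1 / ((q : ℝ) + 1) + v j))
      atTop (𝓝 l)) :
    Tendsto v atTop (𝓝 0) := by
  suffices h : ∀ q : ℕ, ∀ᶠ k in atTop, v k ≤ 34 * (1 / ((q : ℝ) + 1)) by
    refine tendsto_order.2 ⟨fun a ha => Eventually.of_forall fun k => ha.trans_le (hv k),
      fun a ha => ?_⟩
    have := tendsto_one_div_add_atTop_nhds_zero_nat.const_mul (34 : ℝ)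
    rw [mul_zero] at this
    obtain ⟨q, hq⟩ := (this.eventually (gt_mem_nhds ha)).exists
    exact (h q).mono fun k hk => hk.trans_lt hq
  intro q
  set δ : ℝ := 1 / ((q : ℝ) + 1) with hδ
  have hδ0 : 0 < δ := by positivity
  have hδ1 : δ ≤ 1 := by
    rw [hδ, div_le_one (by positivity)]
    have : (0 : ℝ) ≤ q := q.cast_nonneg
    linarith
  obtain ⟨l, hl⟩ := hM q
  set E : ℕ → ℝ := fun k => l - ∑ j ∈ Finset.range k, M j / (δ + v j) with hE
  have hE0 : Tendsto E atTop (𝓝 0) := by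
    have := hl.const_sub l
    rwa [sub_self] at this
  have hEs : ∀ k, E (k + 1) = E k - M k / (δ + v k) := fun k => by
    simp only [hE, Finset.sum_range_succ]; ring
  -- As `E (k+1) = E k - m` with `m` the normalized noise, and `1 + m ≤ exp m`, the factor `exp (E
  -- k)` compensates the multiplicative noise `1 + m`. It tends to one, so `w` and `v + δ` are
  -- comparable.
  set w : ℕ → ℝ := fun k => (v k + δ) * Real.exp (E k) with hw
  have hexp : ∀ᶠ k in atTop, Real.exp (E k) ∈ Set.Ioo (1 / 2 : ℝ) 2 := by
    have : Tendsto (fun k => Real.exp (E k)) atTop (𝓝 1) := by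
      simpa [Function.comp_def] using (Real.continuous_exp.tendsto 0).comp hE0
    exact this.eventually (Ioo_mem_nhds (by norm_num) (by norm_num))
  have hexp' := (tendsto_add_atTop_nat 1).eventually hexp
  have hcs : ∀ᶠ k in atTop, c k / θ k ≤ δ / 2 := hc.eventually (ge_mem_nhds (half_pos hδ0))
  -- The errors of size `δ * θ` add up to at most `2 * δ * θ`, and `16 * δ` is where they balance
  -- the contraction `θ / 8`. The conclusion `w ≤ 17 * δ` then gives `v ≤ 34 * δ`, since `exp (E k)
  -- > 1/2`.
  have hWrec : ∀ᶠ k in atTop,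
      w (k + 1) - 16 * δ ≤ (1 - θ k / 8) * (w k - 16 * δ) + 2 * s k := by
    filter_upwards [hexp, hexp', hcs] with k h1 h2 h3
    have h3' : c k ≤ δ / 2 * θ k := (div_le_iff₀ (hθ0 k)).1 h3
    have hVpos : 0 < δ + v k := by linarith [hv k]
    set m := M k / (δ + v k) with hm
    have hMm : M k = m * (v k + δ) := by rw [hm, add_comm (v k), div_mul_cancel₀ _ hVpos.ne']
    have hθv := mul_nonneg (hθ0 k).le (hv k)
    have hcv : c k * (1 + v k) ≤ δ / 2 * θ k + θ k / 2 * v k := by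
      have h4 := mul_le_mul_of_nonneg_right h3' (by linarith [hv k] : 0 ≤ 1 + v k)
      have h5 := mul_le_mul_of_nonneg_right hδ1 hθv
      nlinarith
    have h4 : v (k + 1) + δ ≤ (v k + δ) * (1 + m) - θ k / 2 * (v k + δ) + δ * θ k + s k := by
      have := hrec k
      rw [hMm] at this
      nlinarith
    have h5 : Real.exp (E (k + 1)) * (1 + m) ≤ Real.exp (E k) := by
      have h6 := Real.add_one_le_exp m
      calc Real.exp (E (k + 1)) * (1 + m) ≤ Real.exp (E (k + 1)) * Real.exp m := by
            gcongr; linarith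
        _ = Real.exp (E k) := by rw [← Real.exp_add, hEs]; congr 1; ring
    set x := Real.exp (E (k + 1)) with hx
    have h6 : w (k + 1) ≤ x * ((v k + δ) * (1 + m) - θ k / 2 * (v k + δ) + δ * θ k + s k) := by
      rw [hw]
      simp only
      rw [mul_comm]
      exact mul_le_mul_of_nonneg_left h4 (Real.exp_pos _).le
    have h7 : x * ((v k + δ) * (1 + m)) ≤ w k := by
      have := mul_le_mul_of_nonneg_left h5 (by linarith : 0 ≤ v k + δ)
      simp only [hw]
      linarith
    have h8 : w k ≤ 2 * (v k + δ) := by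
      have := mul_le_mul_of_nonneg_left h1.2.le (by linarith : 0 ≤ v k + δ)
      simp only [hw]
      linarith
    have h9 : θ k / 8 * w k ≤ x * (θ k / 2 * (v k + δ)) := by
      have h10 : θ k / 8 * w k ≤ θ k / 8 * (2 * (v k + δ)) :=
        mul_le_mul_of_nonneg_left h8 (by linarith [hθ0 k])
      have h11 : 1 / 2 * (θ k / 2 * (v k + δ)) ≤ x * (θ k / 2 * (v k + δ)) :=
        mul_le_mul_of_nonneg_right h2.1.le
          (mul_nonneg (by linarith [hθ0 k]) (by linarith))
      linarith
    have h12 : x * (δ * θ k + s k) ≤ 2 * (δ * θ k + s k) :=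
      mul_le_mul_of_nonneg_right h2.2.le
        (add_nonneg (mul_nonneg hδ0.le (hθ0 k).le) (hs0 k))
    nlinarith
  have hθ8 : Tendsto (fun k => ∑ j ∈ Finset.range k, θ j / 8) atTop atTop := by
    simp only [← Finset.sum_div]
    exact hθ.atTop_div_const (by norm_num)
  have hfin := eventually_le_of_le_one_sub_mul_add (W := fun k => w k - 16 * δ)
    (a := fun k => θ k / 8) (s := fun k => 2 * s k)
    (fun k => by linarith [hθ0 k]) (fun k => by linarith [hθ1 k]) hθ8 (hs.mul_left 2)
    (fun k => by linarith [hs0 k]) hWrec hδ0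
  filter_upwards [hfin, hexp] with k h1 h2
  have h3 : 1 / 2 * (v k + δ) ≤ w k := by
    simp only [hw]
    have := mul_le_mul_of_nonneg_left h2.1.le (by linarith [hv k] : 0 ≤ v k + δ)
    linarith
  linarith

/-! ### Series of conditionally centred terms under summable conditional moments. -/

section Noise

variable {Θ : Type*} {mΘ : MeasurableSpace Θ} {μ : Measure Θ}
  {ℱ : Filtration ℕ mΘ}

/-- Almost sure convergence of square-summable martingale difference series. -/
theorem ae_exists_tendsto_sum_of_sq_le [IsProbabilityMeasure μ]
    {h : ℕ → Θ → ℝ}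
    (hmeas : ∀ k, StronglyMeasurable[ℱ (k + 1)] (h k)) (hL2 : ∀ k, MemLp (h k) 2 μ)
    (hzero : ∀ k A, MeasurableSet[ℱ k] A → ∫ θ in A, h k θ ∂μ = 0)
    {R : ℝ} (hbd : ∀ n, ∑ k ∈ Finset.range n, ∫ θ, h k θ ^ 2 ∂μ ≤ R) :
    ∀ᵐ θ ∂μ, ∃ l, Tendsto (fun n => ∑ k ∈ Finset.range n, h k θ) atTop (𝓝 l) := by
  set M : ℕ → Θ → ℝ := fun n θ => ∑ k ∈ Finset.range n, h k θ with hM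
  have hMs : ∀ n, M (n + 1) = M n + h n := fun n => by
    funext θ; simp [hM, Finset.sum_range_succ]
  have hMmeas : StronglyAdapted ℱ M := fun n =>
    Finset.stronglyMeasurable_fun_sum _ fun k hk =>
      (hmeas k).mono (ℱ.mono (Nat.succ_le_of_lt (Finset.mem_range.1 hk)))
  have hML2 : ∀ n, MemLp (M n) 2 μ := fun n => memLp_finsetSum _ fun k _ => hL2 k
  have hint : ∀ k, Integrable (h k) μ := fun k => (hL2 k).integrable one_le_two
  have hMint : ∀ n, Integrable (M n) μ := fun n => (hML2 n).integrable one_le_two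
  have hmart : Martingale M ℱ μ := by
    refine martingale_of_setIntegral_eq_succ hMmeas hMint fun n A hA => ?_
    rw [hMs]
    simp only [Pi.add_apply]
    rw [integral_add (hMint n).integrableOn (hint n).integrableOn, hzero n A hA, add_zero]
  have hcond : ∀ n, μ[h n | ℱ n] =ᵐ[μ] 0 := by
    intro n
    refine (ae_eq_condExp_of_forall_setIntegral_eq (ℱ.le n) (hint n)
      (fun s _ _ => integrableOn_zero) (fun s hs _ => ?_)
      aestronglyMeasurable_zero).symm
    rw [hzero n s hs]
    simp
  have hortho : ∀ n, ∫ θ, M n θ * h n θ ∂μ = 0 := by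
    intro n
    have hi : Integrable (M n * h n) μ := (hML2 n).integrable_mul (hL2 n)
    have h1 := condExp_mul_of_stronglyMeasurable_left (hMmeas n) hi (hint n)
    have h2 : ∫ θ, (M n * h n) θ ∂μ = 0 := by
      rw [← integral_condExp (ℱ.le n), integral_congr_ae h1]
      refine integral_eq_zero_of_ae ?_
      filter_upwards [hcond n] with θ hθ
      simp [hθ]
    exact h2
  -- The increments are orthogonal, so second moments add up. They bound the first moments by `|x| ≤
  -- 1 + x²`, as the submartingale convergence theorem requires.
  have hsq : ∀ n, ∫ θ, M n θ ^ 2 ∂μ = ∑ k ∈ Finset.range n, ∫ θ, h k θ ^ 2 ∂μ := by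
    intro n
    induction n with
    | zero => simp [hM]
    | succ n ih =>
      have hi : Integrable (fun θ => M n θ * h n θ) μ := (hML2 n).integrable_mul (hL2 n)
      have h1 : ∀ θ, M (n + 1) θ ^ 2 = M n θ ^ 2 + 2 * (M n θ * h n θ) + h n θ ^ 2 := fun θ => by
        rw [hMs, Pi.add_apply]; ring
      simp only [h1]
      have hi2 := (hML2 n).integrable_sq
      rw [integral_add (f := fun θ => M n θ ^ 2 + 2 * (M n θ * h n θ))
        (hi2.add (hi.const_mul 2)) (hL2 n).integrable_sq, integral_add hi2 (hi.const_mul 2), integral_const_mul, hortho, Finset.sum_range_succ, ih]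
      ring
  refine hmart.submartingale.exists_ae_tendsto_of_bdd (R := Real.toNNReal (1 + R)) fun n => ?_
  rw [eLpNorm_one_eq_lintegral_enorm, ← ofReal_integral_norm_eq_lintegral_enorm (hMint n)]
  refine ENNReal.ofReal_le_ofReal ?_
  calc ∫ θ, ‖M n θ‖ ∂μ ≤ ∫ θ, (1 + M n θ ^ 2) ∂μ := by
        refine integral_mono (hMint n).norm ((integrable_const 1).add (hML2 n).integrable_sq)
          fun θ => ?_
        simp only [Real.norm_eq_abs]
        rcases abs_cases (M n θ) with h | h <;> nlinarith [sq_nonneg (M n θ - 1),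
          sq_nonneg (M n θ + 1)]
    _ = 1 + ∫ θ, M n θ ^ 2 ∂μ := by
        rw [integral_add (integrable_const 1) (hML2 n).integrable_sq]; simp
    _ ≤ 1 + R := by rw [hsq]; linarith [hbd n]

/-- The event that the first `k + 1` conditional expectations sum to at most `R`. -/
def condSumLe (ℱ : Filtration ℕ mΘ) (μ : Measure Θ) (g : ℕ → Θ → ℝ≥0∞) (R : ℝ≥0∞) (k : ℕ) :
    Set Θ :=
  {θ | ∑ j ∈ Finset.range (k + 1), condLExp (ℱ j) μ (g j) θ ≤ R}

/-- The event looks at the index `k` itself but is known at time `k`, since the `k`-th conditional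
expectation is. Truncating with it therefore preserves conditional centring. -/
theorem measurableSet_condSumLe (g : ℕ → Θ → ℝ≥0∞) (R : ℝ≥0∞) (k : ℕ) :
    MeasurableSet[ℱ k] (condSumLe ℱ μ g R k) := by
  have : Measurable[ℱ k] fun θ =>
      ∑ j ∈ Finset.range (k + 1), condLExp (ℱ j) μ (g j) θ :=
    Finset.measurable_fun_sum _ fun j hj => (measurable_condLExp (ℱ j) μ (g j)).mono
      (ℱ.mono (Nat.lt_succ_iff.1 (Finset.mem_range.1 hj))) le_rfl
  exact this measurableSet_Iic

/-- On an event known at time `k` the term may be replaced by its conditional expectation.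
Pointwise, the truncated sum of these is at most `R`: either the last event occurs and bounds the
whole sum, or the last term drops out. -/
theorem sum_setLIntegral_condSumLe [IsProbabilityMeasure μ] (g : ℕ → Θ → ℝ≥0∞) (R : ℝ≥0∞)
    (n : ℕ) :
    ∑ k ∈ Finset.range n, ∫⁻ θ in condSumLe ℱ μ g R k, g k θ ∂μ ≤ R := by
  have h1 : ∀ k, ∫⁻ θ in condSumLe ℱ μ g R k, g k θ ∂μ =
      ∫⁻ θ, (condSumLe ℱ μ g R k).indicator (condLExp (ℱ k) μ (g k)) θ ∂μ := fun k => by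
    rw [lintegral_indicator (ℱ.le k _ (measurableSet_condSumLe g R k)),
      setLIntegral_condLExp (ℱ.le k) μ (g k) (measurableSet_condSumLe g R k)]
  simp only [h1]
  rw [← lintegral_finsetSum]
  · have h2 : ∀ θ, ∑ k ∈ Finset.range n,
        (condSumLe ℱ μ g R k).indicator (condLExp (ℱ k) μ (g k)) θ ≤ R := by
      intro θ
      induction n with
      | zero => simp
      | succ n ih =>
        by_cases h : θ ∈ condSumLe ℱ μ g R n
        · refine le_trans (Finset.sum_le_sum fun k _ => Set.indicator_le_self _ _ _) h
        · rw [Finset.sum_range_succ, Set.indicator_of_notMem h, add_zero]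
          exact ih
    calc _ ≤ ∫⁻ _, R ∂μ := lintegral_mono h2
      _ = R := by simp
  · intro k _
    exact ((measurable_condLExp (ℱ k) μ (g k)).mono (ℱ.le k) le_rfl).indicator
      (ℱ.le k _ (measurableSet_condSumLe g R k))

theorem ae_exists_forall_mem_condSumLe {g : ℕ → Θ → ℝ≥0∞}
    (hg : ∀ᵐ θ ∂μ, ∑' k, condLExp (ℱ k) μ (g k) θ < ∞) :
    ∀ᵐ θ ∂μ, ∃ R : ℕ, ∀ k, θ ∈ condSumLe ℱ μ g R k := by
  filter_upwards [hg] with θ hθ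
  obtain ⟨R, hR⟩ := ENNReal.exists_nat_gt hθ.ne
  exact ⟨R, fun k => (ENNReal.sum_le_tsum _).trans hR.le⟩

/-- Nonnegative terms are almost surely summable if their conditional expectations are. -/
theorem ae_tsum_lt_top_of_condLExp [IsProbabilityMeasure μ] {g : ℕ → Θ → ℝ≥0∞}
    (hgm : ∀ k, Measurable (g k))
    (hg : ∀ᵐ θ ∂μ, ∑' k, condLExp (ℱ k) μ (g k) θ < ∞) :
    ∀ᵐ θ ∂μ, ∑' k, g k θ < ∞ := by
  have h1 : ∀ R : ℕ, ∀ᵐ θ ∂μ, ∑' k, (condSumLe ℱ μ g R k).indicator (g k) θ < ∞ := by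
    intro R
    have hm : ∀ k, Measurable ((condSumLe ℱ μ g R k).indicator (g k)) := fun k =>
      (hgm k).indicator (ℱ.le k _ (measurableSet_condSumLe g R k))
    refine ae_lt_top (Measurable.tsum hm) ?_
    rw [lintegral_tsum fun k => (hm k).aemeasurable]
    refine ne_top_of_le_ne_top (ENNReal.natCast_ne_top R) ?_
    rw [ENNReal.tsum_eq_iSup_nat]
    refine iSup_le fun n => ?_
    refine le_trans (le_of_eq ?_) (sum_setLIntegral_condSumLe (ℱ := ℱ) (μ := μ) g R n)
    refine Finset.sum_congr rfl fun k _ => ?_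
    rw [lintegral_indicator (ℱ.le k _ (measurableSet_condSumLe g R k))]
  filter_upwards [ae_exists_forall_mem_condSumLe hg, ae_all_iff.2 h1] with θ hθ h2
  obtain ⟨R, hR⟩ := hθ
  simpa only [Set.indicator_of_mem (hR _)] using h2 R

/-- Local martingale convergence: a series of conditionally centred terms converges almost surely
if the conditional second moments are summable. -/
theorem ae_exists_tendsto_sum_of_condLExp [IsProbabilityMeasure μ] {g : ℕ → Θ → ℝ≥0∞}
    (hg : ∀ᵐ θ ∂μ, ∑' k, condLExp (ℱ k) μ (g k) θ < ∞)
    {h : ℕ → Θ → ℝ} {K : ℝ≥0∞} (hK : K ≠ ∞)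
    (hmeas : ∀ k, StronglyMeasurable[ℱ (k + 1)] (h k))
    (hle : ∀ k θ, ENNReal.ofReal (h k θ ^ 2) ≤ K * g k θ)
    (hzero : ∀ k A, MeasurableSet[ℱ k] A → IntegrableOn (h k) A μ → ∫ θ in A, h k θ ∂μ = 0) :
    ∀ᵐ θ ∂μ, ∃ l, Tendsto (fun n => ∑ k ∈ Finset.range n, h k θ) atTop (𝓝 l) := by
  -- After truncation the second moments sum to at most `K * R`, so the square-integrable theorem
  -- applies. Almost every path is untouched by the truncation for some natural `R`.
  have h1 : ∀ R : ℕ, ∀ᵐ θ ∂μ, ∃ l, Tendsto (fun n => ∑ k ∈ Finset.range n,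
      (condSumLe ℱ μ g R k).indicator (h k) θ) atTop (𝓝 l) := by
    intro R
    have hB : ∀ k, MeasurableSet[ℱ k] (condSumLe ℱ μ g R k) := measurableSet_condSumLe g R
    have hm : ∀ k, StronglyMeasurable[ℱ (k + 1)] ((condSumLe ℱ μ g R k).indicator (h k)) :=
      fun k => (hmeas k).indicator (ℱ.mono k.le_succ _ (hB k))
    have hm' : ∀ k, AEStronglyMeasurable ((condSumLe ℱ μ g R k).indicator (h k)) μ :=
      fun k => ((hm k).mono (ℱ.le _)).aestronglyMeasurable
    have hlint : ∀ k, ∫⁻ θ, ENNReal.ofReal ((condSumLe ℱ μ g R k).indicator (h k) θ ^ 2) ∂μ ≤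
        K * ∫⁻ θ in condSumLe ℱ μ g R k, g k θ ∂μ := by
      intro k
      rw [← lintegral_const_mul' _ _ hK, ← lintegral_indicator (ℱ.le k _ (hB k))]
      refine lintegral_mono fun θ => ?_
      by_cases hθ : θ ∈ condSumLe ℱ μ g R k
      · simpa [hθ] using hle k θ
      · simp [hθ]
    have hfin : ∀ k, ∫⁻ θ in condSumLe ℱ μ g R k, g k θ ∂μ ≤ R := fun k =>
      (Finset.single_le_sum (f := fun k => ∫⁻ θ in condSumLe ℱ μ g R k, g k θ ∂μ)
        (fun _ _ => zero_le) (Finset.self_mem_range_succ k)).trans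
        (sum_setLIntegral_condSumLe g R (k + 1))
    have hL2 : ∀ k, MemLp ((condSumLe ℱ μ g R k).indicator (h k)) 2 μ := by
      intro k
      rw [memLp_two_iff_integrable_sq (hm' k)]
      refine ⟨(hm' k).pow 2, ?_⟩
      rw [hasFiniteIntegral_iff_ofReal (Eventually.of_forall fun θ => sq_nonneg _)]
      refine (hlint k).trans_lt (ENNReal.mul_lt_top hK.lt_top ?_)
      exact (hfin k).trans_lt (ENNReal.natCast_lt_top R)
    refine ae_exists_tendsto_sum_of_sq_le hm hL2 (fun k A hA => ?_) (R := (K * R).toReal)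
      fun n => ?_
    · rw [setIntegral_indicator (ℱ.le k _ (hB k))]
      refine hzero k _ (hA.inter (hB k)) ?_
      have := (hL2 k).integrable one_le_two
      rw [integrable_indicator_iff (ℱ.le k _ (hB k))] at this
      exact this.mono_set Set.inter_subset_right
    · have h2 : ∀ k, ∫ θ, (condSumLe ℱ μ g R k).indicator (h k) θ ^ 2 ∂μ ≤
          (K * ∫⁻ θ in condSumLe ℱ μ g R k, g k θ ∂μ).toReal := by
        intro k
        rw [integral_eq_lintegral_of_nonneg_ae (Eventually.of_forall fun θ => sq_nonneg _)
          ((hm' k).pow 2)]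
        exact ENNReal.toReal_mono (ENNReal.mul_ne_top hK
          (ne_top_of_le_ne_top (ENNReal.natCast_ne_top R) (hfin k))) (hlint k)
      refine (Finset.sum_le_sum fun k _ => h2 k).trans ?_
      rw [← ENNReal.toReal_sum, ← Finset.mul_sum]
      · refine ENNReal.toReal_mono (ENNReal.mul_ne_top hK (ENNReal.natCast_ne_top R)) ?_
        gcongr
        exact sum_setLIntegral_condSumLe g R n
      · exact fun k _ => ENNReal.mul_ne_top hK
          (ne_top_of_le_ne_top (ENNReal.natCast_ne_top R) (hfin k))
  filter_upwards [ae_exists_forall_mem_condSumLe hg, ae_all_iff.2 h1] with θ hθ h2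
  obtain ⟨R, hR⟩ := hθ
  simpa only [Set.indicator_of_mem (hR _)] using h2 R

/-- A function of two independent variables which is centred in the second one has zero mean. -/
theorem integral_eq_zero_of_indepFun [IsProbabilityMeasure μ] {𝒴 𝒮 : Type*} [m𝒴 : MeasurableSpace 𝒴] [MeasurableSpace 𝒮]
    {Y : Θ → 𝒴} {Z : Θ → 𝒮} (hY : Measurable Y) (hZ : Measurable Z) (hind : IndepFun Y Z μ)
    {f : 𝒴 × 𝒮 → ℝ} (hf : Measurable f) (hint : Integrable (fun θ => f (Y θ, Z θ)) μ)
    (hzero : ∀ y, ∫ s, f (y, s) ∂(μ.map Z) = 0) : ∫ θ, f (Y θ, Z θ) ∂μ = 0 := by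
  have h1 := (indepFun_iff_map_prod_eq_prod_map_map hY.aemeasurable hZ.aemeasurable).1 hind
  have h2 : ∫ θ, f (Y θ, Z θ) ∂μ = ∫ q, f q ∂(μ.map fun θ => (Y θ, Z θ)) :=
    (integral_map (hY.prodMk hZ).aemeasurable hf.aestronglyMeasurable).symm
  have h3 : Integrable f ((μ.map Y).prod (μ.map Z)) := by
    rw [← h1]
    exact (integrable_map_measure hf.aestronglyMeasurable (hY.prodMk hZ).aemeasurable).2 hint
  have : IsProbabilityMeasure (μ.map Y) := Measure.isProbabilityMeasure_map hY.aemeasurable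
  have : IsProbabilityMeasure (μ.map Z) := Measure.isProbabilityMeasure_map hZ.aemeasurable
  rw [h2, h1, integral_prod _ h3]
  simp [hzero]

end Noise

/-! ### Sample gradients, expected costs and equilibria. -/

/-- By convexity each difference quotient of `f` at `x` along the segment to `y` is at most `f y - f
x`, and the quotients converge to the derivative. The point `x` may lie on the boundary of `s`. -/
theorem ConvexOn.hasFDerivAt_sub_le {E : Type*} [NormedAddCommGroup E] [NormedSpace ℝ E]
    {s : Set E} {f : E → ℝ} (hf : ConvexOn ℝ s f) {x y : E} (hx : x ∈ s) (hy : y ∈ s)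
    {f' : E →L[ℝ] ℝ} (hd : HasFDerivAt f f' x) : f' (y - x) ≤ f y - f x := by
  refine le_of_tendsto (hd.lim_real (y - x)) ?_
  filter_upwards [eventually_ge_atTop 1] with c hc
  have hc0 : 0 < c := by linarith
  have h1 := hf.2 hx hy (sub_nonneg.2 (inv_le_one_of_one_le₀ hc)) (inv_pos.2 hc0).le
    (sub_add_cancel _ _)
  have h2 : (1 - c⁻¹) • x + c⁻¹ • y = x + c⁻¹ • (y - x) := by module
  rw [h2] at h1
  simp only [smul_eq_mul] at h1 ⊢
  have h3 := mul_le_mul_of_nonneg_left h1 hc0.le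
  have h4 : c * ((1 - c⁻¹) * f x + c⁻¹ * f y) = c * f x - f x + f y := by
    field_simp
  linarith

namespace SGNEP

variable {N n m d : ℕ} {S : SGNEP N n m d}

theorem ConstraintQualification.isClosed_localSet (hcq : S.ConstraintQualification) :
    IsClosed S.localSet := by
  have : S.localSet = ⋂ i, (fun x : Profile N n => x i) ⁻¹' S.Ω i := by
    ext x; simp [localSet]
  rw [this]
  exact isClosed_iInter fun i => (hcq.closed i).preimage (continuous_apply i)

/-- Difference quotients converge to the coordinates of the sample gradient. -/
theorem RegularSampleCost.tendsto_partialGrad (hJ : S.RegularSampleCost) (i : Fin N)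
    {x : Profile N n} (hx : x ∈ S.localSet) (s : Vec d) (l : Fin n) :
    Tendsto (fun q : ℕ => (q : ℝ) * (S.J i (Function.update x i
      (x i + (q : ℝ)⁻¹ • EuclideanSpace.single l (1 : ℝ))) s - S.J i x s)) atTop
      (𝓝 (S.partialGrad i x s l)) := by
  have h1 := (hJ.differentiable i x hx s).hasGradientAt.hasFDerivAt.lim_real
    (EuclideanSpace.single l (1 : ℝ))
  have h2 := h1.comp tendsto_natCast_atTop_atTop
  have h3 : InnerProductSpace.toDual ℝ (Vec n)
      (gradient (fun y => S.J i (Function.update x i y) s) (x i))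
      (EuclideanSpace.single l (1 : ℝ)) = S.partialGrad i x s l := by
    rw [InnerProductSpace.toDual_apply_apply, EuclideanSpace.inner_single_right]
    simp [partialGrad]
  rw [h3] at h2
  simpa [Function.comp_def, Function.update_eq_self] using h2

theorem measurable_update_add (i : Fin N) (v : Vec n) :
    Measurable fun q : Profile N n × Vec d => (Function.update q.1 i (q.1 i + v), q.2) := by
  refine Measurable.prodMk ?_ measurable_snd
  refine measurable_pi_lambda _ fun j => ?_
  rcases eq_or_ne j i with rfl | h
  · simp only [Function.update_self]
    have : Measurable fun q : Profile N n × Vec d => q.1 j :=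
      (measurable_pi_apply j).comp measurable_fst
    exact this.add_const v
  · simp only [Function.update_of_ne h]
    exact (measurable_pi_apply j).comp measurable_fst

/-- The sample gradients are jointly measurable over the product of the local sets. -/
theorem RegularSampleCost.measurable_indicator_partialGrad (hJ : S.RegularSampleCost)
    (hcq : S.ConstraintQualification) (i : Fin N) :
    Measurable (Set.indicator {q : Profile N n × Vec d | q.1 ∈ S.localSet}
      fun q => S.partialGrad i q.1 q.2) := by
  have hm : MeasurableSet {q : Profile N n × Vec d | q.1 ∈ S.localSet} :=
    measurable_fst hcq.isClosed_localSet.measurableSet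
  have hcoord : ∀ l, Measurable fun q : Profile N n × Vec d =>
      (Set.indicator {q : Profile N n × Vec d | q.1 ∈ S.localSet}
        fun q => S.partialGrad i q.1 q.2) q l := by
    intro l
    -- The gradient coordinate is a limit of difference quotients with steps `1/k`. These are
    -- measurable even where the shifted point leaves the local set; only the limit needs the
    -- indicator.
    refine measurable_of_tendsto_metrizable (f := fun (k : ℕ) => Set.indicator
      {q : Profile N n × Vec d | q.1 ∈ S.localSet} fun q => (k : ℝ) * (S.J i (Function.update q.1 i
      (q.1 i + (k : ℝ)⁻¹ • EuclideanSpace.single l (1 : ℝ))) q.2 - S.J i q.1 q.2))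
      (fun k => ?_) (tendsto_pi_nhds.2 fun q => ?_)
    · refine Measurable.indicator ?_ hm
      exact (((hJ.measurable i).comp (measurable_update_add i _)).sub
        (hJ.measurable i)).const_mul _
    · by_cases hq : q.1 ∈ S.localSet
      · have hq' : q ∈ {q : Profile N n × Vec d | q.1 ∈ S.localSet} := hq
        simp only [Set.indicator_of_mem hq']
        exact hJ.tendsto_partialGrad i hq q.2 l
      · have hq' : q ∉ {q : Profile N n × Vec d | q.1 ∈ S.localSet} := hq
        simp only [Set.indicator_of_notMem hq']
        exact tendsto_const_nhds
  exact (WithLp.measurable_toLp 2 (Fin n → ℝ)).comp (measurable_pi_lambda _ hcoord)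

theorem RegularSampleCost.measurable_partialGrad (hJ : S.RegularSampleCost)
    (hcq : S.ConstraintQualification) (i : Fin N) {x : Profile N n} (hx : x ∈ S.localSet) :
    Measurable (S.partialGrad i x) := by
  have h := (hJ.measurable_indicator_partialGrad hcq i).comp
    (measurable_prodMk_left (x := x) (β := Vec d))
  have h2 : (Set.indicator {q : Profile N n × Vec d | q.1 ∈ S.localSet}
      fun q => S.partialGrad i q.1 q.2) ∘ Prod.mk x = S.partialGrad i x := by
    funext s
    have hq' : (x, s) ∈ {q : Profile N n × Vec d | q.1 ∈ S.localSet} := hx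
    simp only [Function.comp_apply, Set.indicator_of_mem hq']
  rwa [h2] at h

/-- Differentiation under the expectation. -/
theorem RegularSampleCost.integrable_partialGrad_and_hasGradientAt (hJ : S.RegularSampleCost)
    (hcq : S.ConstraintQualification) (i : Fin N) {x : Profile N n} (hx : x ∈ S.localSet) :
    Integrable (S.partialGrad i x) S.P ∧
      HasGradientAt (fun y => S.cost i (Function.update x i y)) (S.F x i) (x i) := by
  obtain ⟨C, hC, r, hr, hlip⟩ := hJ.locally_lipschitz i x hx
  set D := InnerProductSpace.toDual ℝ (Vec n)
  have hmeas : ∀ y, Measurable (S.J i y) := fun y =>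
    (hJ.measurable i).comp (measurable_prodMk_left (x := y))
  have h := hasFDerivAt_integral_of_dominated_loc_of_lip (μ := S.P)
    (F := fun y s => S.J i (Function.update x i y) s) (F' := fun s => D (S.partialGrad i x s))
    (x₀ := x i) (bound := C) (Metric.ball_mem_nhds (x i) hr)
    (Eventually.of_forall fun y => (hmeas _).aestronglyMeasurable)
    (by simpa only [Function.update_eq_self] using hJ.integrable i x hx)
    (D.continuous.measurable.comp (hJ.measurable_partialGrad hcq i hx)).aestronglyMeasurable
    (by
      filter_upwards [hlip] with s hs
      refine LipschitzOnWith.of_dist_le_mul fun y hy y' hy' => ?_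
      rw [Real.dist_eq, dist_eq_norm]
      refine (hs y hy y' hy').trans ?_
      gcongr
      exact le_abs_self _)
    hC (Eventually.of_forall fun s => (hJ.differentiable i x hx s).hasGradientAt.hasFDerivAt)
  have hint : Integrable (S.partialGrad i x) S.P := by
    have := (D.symm.toContinuousLinearEquiv.toContinuousLinearMap).integrable_comp h.1
    simpa using this
  refine ⟨hint, ?_⟩
  have h2 : ∫ s, D (S.partialGrad i x s) ∂S.P = D (S.F x i) :=
    (D.toContinuousLinearEquiv.toContinuousLinearMap).integral_comp_comm hint
  rw [h2] at h
  exact h.2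

/-- Testing the variational inequality with a deviation of one agent leaves only the block of that
agent. This block is the gradient of its expected cost, so convexity turns first order optimality
into optimality. -/
theorem IsSVISolution.isVSGNE (hJ : S.RegularSampleCost) (hcq : S.ConstraintQualification)
    (hcost : S.ConvexCost) {x : Profile N n} (hx : S.IsSVISolution x) : S.IsVSGNE x := by
  refine ⟨⟨hx.1, fun i y hy => ?_⟩, hx⟩
  have h1 := (hJ.integrable_partialGrad_and_hasGradientAt hcq i hx.1.1).2
  have hyi : y ∈ S.Ω i := by simpa using hy.1 i
  have h2 := (hcost.convex i x hx.1).hasFDerivAt_sub_le (hx.1.1 i) hyi h1.hasFDerivAt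
  have h3 := hx.2 _ hy
  have h4 : stackInner (S.F x) (Function.update x i y - x) = inner ℝ (S.F x i) (y - x i) := by
    unfold stackInner
    rw [Finset.sum_eq_single i]
    · simp
    · intro j _ hj
      simp [hj]
    · simp
  rw [h4] at h3
  simp only [InnerProductSpace.toDual_apply_apply, Function.update_eq_self] at h2
  linarith

end SGNEP

/-! ### The weighted graph Laplacian. -/

section Laplacian

variable {N : ℕ} {V : Type*} [NormedAddCommGroup V] [InnerProductSpace ℝ V]
  {w : Fin N → Fin N → ℝ} {G : SimpleGraph (Fin N)}

/-- The weighted graph Laplacian acting on one vector per agent. -/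
def lap {V : Type*} [AddCommGroup V] [Module ℝ V] (w : Fin N → Fin N → ℝ) (v : Fin N → V) :
    Fin N → V :=
  fun i => ∑ j, w i j • (v i - v j)

theorem lap_add_smul (a b : ℝ) (u v : Fin N → V) :
    lap w (a • u + b • v) = a • lap w u + b • lap w v := by
  funext i
  simp only [lap, Pi.add_apply, Pi.smul_apply, Finset.smul_sum, ← Finset.sum_add_distrib]
  exact Finset.sum_congr rfl fun j _ => by module

theorem lap_sub (u v : Fin N → V) : lap w (u - v) = lap w u - lap w v := by
  have := lap_add_smul (w := w) 1 (-1) u v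
  simpa [sub_eq_add_neg] using this

theorem continuous_lap : Continuous (lap w : (Fin N → V) → Fin N → V) := by
  unfold lap
  fun_prop

theorem IsWeightMatrix.nonneg (hw : IsWeightMatrix G w) (i j : Fin N) : 0 ≤ w i j := by
  by_cases h : G.Adj i j
  · exact (hw.pos i j h).le
  · exact (hw.zero i j h).ge

/-- Exchanging the two summation indices and using the symmetry of `w` yields the Dirichlet form.
Symmetry, nonnegativity and the kernel of the Laplacian are all read off from it. -/
theorem IsWeightMatrix.sum_inner_lap (hw : IsWeightMatrix G w) (u v : Fin N → V) :
    ∑ i, inner ℝ (lap w u i) (v i) = (∑ i, ∑ j, w i j * inner ℝ (u i - u j) (v i - v j)) / 2 := by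
  have h1 : ∑ i, inner ℝ (lap w u i) (v i) = ∑ i, ∑ j, w i j * inner ℝ (u i - u j) (v i) := by
    refine Finset.sum_congr rfl fun i _ => ?_
    rw [lap, sum_inner]
    exact Finset.sum_congr rfl fun j _ => by rw [real_inner_smul_left]
  have h2 : ∑ i, ∑ j, w i j * inner ℝ (u i - u j) (v i) =
      -∑ i, ∑ j, w i j * inner ℝ (u i - u j) (v j) := by
    rw [Finset.sum_comm, ← Finset.sum_neg_distrib]
    refine Finset.sum_congr rfl fun i _ => ?_
    rw [← Finset.sum_neg_distrib]
    refine Finset.sum_congr rfl fun j _ => ?_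
    rw [hw.symm j i, ← neg_sub (u i) (u j), inner_neg_left, mul_neg]
  have h3 : ∑ i, ∑ j, w i j * inner ℝ (u i - u j) (v i - v j) =
      ∑ i, ∑ j, w i j * inner ℝ (u i - u j) (v i) -
        ∑ i, ∑ j, w i j * inner ℝ (u i - u j) (v j) := by
    simp only [inner_sub_right, mul_sub, Finset.sum_sub_distrib]
  rw [h1]
  linarith

theorem IsWeightMatrix.sum_inner_lap_comm (hw : IsWeightMatrix G w) (u v : Fin N → V) :
    ∑ i, inner ℝ (lap w u i) (v i) = ∑ i, inner ℝ (lap w v i) (u i) := by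
  rw [hw.sum_inner_lap, hw.sum_inner_lap]
  simp only [real_inner_comm]

theorem IsWeightMatrix.sum_inner_lap_self_nonneg (hw : IsWeightMatrix G w) (u : Fin N → V) :
    0 ≤ ∑ i, inner ℝ (lap w u i) (u i) := by
  rw [hw.sum_inner_lap]
  refine div_nonneg (Finset.sum_nonneg fun i _ => Finset.sum_nonneg fun j _ => ?_) two_pos.le
  exact mul_nonneg (hw.nonneg i j) real_inner_self_nonneg

theorem IsWeightMatrix.sum_lap (hw : IsWeightMatrix G w) (u : Fin N → V) : ∑ i, lap w u i = 0 := by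
  refine ext_inner_right ℝ fun v => ?_
  rw [sum_inner, inner_zero_left]
  have := hw.sum_inner_lap u fun _ => v
  simpa using this

/-- On a connected graph the kernel of the Laplacian consists of the consensus vectors. -/
theorem IsWeightMatrix.eq_of_lap_eq_zero (hw : IsWeightMatrix G w) (hG : G.Connected)
    {u : Fin N → V} (hu : lap w u = 0) (i j : Fin N) : u i = u j := by
  have h1 : ∑ i, ∑ j, w i j * inner ℝ (u i - u j) (u i - u j) = 0 := by
    have := hw.sum_inner_lap u u
    rw [hu] at this
    simp only [Pi.zero_apply, inner_zero_left, Finset.sum_const_zero] at this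
    linarith
  have hnn : ∀ i j, 0 ≤ w i j * inner ℝ (u i - u j) (u i - u j) := fun i j =>
    mul_nonneg (hw.nonneg i j) real_inner_self_nonneg
  have hadj : ∀ i j, G.Adj i j → u i = u j := by
    intro i j hij
    have h2 := (Finset.sum_eq_zero_iff_of_nonneg fun i _ =>
      Finset.sum_nonneg fun j _ => hnn i j).1 h1 i (Finset.mem_univ i)
    have h3 := (Finset.sum_eq_zero_iff_of_nonneg fun j _ => hnn i j).1 h2 j (Finset.mem_univ j)
    have h4 := (mul_eq_zero.1 h3).resolve_left (hw.pos i j hij).ne'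
    exact sub_eq_zero.1 (inner_self_eq_zero.1 h4)
  obtain ⟨p⟩ := hG.preconnected i j
  induction p with
  | nil => rfl
  | cons h _ ih => exact (hadj _ _ h).trans ih

/-- The range of a symmetric operator is the orthogonal complement of its kernel, which for a
connected graph consists of the constants. -/
theorem IsWeightMatrix.exists_lap_eq_real (hw : IsWeightMatrix G w) (hG : G.Connected)
    {r : Fin N → ℝ} (hr : ∑ i, r i = 0) : ∃ z : Fin N → ℝ, lap w z = r := by
  let A : EuclideanSpace ℝ (Fin N) →ₗ[ℝ] EuclideanSpace ℝ (Fin N) :=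
    { toFun := fun z => WithLp.toLp 2 (lap w z)
      map_add' := fun u v => by
        have := lap_add_smul (w := w) 1 1 (u : Fin N → ℝ) v
        ext i
        simpa using congrFun this i
      map_smul' := fun a u => by
        have := lap_add_smul (w := w) a 0 (u : Fin N → ℝ) u
        ext i
        simpa using congrFun this i }
  have hA : A.IsSymmetric := by
    intro u v
    have := hw.sum_inner_lap_comm (u : Fin N → ℝ) v
    rw [PiLp.inner_apply, PiLp.inner_apply]
    simp only [real_inner_comm _ (u _)] at this ⊢
    simpa [A] using this
  have hmem : WithLp.toLp 2 r ∈ LinearMap.range A := by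
    rw [← Submodule.orthogonal_orthogonal (LinearMap.range A), hA.orthogonal_range,
      Submodule.mem_orthogonal]
    intro z hz
    have hz0 : lap w (z : Fin N → ℝ) = 0 := by
      have : A z = 0 := hz
      funext i
      exact congrFun (congrArg (fun v : EuclideanSpace ℝ (Fin N) => (v : Fin N → ℝ)) this) i
    obtain ⟨i₀⟩ := hG.nonempty
    have hc := fun i => hw.eq_of_lap_eq_zero hG hz0 i i₀
    rw [PiLp.inner_apply]
    simp only [hc]
    have : ∑ i, inner ℝ (z i₀) (r i) = (∑ i, r i) * z i₀ := by
      rw [Finset.sum_mul]; rfl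
    rw [this, hr, zero_mul]
  obtain ⟨z, hz⟩ := hmem
  exact ⟨z, congrArg (fun v : EuclideanSpace ℝ (Fin N) => (v : Fin N → ℝ)) hz⟩

theorem IsWeightMatrix.exists_lap_eq (hw : IsWeightMatrix G w) (hG : G.Connected) {m : ℕ}
    {r : Profile N m} (hr : ∑ i, r i = 0) : ∃ z : Profile N m, lap w z = r := by
  have h : ∀ l, ∃ z : Fin N → ℝ, lap w z = fun i => r i l := fun l => by
    refine hw.exists_lap_eq_real hG ?_
    have := congrArg (fun v : Vec m => v l) hr
    simpa using this
  choose z hz using h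
  refine ⟨fun i => WithLp.toLp 2 fun l => z l i, ?_⟩
  funext i
  ext l
  have := congrFun (hz l) i
  simpa [lap] using this

end Laplacian

/-! ### Stacked vectors (whose type carries the maximum norm) and the nonnegative orthant. -/

section Stack

variable {N p : ℕ}

theorem norm_le_stackNorm (v : Profile N p) (i : Fin N) : ‖v i‖ ≤ stackNorm v :=
  Real.le_sqrt_of_sq_le
    (Finset.single_le_sum (f := fun i => ‖v i‖ ^ 2) (fun _ _ => sq_nonneg _) (Finset.mem_univ i))

theorem continuous_stackNorm : Continuous (stackNorm : Profile N p → ℝ) := by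
  unfold stackNorm; fun_prop

theorem stackNorm_zero : stackNorm (0 : Profile N p) = 0 := by
  simp [stackNorm]

theorem stackInner_sub_left (u v t : Profile N p) :
    stackInner (u - v) t = stackInner u t - stackInner v t := by
  simp [stackInner, inner_sub_left, Finset.sum_sub_distrib]

theorem stackInner_sub_right (t u v : Profile N p) :
    stackInner t (u - v) = stackInner t u - stackInner t v := by
  simp [stackInner, inner_sub_right, Finset.sum_sub_distrib]

theorem stackInner_add_smul_right (t u v : Profile N p) (a b : ℝ) :
    stackInner t (a • u + b • v) = a * stackInner t u + b * stackInner t v := by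
  simp [stackInner, inner_add_right, inner_smul_right, Finset.sum_add_distrib, Finset.mul_sum]

theorem Continuous.stackInner {X : Type*} [TopologicalSpace X] {f g : X → Profile N p}
    (hf : Continuous f) (hg : Continuous g) : Continuous fun x => stackInner (f x) (g x) := by
  unfold _root_.stackInner
  fun_prop

theorem ContinuousOn.stackInner {X : Type*} [TopologicalSpace X] {s : Set X}
    {f g : X → Profile N p} (hf : ContinuousOn f s) (hg : ContinuousOn g s) :
    ContinuousOn (fun x => stackInner (f x) (g x)) s := by
  unfold _root_.stackInner
  exact continuousOn_finsetSum _ fun i _ => ContinuousOn.inner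
    ((continuous_apply i).comp_continuousOn hf) ((continuous_apply i).comp_continuousOn hg)

theorem isClosed_orthant : IsClosed (orthant p) := by
  have : orthant p = ⋂ l, {v : Vec p | 0 ≤ v l} := by
    ext v; simp [orthant]
  rw [this]
  exact isClosed_iInter fun l => isClosed_le continuous_const (by fun_prop)

theorem zero_mem_orthant : (0 : Vec p) ∈ orthant p := fun _ => le_rfl

theorem convex_orthant : Convex ℝ (orthant p) := by
  intro u hu v hv a b ha hb _ l
  simpa using add_nonneg (mul_nonneg ha (hu l)) (mul_nonneg hb (hv l))

theorem inner_nonneg_of_mem_orthant {u v : Vec p} (hu : u ∈ orthant p) (hv : v ∈ orthant p) :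
    0 ≤ inner ℝ u v := by
  rw [PiLp.inner_apply]
  exact Finset.sum_nonneg fun l _ => mul_nonneg (hv l) (hu l)

end Stack

/-! ### The augmented Lagrangian game and its relation to the variational inequality. -/

namespace SGNEP

variable {N n m d : ℕ} {S : SGNEP N n m d} {w : Fin N → Fin N → ℝ} {G : SimpleGraph (Fin N)}

theorem MonotoneLipschitz.continuousOn (hF : S.MonotoneLipschitz) :
    ContinuousOn S.F S.localSet := by
  obtain ⟨ℓ, -, hℓ⟩ := hF.lipschitz
  intro x hx
  refine tendsto_pi_nhds.2 fun i => tendsto_iff_norm_sub_tendsto_zero.2 ?_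
  have h : Tendsto (fun y => ℓ * stackNorm (y - x)) (𝓝[S.localSet] x) (𝓝 0) := by
    have hc : Continuous fun y => ℓ * stackNorm (y - x) :=
      (continuous_stackNorm.comp (continuous_sub_right x)).const_mul ℓ
    have := hc.tendsto x
    simp only [sub_self, stackNorm_zero, mul_zero] at this
    exact this.mono_left nhdsWithin_le_nhds
  refine squeeze_zero' (Eventually.of_forall fun _ => norm_nonneg _) ?_ h
  filter_upwards [self_mem_nhdsWithin] with y hy
  exact (norm_le_stackNorm (S.F y - S.F x) i).trans (hℓ y hy x hx)

theorem ConvexCoupling.inner_le (hg : S.ConvexCoupling) {lam : Vec m} (hl : lam ∈ orthant m)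
    (i : Fin N) (x y : Vec n) {a b : ℝ} (ha : 0 ≤ a) (hb : 0 ≤ b) (hab : a + b = 1) :
    inner ℝ lam (S.g i (a • x + b • y)) ≤
      a * inner ℝ lam (S.g i x) + b * inner ℝ lam (S.g i y) := by
  have h : 0 ≤ inner ℝ lam (a • S.g i x + b • S.g i y - S.g i (a • x + b • y)) := by
    refine inner_nonneg_of_mem_orthant hl fun l => ?_
    have := (hg.convex i l).2 (Set.mem_univ x) (Set.mem_univ y) ha hb hab
    simpa using this
  rw [inner_sub_right, inner_add_right, inner_smul_right, inner_smul_right] at h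
  linarith

theorem ConvexCoupling.continuous (hg : S.ConvexCoupling) (i : Fin N) : Continuous (S.g i) :=
  (hg.differentiable i).continuous

variable (S) in
/-- The states with local primal variables and nonnegative multipliers. -/
def dom : Set (State N n m) := {u | u.1 ∈ S.localSet ∧ ∀ i, u.2.2 i ∈ orthant m}

variable (S) in
/-- The equilibrium bifunction of the augmented Lagrangian game. -/
noncomputable def lagBif (w : Fin N → Fin N → ℝ) (u v : State N n m) : ℝ :=
  stackInner (S.F u.1) (v.1 - u.1) + ∑ i, inner ℝ (u.2.2 i) (S.g i (v.1 i))
    - ∑ i, inner ℝ (v.2.2 i) (S.g i (u.1 i)) + stackInner (lap w u.2.2) (v.2.1 - u.2.1)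
    + stackInner (lap w u.2.2 - lap w u.2.1) (v.2.2 - u.2.2)

/-- In `B u v + B v u` the constraint terms cancel, and so do the products of auxiliary variables
and multipliers, by symmetry of the Laplacian. What remains is minus the monotonicity term of `F`
minus a Dirichlet form of multipliers. Convexity in the second argument uses that the multipliers in
the first are nonnegative. -/
theorem isMonotoneBifunction_lagBif (hcq : S.ConstraintQualification) (hg : S.ConvexCoupling)
    (hF : S.MonotoneLipschitz) (hw : IsWeightMatrix G w) :
    IsMonotoneBifunction S.dom (S.lagBif w) where
  nonempty := by
    choose x hx using hcq.nonempty
    exact ⟨(x, 0, 0), hx, fun i l => le_rfl⟩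
  closed := by
    refine (hcq.isClosed_localSet.preimage continuous_fst).inter ?_
    have : {u : State N n m | ∀ i, u.2.2 i ∈ orthant m} =
        ⋂ i, (fun u : State N n m => u.2.2 i) ⁻¹' orthant m := by
      ext u; simp
    change IsClosed {u : State N n m | ∀ i, u.2.2 i ∈ orthant m}
    rw [this]
    exact isClosed_iInter fun i => isClosed_orthant.preimage (by fun_prop)
  convex := fun u hu v hv a b ha hb hab =>
    ⟨fun i => hcq.convex i (hu.1 i) (hv.1 i) ha hb hab,
      fun i => convex_orthant (hu.2 i) (hv.2 i) ha hb hab⟩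
  diag := fun u _ => by simp [lagBif, stackInner]
  monotone := fun u hu v hv => by
    have h1 := hF.monotone u.1 hu.1 v.1 hv.1
    have h2 := hw.sum_inner_lap_self_nonneg (u.2.2 - v.2.2)
    have h3 := hw.sum_inner_lap_comm (u.2.2 - v.2.2) (u.2.1 - v.2.1)
    change 0 ≤ stackInner (lap w (u.2.2 - v.2.2)) (u.2.2 - v.2.2) at h2
    change stackInner (lap w (u.2.2 - v.2.2)) (u.2.1 - v.2.1) =
      stackInner (lap w (u.2.1 - v.2.1)) (u.2.2 - v.2.2) at h3
    simp only [lagBif, lap_sub, stackInner_sub_left, stackInner_sub_right] at *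
    linarith
  convexOn := fun u hu => by
    refine ⟨fun u hu v hv a b ha hb hab =>
      ⟨fun i => hcq.convex i (hu.1 i) (hv.1 i) ha hb hab,
        fun i => convex_orthant (hu.2 i) (hv.2 i) ha hb hab⟩, fun v _ v' _ a b ha hb hab => ?_⟩
    have h1 : ∑ i, inner ℝ (u.2.2 i) (S.g i ((a • v + b • v').1 i)) ≤
        a * ∑ i, inner ℝ (u.2.2 i) (S.g i (v.1 i)) +
          b * ∑ i, inner ℝ (u.2.2 i) (S.g i (v'.1 i)) := by
      rw [Finset.mul_sum, Finset.mul_sum, ← Finset.sum_add_distrib]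
      exact Finset.sum_le_sum fun i _ => hg.inner_le (hu.2 i) i _ _ ha hb hab
    have h2 : ∑ i, inner ℝ ((a • v + b • v').2.2 i) (S.g i (u.1 i)) =
        a * ∑ i, inner ℝ (v.2.2 i) (S.g i (u.1 i)) +
          b * ∑ i, inner ℝ (v'.2.2 i) (S.g i (u.1 i)) := by
      rw [Finset.mul_sum, Finset.mul_sum, ← Finset.sum_add_distrib]
      refine Finset.sum_congr rfl fun i _ => ?_
      simp [inner_add_left, real_inner_smul_left]
    simp only [smul_eq_mul, lagBif, stackInner_sub_right, Prod.snd_add, Prod.fst_add,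
      Prod.smul_fst, Prod.smul_snd, stackInner_add_smul_right]
    simp only [Prod.fst_add, Prod.snd_add, Prod.smul_fst, Prod.smul_snd] at h1 h2
    rw [h2]
    obtain rfl : b = 1 - a := by linarith
    linarith
  continuousOn_left := fun v _ => by
    have hmap : Set.MapsTo (fun u : State N n m => u.1) S.dom S.localSet := fun u hu => hu.1
    have hFc : ContinuousOn (fun u : State N n m => S.F u.1) S.dom :=
      hF.continuousOn.comp continuous_fst.continuousOn hmap
    have hl1 : Continuous fun u : State N n m => lap w u.2.2 :=
      continuous_lap.comp (continuous_snd.comp continuous_snd)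
    have hl2 : Continuous fun u : State N n m => lap w u.2.1 :=
      continuous_lap.comp (continuous_fst.comp continuous_snd)
    have hgc := hg.continuous
    refine (((hFc.stackInner (by fun_prop)).add ?_).sub ?_).add ?_ |>.add ?_
    · fun_prop
    · refine Continuous.continuousOn (continuous_finsetSum _ fun i _ => ?_)
      exact continuous_const.inner ((hgc i).comp (by fun_prop))
    · exact (hl1.stackInner (by fun_prop)).continuousOn
    · exact ((hl1.sub hl2).stackInner (by fun_prop)).continuousOn
  continuousOn_right := fun u _ => by
    have hgc := hg.continuous
    refine Continuous.continuousOn ?_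
    refine ((((continuous_const).stackInner (by fun_prop)).add ?_).sub ?_).add ?_ |>.add ?_
    · exact continuous_finsetSum _ fun i _ =>
        continuous_const.inner ((hgc i).comp (by fun_prop))
    · fun_prop
    · exact continuous_const.stackInner (by fun_prop)
    · exact continuous_const.stackInner (by fun_prop)

theorem sum_inner_coupling (lam : Vec m) (x : Profile N n) :
    ∑ i, inner ℝ lam (S.g i (x i)) = inner ℝ lam (S.coupling x) := by
  rw [coupling, inner_sum]

/-- Equilibria of the augmented game have a variational primal part. -/
theorem isSVISolution_of_lagBif_nonneg (hw : IsWeightMatrix G w) (hG : G.Connected)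
    {u : State N n m} (hu : u ∈ S.dom) (hus : ∀ v ∈ S.dom, 0 ≤ S.lagBif w u v) :
    S.IsSVISolution u.1 := by
  obtain ⟨x, z, lam⟩ := u
  have hlap : lap w lam = 0 := by
    -- The auxiliary variable is unconstrained, so it can be moved along `-lap w lam`, which gives
    -- `-‖lap w lam‖² ≥ 0` and hence consensus.
    have h := hus (x, z - lap w lam, lam) hu
    simp only [lagBif, sub_self, sub_sub_cancel_left] at h
    have h2 : stackInner (lap w lam) (-lap w lam) = -∑ i, ‖lap w lam i‖ ^ 2 := by
      simp [stackInner, Finset.sum_neg_distrib]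
    have h3 : ∑ i, ‖lap w lam i‖ ^ 2 ≤ 0 := by
      rw [h2] at h
      simp [stackInner] at h
      linarith
    funext i
    have h4 := (Finset.sum_eq_zero_iff_of_nonneg fun i _ => sq_nonneg ‖lap w lam i‖).1
      (le_antisymm h3 (Finset.sum_nonneg fun i _ => sq_nonneg _)) i (Finset.mem_univ i)
    exact norm_eq_zero.1 (pow_eq_zero_iff two_ne_zero |>.1 h4)
  obtain ⟨i₀⟩ := hG.nonempty
  obtain ⟨c, hc⟩ : ∃ c, c = lam i₀ := ⟨_, rfl⟩
  have hlam : lam = fun _ => c := funext fun i => hc ▸ hw.eq_of_lap_eq_zero hG hlap i i₀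
  have hcm : c ∈ orthant m := hc ▸ hu.2 i₀
  subst hlam
  -- Moving all multipliers to a common value `b` removes `z`, because the Laplacian sums to zero.
  -- The choice `c + e_l` will give feasibility, and `0` the sign needed for complementarity.
  have h1 : ∀ b ∈ orthant m, 0 ≤ inner ℝ (c - b) (S.coupling x) := by
    intro b hb
    have h := hus (x, z, fun _ => b) ⟨hu.1, fun _ => hb⟩
    have h2 : stackInner (lap w z) ((fun _ => b) - fun _ => c) = 0 := by
      have := hw.sum_lap z
      simp only [stackInner, Pi.sub_apply]
      rw [← sum_inner, this, inner_zero_left]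
    simp only [lagBif, hlap, stackInner_sub_left, h2, sub_self, sum_inner_coupling] at h
    simp only [stackInner, Pi.zero_apply, inner_zero_left, inner_zero_right,
      Finset.sum_const_zero] at h
    rw [inner_sub_left]
    linarith
  have hcoup : ∀ l, S.coupling x l ≤ 0 := by
    intro l
    have h := h1 (c + EuclideanSpace.single l 1) fun l' => by
      have := hcm l'
      by_cases h : l' = l
      · subst h; simp; linarith
      · simpa [h] using this
    simp only [sub_add_cancel_left, inner_neg_left, EuclideanSpace.inner_single_left] at h
    simp at h
    exact h
  refine ⟨⟨hu.1, hcoup⟩, fun y hy => ?_⟩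
  have h0 := h1 0 fun l => le_rfl
  rw [sub_zero] at h0
  have h := hus (y, z, fun _ => c) ⟨hy.1, hu.2⟩
  simp only [lagBif, hlap, sub_self, sum_inner_coupling] at h
  have h2 : 0 ≤ inner ℝ c (-S.coupling y) :=
    inner_nonneg_of_mem_orthant hcm fun l => by simpa using hy.2 l
  rw [inner_neg_right] at h2
  simp only [stackInner, Pi.zero_apply, inner_zero_right, Finset.sum_const_zero] at h ⊢
  linarith

/-- Lagrange multipliers of the linearized program at a solution of the variational inequality. -/
theorem IsSVISolution.exists_multiplier (hcq : S.ConstraintQualification) (hg : S.ConvexCoupling)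
    {x : Profile N n} (hx : S.IsSVISolution x) :
    ∃ lam ∈ orthant m, ∀ y ∈ S.localSet,
      0 ≤ stackInner (S.F x) (y - x) + inner ℝ lam (S.coupling y) := by
  have hconv : Convex ℝ S.localSet := fun u hu v hv a b ha hb hab i =>
    hcq.convex i (hu i) (hv i) ha hb hab
  obtain ⟨x₀, hx₀, hslater⟩ := hcq.slater
  -- The index `none` is the linearized objective and `some l` a constraint. If all were negative at
  -- a point, that point would be feasible and violate the variational inequality.
  let f : Option (Fin m) → Profile N n → ℝ := fun o y =>
    o.elim (stackInner (S.F x) (y - x)) fun l => S.coupling y l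
  have hf : ∀ o, ConvexOn ℝ S.localSet (f o) := by
    rintro (_ | l)
    · refine ⟨hconv, fun y _ y' _ a b _ _ hab => le_of_eq ?_⟩
      simp only [f, Option.elim, stackInner_sub_right, stackInner_add_smul_right, smul_eq_mul]
      obtain rfl : b = 1 - a := by linarith
      ring
    · refine ⟨hconv, fun y _ y' _ a b ha hb hab => ?_⟩
      simp only [f, Option.elim, coupling, smul_eq_mul, WithLp.ofLp_sum, Finset.sum_apply,
        Finset.mul_sum]
      rw [← Finset.sum_add_distrib]
      exact Finset.sum_le_sum fun i _ =>
        (hg.convex i l).2 (Set.mem_univ _) (Set.mem_univ _) ha hb hab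
  obtain ⟨q, ⟨hq0, hq1⟩, hq⟩ := exists_stdSimplex_sum_nonneg ⟨x₀, hx₀⟩ hf hconv fun y hy => by
    by_contra h
    push Not at h
    have := hx.2 y ⟨hy, fun l => (h (some l)).le⟩
    exact (h none).not_ge this
  simp only [Fintype.sum_option] at hq hq1
  -- Were the weight of the objective zero, the constraint functions, all negative at the Slater
  -- point, would force every weight to vanish.
  have hpos : 0 < q none := by
    refine (hq0 none).lt_of_ne fun h0 => ?_
    have h1 := hq x₀ hx₀
    rw [← h0, zero_mul, zero_add] at h1
    have h2 : ∀ l, q (some l) * f (some l) x₀ ≤ 0 := fun l =>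
      mul_nonpos_of_nonneg_of_nonpos (hq0 _) (hslater l).le
    have h3 := (Finset.sum_eq_zero_iff_of_nonpos fun l _ => h2 l).1
      (le_antisymm (Finset.sum_nonpos fun l _ => h2 l) h1)
    rw [← h0, zero_add, Finset.sum_eq_zero] at hq1
    · exact zero_ne_one hq1
    · exact fun l hl => (mul_eq_zero.1 (h3 l hl)).resolve_right (hslater l).ne
  refine ⟨WithLp.toLp 2 fun l => q (some l) / q none,
    fun l => div_nonneg (hq0 _) (hq0 _), fun y hy => ?_⟩
  have h1 := div_nonneg (hq y hy) hpos.le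
  rw [add_div, mul_div_cancel_left₀ _ hpos.ne', Finset.sum_div] at h1
  have h2 : inner ℝ (WithLp.toLp 2 fun l => q (some l) / q none : Vec m) (S.coupling y) =
      ∑ l, q (some l) * f (some l) y / q none := by
    rw [PiLp.inner_apply]
    refine Finset.sum_congr rfl fun l _ => ?_
    simp only [f, Option.elim, RCLike.inner_apply, conj_trivial]
    ring
  rw [h2]
  exact h1

/-- Solutions of the variational inequality extend to equilibria of the augmented game. -/
theorem IsSVISolution.exists_lagBif_nonneg (hcq : S.ConstraintQualification) (hg : S.ConvexCoupling)
    (hw : IsWeightMatrix G w) (hG : G.Connected) {x : Profile N n} (hx : S.IsSVISolution x) :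
    ∃ u ∈ S.dom, ∀ v ∈ S.dom, 0 ≤ S.lagBif w u v := by
  obtain ⟨lam, hlam, hL⟩ := hx.exists_multiplier hcq hg
  have hcoup : -S.coupling x ∈ orthant m := fun l => by simpa using hx.1.2 l
  have hcomp : inner ℝ lam (S.coupling x) = 0 := by
    have h1 := hL x hx.1.1
    have h2 := inner_nonneg_of_mem_orthant hlam hcoup
    rw [inner_neg_right] at h2
    have h3 : stackInner (S.F x) (x - x) = 0 := by simp [stackInner]
    linarith
  have hN : (N : ℝ) ≠ 0 := by
    obtain ⟨i⟩ := hG.nonempty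
    exact_mod_cast i.pos.ne'
  -- With this `z` each `g i (x i) + lap w z i` equals the same fraction of the total coupling,
  -- which is nonpositive; solvability holds because the right-hand side sums to zero.
  obtain ⟨z, hz⟩ := hw.exists_lap_eq hG
    (r := fun i => (N : ℝ)⁻¹ • S.coupling x - S.g i (x i)) (by
      rw [Finset.sum_sub_distrib, Finset.sum_const, Finset.card_univ, Fintype.card_fin,
        ← Nat.cast_smul_eq_nsmul ℝ, smul_smul, mul_inv_cancel₀ hN, one_smul, coupling, sub_self])
  refine ⟨(x, z, fun _ => lam), ⟨hx.1.1, fun _ => hlam⟩, fun v hv => ?_⟩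
  have hl0 : lap w (fun _ : Fin N => lam) = 0 := by
    funext i; simp [lap]
  have h1 : stackInner (lap w z) (v.2.2 - fun _ => lam) =
      (N : ℝ)⁻¹ * (∑ i, inner ℝ (S.coupling x) (v.2.2 i)) -
        ∑ i, inner ℝ (v.2.2 i) (S.g i (x i)) := by
    rw [stackInner_sub_right, hz]
    have h2 : stackInner (fun i => (N : ℝ)⁻¹ • S.coupling x - S.g i (x i)) (fun _ => lam) = 0 := by
      rw [← hz]
      simp only [stackInner]
      rw [← sum_inner, hw.sum_lap, inner_zero_left]
    rw [h2, sub_zero]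
    simp only [stackInner, inner_sub_left, Finset.sum_sub_distrib, real_inner_smul_left,
      ← Finset.mul_sum]
    simp only [real_inner_comm]
  have h2 : 0 ≤ (N : ℝ)⁻¹ * -(∑ i, inner ℝ (S.coupling x) (v.2.2 i)) := by
    rw [← Finset.sum_neg_distrib]
    refine mul_nonneg (by positivity) (Finset.sum_nonneg fun i _ => ?_)
    rw [← inner_neg_left]
    exact inner_nonneg_of_mem_orthant hcoup (hv.2 i)
  have h3 := hL v.1 hv.1
  simp only [lagBif, hl0, stackInner_sub_left, h1, sum_inner_coupling]
  have h4 : ∀ t : Profile N m, stackInner (0 : Profile N m) t = 0 := fun t => by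
    simp [stackInner]
  rw [h4, h4]
  linarith

end SGNEP

/-! ### Euclidean projections. -/

section Projection

variable {p : ℕ} {C : Set (Vec p)}

theorem proj_spec (hne : C.Nonempty) (hc : IsClosed C) (x : Vec p) :
    proj C x ∈ C ∧ ∀ z ∈ C, ‖proj C x - x‖ ≤ ‖z - x‖ := by
  have h : ∃ y, y ∈ C ∧ ∀ z ∈ C, ‖y - x‖ ≤ ‖z - x‖ := by
    obtain ⟨y, hy, hxy⟩ := hc.exists_infDist_eq_dist hne x
    refine ⟨y, hy, fun z hz => ?_⟩
    rw [← dist_eq_norm, ← dist_eq_norm, dist_comm y, dist_comm z, ← hxy]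
    exact Metric.infDist_le_dist_of_mem hz
  exact Classical.epsilon_spec h

theorem proj_of_mem {x : Vec p} (hc : IsClosed C) (hx : x ∈ C) : proj C x = x := by
  have h := (proj_spec ⟨x, hx⟩ hc x).2 x hx
  rw [sub_self, norm_zero] at h
  exact sub_eq_zero.1 (norm_le_zero_iff.1 h)

theorem inner_sub_proj_le_zero (hne : C.Nonempty) (hc : IsClosed C) (hconv : Convex ℝ C)
    (x : Vec p) {z : Vec p} (hz : z ∈ C) : inner ℝ (x - proj C x) (z - proj C x) ≤ 0 := by
  obtain ⟨h1, h2⟩ := proj_spec hne hc x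
  refine (norm_eq_iInf_iff_real_inner_le_zero hconv h1).1 ?_ z hz
  have : Nonempty C := hne.to_subtype
  refine le_antisymm (le_ciInf fun z => ?_)
    (ciInf_le ⟨0, by rintro _ ⟨z, rfl⟩; exact norm_nonneg _⟩ (⟨_, h1⟩ : C))
  rw [norm_sub_rev, norm_sub_rev x]
  exact h2 z z.2

theorem norm_proj_sub_proj_le (hne : C.Nonempty) (hc : IsClosed C) (hconv : Convex ℝ C)
    (x y : Vec p) : ‖proj C x - proj C y‖ ≤ ‖x - y‖ := by
  have h1 := inner_sub_proj_le_zero hne hc hconv x (proj_spec hne hc y).1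
  have h2 := inner_sub_proj_le_zero hne hc hconv y (proj_spec hne hc x).1
  set a := proj C x
  set b := proj C y
  have h3 : inner ℝ (x - y) (a - b) = ‖a - b‖ ^ 2 - inner ℝ (x - a) (b - a)
      - inner ℝ (y - b) (a - b) := by
    have h4 : inner ℝ (x - a) (b - a) = -inner ℝ (x - a) (a - b) := by
      rw [← inner_neg_right, neg_sub]
    rw [h4, ← real_inner_self_eq_norm_sq, sub_neg_eq_add, ← inner_add_left, ← inner_sub_left]
    congr 1
    abel
  have h5 := real_inner_le_norm (x - y) (a - b)
  rcases (norm_nonneg (a - b)).eq_or_lt with h | h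
  · rw [← h]; exact norm_nonneg _
  · nlinarith

theorem continuous_proj (hne : C.Nonempty) (hc : IsClosed C) (hconv : Convex ℝ C) :
    Continuous (proj C) :=
  (LipschitzWith.of_dist_le_mul (K := 1) fun x y => by
    simpa [dist_eq_norm] using norm_proj_sub_proj_le hne hc hconv x y).continuous

/-- One projected step of length `a` in the direction `-v`, measured at a point `y` of the set. -/
theorem norm_sq_proj_sub_le (hc : IsClosed C) (hconv : Convex ℝ C) (x v : Vec p) {y : Vec p}
    (hy : y ∈ C) {a c : ℝ} (hc0 : 0 < c) :
    c⁻¹ * ‖proj C (x - (a * c) • v) - y‖ ^ 2 ≤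
      c⁻¹ * ‖x - y‖ ^ 2 - 2 * a * inner ℝ v (x - y) + a ^ 2 * (c * ‖v‖ ^ 2) := by
  have h1 := norm_proj_sub_proj_le ⟨y, hy⟩ hc hconv (x - (a * c) • v) y
  rw [proj_of_mem hc hy] at h1
  have h2 : x - (a * c) • v - y = (x - y) - (a * c) • v := by abel
  -- Weighting by `c⁻¹` leaves only the common step length `a` before the inner product, so blocks
  -- with different scalings can be added.
  have h3 : c⁻¹ * ‖x - (a * c) • v - y‖ ^ 2 =
      c⁻¹ * ‖x - y‖ ^ 2 - 2 * a * inner ℝ v (x - y) + a ^ 2 * (c * ‖v‖ ^ 2) := by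
    rw [h2, norm_sub_sq_real, inner_smul_right, norm_smul, Real.norm_eq_abs, mul_pow, sq_abs,
      real_inner_comm]
    field_simp
  rw [← h3]
  gcongr

end Projection

/-! ### Scalar coordinates and linear growth of the data. -/

/-- A state as the family of its scalar coordinates. -/
def coordEquiv (N n m : ℕ) : State N n m ≃ₗ[ℝ] (Coord N n m → ℝ) where
  toFun u c := c.elim (fun q => u.1 q.1 q.2)
    fun c => c.elim (fun q => u.2.1 q.1 q.2) fun q => u.2.2 q.1 q.2
  invFun f := (fun i => WithLp.toLp 2 fun l => f (.inl (i, l)),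
    fun i => WithLp.toLp 2 fun l => f (.inr (.inl (i, l))),
    fun i => WithLp.toLp 2 fun l => f (.inr (.inr (i, l))))
  map_add' u v := by
    funext c
    rcases c with q | q | q <;> rfl
  map_smul' a u := by
    funext c
    rcases c with q | q | q <;> rfl
  left_inv u := rfl
  right_inv f := by
    funext c
    rcases c with q | q | q <;> rfl

theorem coordEquiv_inl {N n m : ℕ} (u : State N n m) (q : Fin N × Fin n) :
    coordEquiv N n m u (.inl q) = u.1 q.1 q.2 := rfl

theorem coordEquiv_inr_inl {N n m : ℕ} (u : State N n m) (q : Fin N × Fin m) :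
    coordEquiv N n m u (.inr (.inl q)) = u.2.1 q.1 q.2 := rfl

theorem coordEquiv_inr_inr {N n m : ℕ} (u : State N n m) (q : Fin N × Fin m) :
    coordEquiv N n m u (.inr (.inr q)) = u.2.2 q.1 q.2 := rfl

/-- A state as the family of its scalar coordinates, as a continuous linear equivalence. -/
noncomputable def coordCLE (N n m : ℕ) : State N n m ≃L[ℝ] (Coord N n m → ℝ) :=
  (coordEquiv N n m).toContinuousLinearEquiv

theorem norm_tik_le {p : ℕ} {e : Fin p → ℝ} {E : ℝ} (he : ∀ l, |e l| ≤ E) (hE : 0 ≤ E)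
    (v : Vec p) : ‖tik e v‖ ≤ E * ‖v‖ := by
  rw [EuclideanSpace.norm_eq, EuclideanSpace.norm_eq, ← Real.sqrt_sq hE, ← Real.sqrt_mul (sq_nonneg E),
    Finset.mul_sum]
  refine Real.sqrt_le_sqrt (Finset.sum_le_sum fun l _ => ?_)
  simp only [tik, Real.norm_eq_abs, sq_abs, mul_pow]
  have := sq_le_sq' (by linarith [neg_abs_le (e l), he l]) ((le_abs_self _).trans (he l))
  gcongr

theorem stackNorm_le {N p : ℕ} (v : Profile N p) : stackNorm v ≤ Real.sqrt N * ‖v‖ := by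
  rw [stackNorm, ← Real.sqrt_sq (norm_nonneg v), ← Real.sqrt_mul (Nat.cast_nonneg N)]
  refine Real.sqrt_le_sqrt ?_
  calc ∑ i, ‖v i‖ ^ 2 ≤ ∑ _i : Fin N, ‖v‖ ^ 2 := by
        gcongr with i
        exact norm_le_pi_norm v i
    _ = N * ‖v‖ ^ 2 := by simp

namespace SGNEP

variable {N n m d : ℕ} {S : SGNEP N n m d} {p : Params N n m} {G : SimpleGraph (Fin N)}

/-- This inequality converts the term `∇gᵀλ` of the algorithm into the constraint values appearing
in `lagBif`. -/
theorem ConvexCoupling.inner_fderiv_le (hg : S.ConvexCoupling) {lam : Vec m}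
    (hl : lam ∈ orthant m) (i : Fin N) (x y : Vec n) :
    inner ℝ lam (fderiv ℝ (S.g i) x (y - x)) ≤
      inner ℝ lam (S.g i y) - inner ℝ lam (S.g i x) := by
  rw [← inner_sub_right, ← sub_nonneg, ← inner_sub_right]
  refine inner_nonneg_of_mem_orthant hl fun l => ?_
  have h1 : HasFDerivAt (fun y => S.g i y l)
      ((EuclideanSpace.proj l : Vec m →L[ℝ] ℝ).comp (fderiv ℝ (S.g i) x)) x :=
    (EuclideanSpace.proj l : Vec m →L[ℝ] ℝ).hasFDerivAt.comp x
      (hg.differentiable i x).hasFDerivAt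
  have h2 := (hg.convex i l).hasFDerivAt_sub_le (Set.mem_univ x) (Set.mem_univ y) h1
  simpa using h2

/-- By separability, two profiles differing in one block isolate the function of that block. -/
theorem ConvexCoupling.exists_lipschitz (hg : S.ConvexCoupling) :
    ∃ ℓ : ℝ, 0 ≤ ℓ ∧ ∀ i x y, ‖S.g i x - S.g i y‖ ≤ ℓ * ‖x - y‖ := by
  obtain ⟨ℓ, hℓ, h⟩ := hg.lipschitz
  refine ⟨ℓ, hℓ.le, fun i x y => ?_⟩
  have h1 := h (Function.update (0 : Profile N n) i x) (Function.update (0 : Profile N n) i y)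
  have h2 : S.coupling (Function.update (0 : Profile N n) i x) -
      S.coupling (Function.update (0 : Profile N n) i y) = S.g i x - S.g i y := by
    rw [coupling, coupling, ← Finset.sum_sub_distrib, Finset.sum_eq_single i]
    · simp
    · intro j _ hj; simp [hj]
    · simp
  have h3 : stackNorm (Function.update (0 : Profile N n) i x -
      Function.update (0 : Profile N n) i y) =
      ‖x - y‖ := by
    rw [stackNorm, Finset.sum_eq_single i]
    · simp
    · intro j _ hj; simp [hj]
    · simp
  rw [h2, h3] at h1
  exact h1

theorem exists_norm_F_le (hcq : S.ConstraintQualification) (hF : S.MonotoneLipschitz) :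
    ∃ K : ℝ, 0 ≤ K ∧ ∀ u ∈ S.dom, ∀ i, ‖S.F u.1 i‖ ≤ K * (1 + ‖u‖) := by
  obtain ⟨ℓ, hℓ, h⟩ := hF.lipschitz
  choose x₀ hx₀ using hcq.nonempty
  set c := ℓ * Real.sqrt N with hc
  have hc0 : 0 ≤ c := by positivity
  refine ⟨‖S.F x₀‖ + c * ‖x₀‖ + c, by positivity, fun u hu i => ?_⟩
  have h1 := (norm_le_stackNorm (S.F u.1 - S.F x₀) i).trans (h u.1 hu.1 x₀ hx₀)
  have h2 : ℓ * stackNorm (u.1 - x₀) ≤ c * ‖u.1 - x₀‖ := by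
    rw [hc, mul_assoc]
    gcongr
    exact stackNorm_le _
  have h3 : c * ‖u.1 - x₀‖ ≤ c * (‖u‖ + ‖x₀‖) := by
    gcongr
    exact (norm_sub_le _ _).trans (add_le_add_left (norm_fst_le u) _)
  have h4 : ‖S.F u.1 i‖ ≤ ‖(S.F u.1 - S.F x₀) i‖ + ‖S.F x₀ i‖ := by
    have := norm_add_le ((S.F u.1 - S.F x₀) i) (S.F x₀ i)
    simpa using this
  have h5 := norm_le_pi_norm (S.F x₀) i
  have h6 : 0 ≤ ‖S.F x₀‖ * ‖u‖ := by positivity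
  have h7 : 0 ≤ c * ‖x₀‖ * ‖u‖ := by positivity
  nlinarith

/-- The Lipschitz constant bounds the derivative everywhere, so `∇gᵀλ` grows only linearly in the
state. Linear growth lets the squared directions be absorbed into multiples of `1 + v`. -/
theorem ConvexCoupling.exists_norm_le (hg : S.ConvexCoupling) :
    ∃ K : ℝ, 0 ≤ K ∧ ∀ u : State N n m, ∀ i, ‖S.g i (u.1 i)‖ ≤ K * (1 + ‖u‖) ∧
      ‖ContinuousLinearMap.adjoint (fderiv ℝ (S.g i) (u.1 i)) (u.2.2 i)‖ ≤ K * (1 + ‖u‖) := by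
  obtain ⟨ℓ, hℓ, h⟩ := hg.exists_lipschitz
  set A := ∑ i, ‖S.g i 0‖ with hA
  have hA0 : 0 ≤ A := by positivity
  refine ⟨ℓ + A, by positivity, fun u i => ⟨?_, ?_⟩⟩
  · have h1 := h i (u.1 i) 0
    rw [sub_zero] at h1
    have h2 : ‖u.1 i‖ ≤ ‖u‖ := (norm_le_pi_norm u.1 i).trans (norm_fst_le u)
    have h3 : ‖S.g i 0‖ ≤ A := Finset.single_le_sum (f := fun i => ‖S.g i 0‖)
      (fun _ _ => norm_nonneg _) (Finset.mem_univ i)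
    have h4 : ‖S.g i (u.1 i)‖ ≤ ‖S.g i (u.1 i) - S.g i 0‖ + ‖S.g i 0‖ := by
      have := norm_add_le (S.g i (u.1 i) - S.g i 0) (S.g i 0)
      simpa using this
    have h5 := mul_le_mul_of_nonneg_left h2 hℓ
    have h6 : 0 ≤ A * ‖u‖ := by positivity
    nlinarith
  · have h1 : ‖fderiv ℝ (S.g i) (u.1 i)‖ ≤ ℓ := by
      have hlip : LipschitzWith (Real.toNNReal ℓ) (S.g i) :=
        LipschitzWith.of_dist_le_mul fun x y => by
          simpa [dist_eq_norm, Real.coe_toNNReal _ hℓ] using h i x y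
      simpa [Real.coe_toNNReal _ hℓ] using norm_fderiv_le_of_lipschitz ℝ hlip (x₀ := u.1 i)
    have h2 : ‖u.2.2 i‖ ≤ ‖u‖ :=
      (norm_le_pi_norm u.2.2 i).trans ((norm_snd_le u.2).trans (norm_snd_le u))
    refine (ContinuousLinearMap.le_opNorm _ _).trans ?_
    rw [LinearIsometryEquiv.norm_map]
    have h3 : ‖fderiv ℝ (S.g i) (u.1 i)‖ * ‖u.2.2 i‖ ≤ ℓ * ‖u‖ := by gcongr
    have h4 : 0 ≤ A * ‖u‖ := by positivity
    nlinarith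

theorem exists_norm_lap_le (w : Fin N → Fin N → ℝ) :
    ∃ K : ℝ, 0 ≤ K ∧ ∀ (v : Profile N m) (i : Fin N), ‖lap w v i‖ ≤ K * ‖v‖ := by
  refine ⟨∑ i, ∑ j, |w i j| * 2, by positivity, fun v i => ?_⟩
  calc ‖lap w v i‖ ≤ ∑ j, ‖w i j • (v i - v j)‖ := norm_sum_le _ _
    _ ≤ ∑ j, |w i j| * 2 * ‖v‖ := by
        refine Finset.sum_le_sum fun j _ => ?_
        rw [norm_smul, Real.norm_eq_abs, mul_assoc]
        gcongr
        have := norm_sub_le (v i) (v j)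
        linarith [norm_le_pi_norm v i, norm_le_pi_norm v j]
    _ = (∑ j, |w i j| * 2) * ‖v‖ := by rw [Finset.sum_mul]
    _ ≤ _ := by
        refine mul_le_mul_of_nonneg_right ?_ (norm_nonneg v)
        exact Finset.single_le_sum (f := fun i => ∑ j, |w i j| * 2)
          (fun _ _ => by positivity) (Finset.mem_univ i)

end SGNEP

/-! ### The metric induced by the step scalings. -/

section WeightedDistance

variable {N n m : ℕ} {p : Params N n m}

theorem sum_sq_coordEquiv (u y : State N n m) :
    ∑ c, (coordEquiv N n m u c - coordEquiv N n m y c) ^ 2 =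
      ∑ i, (‖u.1 i - y.1 i‖ ^ 2 + ‖u.2.1 i - y.2.1 i‖ ^ 2 + ‖u.2.2 i - y.2.2 i‖ ^ 2) := by
  simp only [Fintype.sum_sum_type, Fintype.sum_prod_type, EuclideanSpace.norm_sq_eq,
    Finset.sum_add_distrib, coordEquiv_inl, coordEquiv_inr_inl, coordEquiv_inr_inr, PiLp.sub_apply, Real.norm_eq_abs, sq_abs]
  ring

/-- The squared distance of two states in the metric induced by the step scalings. -/
noncomputable def Params.distSq (p : Params N n m) (u y : State N n m) : ℝ :=
  ∑ i, ((p.γ i)⁻¹ * ‖u.1 i - y.1 i‖ ^ 2 + (p.ν i)⁻¹ * ‖u.2.1 i - y.2.1 i‖ ^ 2 +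
    (p.τ i)⁻¹ * ‖u.2.2 i - y.2.2 i‖ ^ 2)

theorem Params.Valid.distSq_nonneg (hp : p.Valid) (u y : State N n m) : 0 ≤ p.distSq u y :=
  Finset.sum_nonneg fun i _ => by
    have := hp.γ_pos i
    have := hp.ν_pos i
    have := hp.τ_pos i
    positivity

theorem Params.continuous_distSq (p : Params N n m) :
    Continuous fun q : State N n m × State N n m => p.distSq q.1 q.2 := by
  unfold Params.distSq
  fun_prop

theorem Params.Valid.exists_distSq_le (hp : p.Valid) : ∃ K > 0, ∀ u y : State N n m,
    p.distSq u y ≤ K * ∑ c, (coordEquiv N n m u c - coordEquiv N n m y c) ^ 2 := by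
  have h0 : ∀ i, 0 ≤ (p.γ i)⁻¹ ∧ 0 ≤ (p.ν i)⁻¹ ∧ 0 ≤ (p.τ i)⁻¹ := fun i =>
    ⟨(inv_pos.2 (hp.γ_pos i)).le, (inv_pos.2 (hp.ν_pos i)).le, (inv_pos.2 (hp.τ_pos i)).le⟩
  set K := 1 + ∑ i, ((p.γ i)⁻¹ + (p.ν i)⁻¹ + (p.τ i)⁻¹) with hK
  have hle : ∀ i, (p.γ i)⁻¹ + (p.ν i)⁻¹ + (p.τ i)⁻¹ ≤ K := fun i => by
    have := Finset.single_le_sum (f := fun i => (p.γ i)⁻¹ + (p.ν i)⁻¹ + (p.τ i)⁻¹)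
      (fun i _ => by have := h0 i; linarith) (Finset.mem_univ i)
    linarith
  have hs0 : 0 ≤ ∑ i, ((p.γ i)⁻¹ + (p.ν i)⁻¹ + (p.τ i)⁻¹) :=
    Finset.sum_nonneg fun i _ => by have := h0 i; linarith
  refine ⟨K, by linarith, fun u y => ?_⟩
  rw [sum_sq_coordEquiv, Params.distSq, Finset.mul_sum]
  refine Finset.sum_le_sum fun i _ => ?_
  obtain ⟨h1, h2, h3⟩ := h0 i
  have h4 := hle i
  rw [mul_add, mul_add]
  gcongr <;> linarith

theorem Params.Valid.exists_norm_sq_le (hp : p.Valid) : ∃ K > 0, ∀ u y : State N n m,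
    ‖u - y‖ ^ 2 ≤ K * p.distSq u y := by
  have h0 : ∀ i, 0 < p.γ i ∧ 0 < p.ν i ∧ 0 < p.τ i := fun i =>
    ⟨hp.γ_pos i, hp.ν_pos i, hp.τ_pos i⟩
  set K := 1 + ∑ i, (p.γ i + p.ν i + p.τ i) with hK
  have hle : ∀ i, p.γ i + p.ν i + p.τ i ≤ K := fun i => by
    have := Finset.single_le_sum (f := fun i => p.γ i + p.ν i + p.τ i)
      (fun i _ => by have := h0 i; linarith) (Finset.mem_univ i)
    linarith
  have hs0 : 0 ≤ ∑ i, (p.γ i + p.ν i + p.τ i) :=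
    Finset.sum_nonneg fun i _ => by have := h0 i; linarith
  have hK0 : 0 < K := by linarith
  refine ⟨K, hK0, fun u y => ?_⟩
  have hD := hp.distSq_nonneg u y
  have hterm : ∀ i, ‖u.1 i - y.1 i‖ ^ 2 ≤ K * p.distSq u y ∧
      ‖u.2.1 i - y.2.1 i‖ ^ 2 ≤ K * p.distSq u y ∧
      ‖u.2.2 i - y.2.2 i‖ ^ 2 ≤ K * p.distSq u y := by
    intro i
    obtain ⟨h1, h2, h3⟩ := h0 i
    have h4 := hle i
    have h5 := Finset.single_le_sum (f := fun i => (p.γ i)⁻¹ * ‖u.1 i - y.1 i‖ ^ 2 +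
      (p.ν i)⁻¹ * ‖u.2.1 i - y.2.1 i‖ ^ 2 + (p.τ i)⁻¹ * ‖u.2.2 i - y.2.2 i‖ ^ 2)
      (fun i _ => by obtain ⟨_, _, _⟩ := h0 i; positivity) (Finset.mem_univ i)
    change _ ≤ p.distSq u y at h5
    have key : ∀ {c x : ℝ}, 0 < c → c ≤ K → c⁻¹ * x ≤ p.distSq u y → x ≤ K * p.distSq u y := by
      intro c x hc hcK hx
      rw [inv_mul_le_iff₀ hc] at hx
      exact hx.trans (mul_le_mul_of_nonneg_right hcK hD)
    have h6 : 0 ≤ (p.γ i)⁻¹ * ‖u.1 i - y.1 i‖ ^ 2 := by positivity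
    have h7 : 0 ≤ (p.ν i)⁻¹ * ‖u.2.1 i - y.2.1 i‖ ^ 2 := by positivity
    have h8 : 0 ≤ (p.τ i)⁻¹ * ‖u.2.2 i - y.2.2 i‖ ^ 2 := by positivity
    exact ⟨key h1 (by linarith) (by linarith), key h2 (by linarith) (by linarith),
      key h3 (by linarith) (by linarith)⟩
  have hB : 0 ≤ K * p.distSq u y := mul_nonneg hK0.le hD
  have hnorm : ‖u - y‖ ≤ Real.sqrt (K * p.distSq u y) := by
    have hs := Real.sqrt_nonneg (K * p.distSq u y)
    refine norm_prod_le_iff.2 ⟨?_, norm_prod_le_iff.2 ⟨?_, ?_⟩⟩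
    · exact (pi_norm_le_iff_of_nonneg hs).2 fun i => Real.le_sqrt_of_sq_le (hterm i).1
    · exact (pi_norm_le_iff_of_nonneg hs).2 fun i => Real.le_sqrt_of_sq_le (hterm i).2.1
    · exact (pi_norm_le_iff_of_nonneg hs).2 fun i => Real.le_sqrt_of_sq_le (hterm i).2.2
  calc ‖u - y‖ ^ 2 ≤ Real.sqrt (K * p.distSq u y) ^ 2 := by gcongr
    _ = _ := Real.sq_sqrt hB

theorem norm_sub_sq_le_add_mul {V : Type*} [NormedAddCommGroup V] (u y y' : V) {t : ℝ}
    (ht : 0 < t) : ‖u - y'‖ ^ 2 ≤ (1 + t) * ‖u - y‖ ^ 2 + (1 + 1 / t) * ‖y - y'‖ ^ 2 := by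
  have h1 : ‖u - y'‖ ≤ ‖u - y‖ + ‖y - y'‖ := norm_sub_le_norm_sub_add_norm_sub u y y'
  have h2 : ‖u - y'‖ ^ 2 ≤ (‖u - y‖ + ‖y - y'‖) ^ 2 := by gcongr
  have h3 : (1 + t) * ‖u - y‖ ^ 2 + (1 + 1 / t) * ‖y - y'‖ ^ 2 - (‖u - y‖ + ‖y - y'‖) ^ 2 =
      (t * ‖u - y‖ - ‖y - y'‖) ^ 2 / t := by
    field_simp
    ring
  have h4 : 0 ≤ (t * ‖u - y‖ - ‖y - y'‖) ^ 2 / t := by positivity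
  linarith

/-- This moves the reference point from `y k` to `y (k+1)`; with `t` equal to the contraction rate,
the factor `1 + t` costs only part of the contraction. -/
theorem Params.Valid.distSq_le_add_mul (hp : p.Valid) (u y y' : State N n m) {t : ℝ}
    (ht : 0 < t) : p.distSq u y' ≤ (1 + t) * p.distSq u y + (1 + 1 / t) * p.distSq y y' := by
  simp only [Params.distSq, Finset.mul_sum]
  rw [← Finset.sum_add_distrib]
  refine Finset.sum_le_sum fun i _ => ?_
  have h1 := mul_le_mul_of_nonneg_left (norm_sub_sq_le_add_mul (u.1 i) (y.1 i) (y'.1 i) ht)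
    (inv_pos.2 (hp.γ_pos i)).le
  have h2 := mul_le_mul_of_nonneg_left (norm_sub_sq_le_add_mul (u.2.1 i) (y.2.1 i) (y'.2.1 i) ht)
    (inv_pos.2 (hp.ν_pos i)).le
  have h3 := mul_le_mul_of_nonneg_left (norm_sub_sq_le_add_mul (u.2.2 i) (y.2.2 i) (y'.2.2 i) ht)
    (inv_pos.2 (hp.τ_pos i)).le
  linarith

end WeightedDistance

/-! ### Search directions of the algorithm. -/

namespace SGNEP

variable {N n m d : ℕ} {S : SGNEP N n m d} {p : Params N n m} {G : SimpleGraph (Fin N)}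

variable (S p) in
/-- The exact regularized direction of the primal variables. -/
noncomputable def dirX (k : ℕ) (u : State N n m) (i : Fin N) : Vec n :=
  S.F u.1 i + ContinuousLinearMap.adjoint (fderiv ℝ (S.g i) (u.1 i)) (u.2.2 i) +
    tik (fun l => p.ε k (.inl (i, l))) (u.1 i)

variable (S p) in
/-- The regularized direction of the multipliers. -/
noncomputable def dirL (k : ℕ) (u : State N n m) (i : Fin N) : Vec m :=
  lap p.w u.2.2 i - lap p.w u.2.1 i - S.g i (u.1 i) +
    tik (fun l => p.ε k (.inr (.inr (i, l)))) (u.2.2 i)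

end SGNEP

/-- The regularized direction of the auxiliary variables. -/
noncomputable def Params.dirZ {N n m : ℕ} (p : Params N n m) (k : ℕ) (u : State N n m)
    (i : Fin N) : Vec m :=
  lap p.w u.2.2 i + tik (fun l => p.ε k (.inr (.inl (i, l)))) (u.2.1 i)

namespace SGNEP

variable {N n m d : ℕ} {S : SGNEP N n m d} {p : Params N n m} {G : SimpleGraph (Fin N)}

theorem inner_tik {q : ℕ} (e : Fin q → ℝ) (v y : Vec q) :
    inner ℝ (tik e v) (v - y) = ∑ l, e l * v l * (v l - y l) := by
  rw [PiLp.inner_apply]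
  refine Finset.sum_congr rfl fun l _ => ?_
  simp [tik]
  ring

theorem sum_tik (k : ℕ) (u y : State N n m) :
    ∑ c, p.ε k c * coordEquiv N n m u c * (coordEquiv N n m u c - coordEquiv N n m y c) =
      ∑ i, (inner ℝ (tik (fun l => p.ε k (.inl (i, l))) (u.1 i)) (u.1 i - y.1 i) +
        inner ℝ (tik (fun l => p.ε k (.inr (.inl (i, l)))) (u.2.1 i)) (u.2.1 i - y.2.1 i) +
        inner ℝ (tik (fun l => p.ε k (.inr (.inr (i, l)))) (u.2.2 i)) (u.2.2 i - y.2.2 i)) := by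
  simp only [Fintype.sum_sum_type, Fintype.sum_prod_type, inner_tik,
    Finset.sum_add_distrib, coordEquiv_inl, coordEquiv_inr_inl, coordEquiv_inr_inr]
  ring

/-- All terms agree except `∇gᵀλ`, where convexity of `g` and `λ ≥ 0` give the inequality in the
right direction. Descent along the directions is thereby controlled by the bifunction. -/
theorem le_sum_inner_dir (hg : S.ConvexCoupling) (k : ℕ) {u y : State N n m} (hu : u ∈ S.dom) :
    -S.lagBif p.w u y +
      ∑ c, p.ε k c * coordEquiv N n m u c * (coordEquiv N n m u c - coordEquiv N n m y c) ≤
      ∑ i, (inner ℝ (S.dirX p k u i) (u.1 i - y.1 i) +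
        inner ℝ (p.dirZ k u i) (u.2.1 i - y.2.1 i) +
        inner ℝ (S.dirL p k u i) (u.2.2 i - y.2.2 i)) := by
  rw [sum_tik]
  have h1 : -S.lagBif p.w u y = ∑ i, (inner ℝ (S.F u.1 i) (u.1 i - y.1 i)
      - inner ℝ (u.2.2 i) (S.g i (y.1 i)) + inner ℝ (y.2.2 i) (S.g i (u.1 i))
      + inner ℝ (lap p.w u.2.2 i) (u.2.1 i - y.2.1 i)
      + inner ℝ (lap p.w u.2.2 i - lap p.w u.2.1 i) (u.2.2 i - y.2.2 i)) := by
    simp only [lagBif, stackInner, Finset.sum_add_distrib, Finset.sum_sub_distrib, Pi.sub_apply,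
      inner_sub_right]
    ring
  rw [h1, ← Finset.sum_add_distrib]
  refine Finset.sum_le_sum fun i _ => ?_
  have h2 := hg.inner_fderiv_le (hu.2 i) i (u.1 i) (y.1 i)
  have h3 : inner ℝ (ContinuousLinearMap.adjoint (fderiv ℝ (S.g i) (u.1 i)) (u.2.2 i))
      (u.1 i - y.1 i) = -inner ℝ (u.2.2 i) (fderiv ℝ (S.g i) (u.1 i) (y.1 i - u.1 i)) := by
    rw [ContinuousLinearMap.adjoint_inner_left, ← inner_neg_right, ← map_neg, neg_sub]
  have h4 : inner ℝ (S.g i (u.1 i)) (u.2.2 i - y.2.2 i) =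
      inner ℝ (u.2.2 i) (S.g i (u.1 i)) - inner ℝ (y.2.2 i) (S.g i (u.1 i)) := by
    rw [inner_sub_right, real_inner_comm, real_inner_comm (y.2.2 i)]
  simp only [dirX, Params.dirZ, dirL, inner_add_left]
  rw [h3, inner_sub_left (lap p.w u.2.2 i - lap p.w u.2.1 i) (S.g i (u.1 i)), h4]
  linarith

theorem step_fst (k : ℕ) (s : Fin N → Vec d) (u : State N n m) (i : Fin N) :
    (S.step p k s u).1 i = proj (S.Ω i) (u.1 i - (p.α k * p.γ i) •
      (S.dirX p k u i - (S.F u.1 i - S.partialGrad i u.1 (s i)))) := by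
  simp only [step, dirX]
  congr 3
  abel

theorem step_snd_fst (k : ℕ) (s : Fin N → Vec d) (u : State N n m) (i : Fin N) :
    (S.step p k s u).2.1 i = u.2.1 i - (p.α k * p.ν i) • p.dirZ k u i := rfl

theorem step_snd_snd (k : ℕ) (s : Fin N → Vec d) (u : State N n m) (i : Fin N) :
    (S.step p k s u).2.2 i = proj (orthant m) (u.2.2 i - (p.α k * p.τ i) • S.dirL p k u i) := by
  have h : ∑ j, p.w i j • ((u.2.1 i - u.2.1 j) - (u.2.2 i - u.2.2 j)) =
      lap p.w u.2.1 i - lap p.w u.2.2 i := by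
    simp only [lap, smul_sub, Finset.sum_sub_distrib]
  simp only [step, dirL, h]
  congr 1
  rw [sub_eq_add_neg (u.2.2 i), ← smul_neg]
  congr 2
  abel

theorem step_mem_dom (hcq : S.ConstraintQualification) (k : ℕ) (s : Fin N → Vec d)
    (u : State N n m) : S.step p k s u ∈ S.dom := by
  refine ⟨fun i => ?_, fun i => ?_⟩
  · rw [step_fst]
    exact (proj_spec (hcq.nonempty i) (hcq.closed i) _).1
  · rw [step_snd_snd]
    exact (proj_spec ⟨0, zero_mem_orthant⟩ isClosed_orthant _).1

theorem exists_norm_dir_le (hcq : S.ConstraintQualification) (hg : S.ConvexCoupling)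
    (hF : S.MonotoneLipschitz) {E : ℝ} (hE : 0 ≤ E) (hε : ∀ k c, |p.ε k c| ≤ E) :
    ∃ K : ℝ, 0 ≤ K ∧ ∀ k, ∀ u ∈ S.dom, ∀ i, ‖S.dirX p k u i‖ ≤ K * (1 + ‖u‖) ∧
      ‖p.dirZ k u i‖ ≤ K * (1 + ‖u‖) ∧ ‖S.dirL p k u i‖ ≤ K * (1 + ‖u‖) := by
  obtain ⟨K₁, hK₁, h₁⟩ := exists_norm_F_le hcq hF
  obtain ⟨K₂, hK₂, h₂⟩ := hg.exists_norm_le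
  obtain ⟨K₃, hK₃, h₃⟩ := exists_norm_lap_le (m := m) p.w
  refine ⟨K₁ + K₂ + 2 * K₃ + E, by positivity, fun k u hu i => ?_⟩
  have hn := norm_nonneg u
  have hu1 : ‖u.1‖ ≤ ‖u‖ := norm_fst_le u
  have hu2 : ‖u.2.1‖ ≤ ‖u‖ := (norm_fst_le u.2).trans (norm_snd_le u)
  have hu3 : ‖u.2.2‖ ≤ ‖u‖ := (norm_snd_le u.2).trans (norm_snd_le u)
  have hlap : ∀ v : Profile N m, ‖v‖ ≤ ‖u‖ → ‖lap p.w v i‖ ≤ K₃ * (1 + ‖u‖) := fun v hv =>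
    (h₃ v i).trans (mul_le_mul_of_nonneg_left (by linarith) hK₃)
  have htik : ∀ {q : ℕ} (e : Fin q → ℝ) (v : Vec q), (∀ l, |e l| ≤ E) → ‖v‖ ≤ ‖u‖ →
      ‖tik e v‖ ≤ E * (1 + ‖u‖) := fun e v he hv =>
    (norm_tik_le he hE v).trans (mul_le_mul_of_nonneg_left (by linarith) hE)
  have hF1 := h₁ u hu i
  obtain ⟨hg1, hg2⟩ := h₂ u i
  have hl2 := hlap u.2.1 hu2
  have hl3 := hlap u.2.2 hu3
  have p1 : 0 ≤ K₁ * (1 + ‖u‖) := by positivity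
  have p2 : 0 ≤ K₂ * (1 + ‖u‖) := by positivity
  have p3 : 0 ≤ K₃ * (1 + ‖u‖) := by positivity
  refine ⟨?_, ?_, ?_⟩
  · have ht := htik (fun l => p.ε k (.inl (i, l))) (u.1 i) (fun l => hε k _)
      ((norm_le_pi_norm u.1 i).trans hu1)
    refine (norm_add_le _ _).trans ((add_le_add_left (norm_add_le _ _) _).trans ?_)
    linarith
  · have ht := htik (fun l => p.ε k (.inr (.inl (i, l)))) (u.2.1 i) (fun l => hε k _)
      ((norm_le_pi_norm u.2.1 i).trans hu2)
    refine (norm_add_le _ _).trans ?_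
    linarith
  · have ht := htik (fun l => p.ε k (.inr (.inr (i, l)))) (u.2.2 i) (fun l => hε k _)
      ((norm_le_pi_norm u.2.2 i).trans hu3)
    refine (norm_add_le _ _).trans ((add_le_add_left (norm_sub_le _ _) _).trans
      ((add_le_add_left (add_le_add_left (norm_sub_le _ _) _) _).trans ?_))
    linarith

end SGNEP

/-! ### Rates of the step sizes and of the regularization, in terms of the single rate `κ`. -/

section Rates

theorem tendsto_add_div_add_rpow (c c' s : ℝ) :
    Tendsto (fun k : ℕ => (((k : ℝ) + c) / ((k : ℝ) + c')) ^ s) atTop (𝓝 1) := by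
  have h1 : Tendsto (fun k : ℕ => (k : ℝ) + c') atTop atTop :=
    tendsto_atTop_add_const_right _ _ tendsto_natCast_atTop_atTop
  have h2 : Tendsto (fun k : ℕ => 1 + (c - c') / ((k : ℝ) + c')) atTop (𝓝 (1 + 0)) :=
    (h1.const_div_atTop (c - c')).const_add 1
  have h3 : Tendsto (fun k : ℕ => ((k : ℝ) + c) / ((k : ℝ) + c')) atTop (𝓝 1) := by
    rw [add_zero] at h2
    refine h2.congr' ?_
    filter_upwards [h1.eventually (eventually_gt_atTop 0)] with k hk
    field_simp
    ring
  simpa using h3.rpow_const (p := s) (Or.inl one_ne_zero)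

theorem tendsto_add_rpow_neg (c : ℝ) {s : ℝ} (hs : 0 < s) :
    Tendsto (fun k : ℕ => ((k : ℝ) + c) ^ (-s)) atTop (𝓝 0) :=
  (tendsto_rpow_neg_atTop hs).comp
    (tendsto_atTop_add_const_right _ _ tendsto_natCast_atTop_atTop)

namespace Params

variable {N n m : ℕ} {p : Params N n m}

/-- An offset dominating all the offsets of the regularization. -/
noncomputable def offset (p : Params N n m) : ℝ := 1 + ∑ c, p.ζ c

/-- A common lower bound of the regularization parameters. -/
noncomputable def κ (p : Params N n m) (k : ℕ) : ℝ := ((k : ℝ) + p.offset) ^ (-p.b)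

theorem Valid.one_le_offset (hp : p.Valid) : 1 ≤ p.offset := by
  have := Finset.sum_nonneg fun c (_ : c ∈ Finset.univ) => (hp.ζ_pos c).le
  unfold offset
  linarith

theorem Valid.le_offset (hp : p.Valid) (c : Coord N n m) : p.ζ c ≤ p.offset := by
  have := Finset.single_le_sum (f := p.ζ) (fun c _ => (hp.ζ_pos c).le) (Finset.mem_univ c)
  unfold offset
  linarith

theorem Valid.add_offset_pos (hp : p.Valid) (k : ℕ) : 0 < (k : ℝ) + p.offset := by
  have := hp.one_le_offset
  positivity

theorem Valid.add_η_pos (hp : p.Valid) (k : ℕ) : 0 < (k : ℝ) + p.η := by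
  have := hp.η_pos
  positivity

theorem Valid.add_ζ_pos (hp : p.Valid) (k : ℕ) (c : Coord N n m) : 0 < (k : ℝ) + p.ζ c := by
  have := hp.ζ_pos c
  positivity

theorem Valid.α_pos (hp : p.Valid) (k : ℕ) : 0 < p.α k := Real.rpow_pos_of_pos (hp.add_η_pos k) _

theorem Valid.κ_pos (hp : p.Valid) (k : ℕ) : 0 < p.κ k :=
  Real.rpow_pos_of_pos (hp.add_offset_pos k) _

theorem Valid.ε_pos (hp : p.Valid) (k : ℕ) (c : Coord N n m) : 0 < p.ε k c :=
  Real.rpow_pos_of_pos (hp.add_ζ_pos k c) _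

theorem Valid.κ_le_ε (hp : p.Valid) (k : ℕ) (c : Coord N n m) : p.κ k ≤ p.ε k c :=
  Real.rpow_le_rpow_of_nonpos (hp.add_ζ_pos k c) (by linarith [hp.le_offset c])
    (by linarith [hp.b_mem.1])

theorem Valid.exists_abs_ε_le (hp : p.Valid) : ∃ E : ℝ, 0 ≤ E ∧ ∀ k c, |p.ε k c| ≤ E := by
  refine ⟨∑ c, p.ε 0 c, Finset.sum_nonneg fun c _ => (hp.ε_pos 0 c).le, fun k c => ?_⟩
  rw [abs_of_pos (hp.ε_pos k c)]
  have h1 : p.ε k c ≤ p.ε 0 c := by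
    refine Real.rpow_le_rpow_of_nonpos (hp.add_ζ_pos 0 c) ?_ (by linarith [hp.b_mem.1])
    simp
  exact h1.trans (Finset.single_le_sum (f := p.ε 0) (fun c _ => (hp.ε_pos 0 c).le)
    (Finset.mem_univ c))

theorem Valid.tendsto_ε_div_κ (hp : p.Valid) (c : Coord N n m) :
    Tendsto (fun k => p.ε k c / p.κ k) atTop (𝓝 1) := by
  refine (tendsto_add_div_add_rpow (p.ζ c) p.offset (-p.b)).congr fun k => ?_
  rw [Real.div_rpow (hp.add_ζ_pos k c).le (hp.add_offset_pos k).le]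
  rfl

theorem Valid.tendsto_κ (hp : p.Valid) : Tendsto p.κ atTop (𝓝 0) :=
  tendsto_add_rpow_neg _ hp.b_mem.1

theorem Valid.tendsto_α_div_κ (hp : p.Valid) : Tendsto (fun k => p.α k / p.κ k) atTop (𝓝 0) := by
  have h1 := (tendsto_add_div_add_rpow p.offset p.η p.b).mul
    (tendsto_add_rpow_neg p.η (sub_pos.2 hp.lt))
  rw [one_mul] at h1
  refine h1.congr fun k => ?_
  have hη := hp.add_η_pos k
  have hZ := hp.add_offset_pos k
  rw [Real.div_rpow hZ.le hη.le, neg_sub, Real.rpow_sub hη, α, κ, Real.rpow_neg hη.le,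
    Real.rpow_neg hZ.le]
  have h2 := (Real.rpow_pos_of_pos hη p.b).ne'
  have h3 := (Real.rpow_pos_of_pos hη p.a).ne'
  have h4 := (Real.rpow_pos_of_pos hZ p.b).ne'
  field_simp

/-- The quotient is of order `k ^ (a + b - 1)`: the drift `1/k` of the regularized solutions is
negligible relative to the contraction rate. -/
theorem Valid.tendsto_inv_mul_α_mul_κ (hp : p.Valid) :
    Tendsto (fun k : ℕ => 1 / (((k : ℝ) + 1) * (p.α k * p.κ k))) atTop (𝓝 0) := by
  have hab : 0 < 1 - p.a - p.b := by linarith [hp.add_lt]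
  have h1 := ((tendsto_add_div_add_rpow p.η 1 p.a).mul
    (tendsto_add_div_add_rpow p.offset 1 p.b)).mul (tendsto_add_rpow_neg 1 hab)
  rw [mul_zero] at h1
  refine h1.congr fun k => ?_
  have hη := hp.add_η_pos k
  have hZ := hp.add_offset_pos k
  have h1 : 0 < (k : ℝ) + 1 := by positivity
  have h5 : -(1 - p.a - p.b) = p.a + p.b - 1 := by ring
  rw [Real.div_rpow hZ.le h1.le, Real.div_rpow hη.le h1.le, h5, Real.rpow_sub h1,
    Real.rpow_add h1, Real.rpow_one, α, κ, Real.rpow_neg hη.le, Real.rpow_neg hZ.le]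
  have h2 := (Real.rpow_pos_of_pos h1 p.b).ne'
  have h3 := (Real.rpow_pos_of_pos hη p.a).ne'
  have h4 := (Real.rpow_pos_of_pos hZ p.b).ne'
  have h6 := (Real.rpow_pos_of_pos h1 p.a).ne'
  field_simp

theorem Valid.tendsto_sum_α_mul_κ (hp : p.Valid) :
    Tendsto (fun k => ∑ j ∈ Finset.range k, p.α j * p.κ j) atTop atTop := by
  -- This `Z` exceeds both offsets and is at least one, so that `j + Z ≤ Z * (j + 1)` and the series
  -- dominates a multiple of the harmonic one.
  set Z := p.offset + p.η with hZ
  have hη0 := hp.η_pos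
  have hZ1 : 1 ≤ Z := by linarith [hp.one_le_offset]
  have h1 := Real.tendsto_sum_range_one_div_nat_succ_atTop.const_mul_atTop
    (inv_pos.2 (by linarith : 0 < Z))
  refine tendsto_atTop_mono (fun k => ?_) h1
  rw [Finset.mul_sum]
  refine Finset.sum_le_sum fun j _ => ?_
  have hη := hp.add_η_pos j
  have hZ' := hp.add_offset_pos j
  have hj : (0 : ℝ) ≤ j := j.cast_nonneg
  have hpos : 0 < (j : ℝ) + Z := by linarith
  calc Z⁻¹ * (1 / ((j : ℝ) + 1)) = (Z * ((j : ℝ) + 1))⁻¹ := by rw [one_div, mul_inv]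
    _ ≤ ((j : ℝ) + Z)⁻¹ := by
        refine inv_anti₀ hpos ?_
        nlinarith
    _ = ((j : ℝ) + Z) ^ (-1 : ℝ) := by rw [Real.rpow_neg_one]
    _ ≤ ((j : ℝ) + Z) ^ (-p.a + -p.b) :=
        Real.rpow_le_rpow_of_exponent_le (by linarith) (by linarith [hp.add_lt])
    _ = ((j : ℝ) + Z) ^ (-p.a) * ((j : ℝ) + Z) ^ (-p.b) := Real.rpow_add hpos _ _
    _ ≤ p.α j * p.κ j := by
        have h2 : ((j : ℝ) + Z) ^ (-p.a) ≤ p.α j :=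
          Real.rpow_le_rpow_of_nonpos hη (by linarith [hp.one_le_offset])
            (by linarith [hp.a_mem.1])
        have h3 : ((j : ℝ) + Z) ^ (-p.b) ≤ p.κ j :=
          Real.rpow_le_rpow_of_nonpos hZ' (by linarith) (by linarith [hp.b_mem.1])
        exact mul_le_mul h2 h3 (Real.rpow_nonneg hpos.le _) (hp.α_pos j).le

/-- With `s = t / (t + 1)` the difference is `t ^ (-b) * (1 - s ^ b)`, and `s ≤ s ^ b` because `s ≤
1` and `b ≤ 1`. -/
theorem rpow_neg_sub_rpow_neg_le {t b : ℝ} (ht : 0 < t) (hb0 : 0 ≤ b) (hb1 : b ≤ 1) :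
    |t ^ (-b) - (t + 1) ^ (-b)| ≤ t ^ (-b) / (t + 1) := by
  have ht1 : 0 < t + 1 := by linarith
  have hpos := Real.rpow_pos_of_pos ht (-b)
  have h1 : (t + 1) ^ (-b) ≤ t ^ (-b) :=
    Real.rpow_le_rpow_of_nonpos ht (by linarith) (by linarith)
  rw [abs_of_nonneg (sub_nonneg.2 h1)]
  have h2 : (t + 1) ^ (-b) = t ^ (-b) * (t / (t + 1)) ^ b := by
    rw [Real.div_rpow ht.le ht1.le, Real.rpow_neg ht.le, Real.rpow_neg ht1.le]
    have := (Real.rpow_pos_of_pos ht b).ne'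
    field_simp
  have h3 : t / (t + 1) ≤ (t / (t + 1)) ^ b :=
    Real.self_le_rpow_of_le_one (by positivity) ((div_le_one ht1).2 (by linarith)) hb1
  have h4 : t ^ (-b) / (t + 1) = t ^ (-b) - t ^ (-b) * (t / (t + 1)) := by
    field_simp
    ring
  rw [h4, h2]
  have := mul_le_mul_of_nonneg_left h3 hpos.le
  linarith

/-- The regularization varies slowly, relative to its size. -/
theorem Valid.exists_abs_ε_sub_le (hp : p.Valid) : ∃ B : ℝ, 0 ≤ B ∧ ∀ k c,
    |p.ε k c - p.ε (k + 1) c| ≤ B / ((k : ℝ) + 1) * p.κ (k + 1) := by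
  have hb0 := hp.b_mem.1
  have hb1 := hp.b_mem.2
  have hoff := hp.one_le_offset
  set B := ∑ c, (1 + (1 + p.offset) / p.ζ c) with hB
  have hterm : ∀ c, 0 ≤ 1 + (1 + p.offset) / p.ζ c := fun c => by
    have := hp.ζ_pos c
    positivity
  refine ⟨B, Finset.sum_nonneg fun c _ => hterm c, fun k c => ?_⟩
  have hζ := hp.ζ_pos c
  have hk : (0 : ℝ) ≤ k := k.cast_nonneg
  have hkζ := hp.add_ζ_pos k c
  have h1 : |p.ε k c - p.ε (k + 1) c| ≤ p.ε k c / ((k : ℝ) + p.ζ c + 1) := by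
    have := rpow_neg_sub_rpow_neg_le hkζ hb0.le hb1.le
    have h2 : p.ε (k + 1) c = ((k : ℝ) + p.ζ c + 1) ^ (-p.b) := by
      unfold ε
      push_cast
      congr 1
      ring
    rw [h2]
    exact this
  have h3 : p.ε k c ≤ B * p.κ (k + 1) := by
    -- The ratio `r` is at least one, so `r ^ b ≤ r`, and `r` is bounded uniformly in `k`.
    set r := ((k : ℝ) + 1 + p.offset) / ((k : ℝ) + p.ζ c) with hr
    have hk1 : 0 < (k : ℝ) + 1 + p.offset := by linarith
    have h4 : p.ε k c = r ^ p.b * p.κ (k + 1) := by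
      unfold ε κ
      push_cast
      rw [hr, Real.div_rpow hk1.le hkζ.le, Real.rpow_neg hkζ.le, Real.rpow_neg hk1.le]
      have := (Real.rpow_pos_of_pos hk1 p.b).ne'
      field_simp
    have h5 : 1 ≤ r := by
      rw [hr, one_le_div hkζ]
      linarith [hp.le_offset c]
    have h6 : r ^ p.b ≤ r := by
      have := Real.rpow_le_rpow_of_exponent_le h5 hb1.le
      rwa [Real.rpow_one] at this
    have h7 : r ≤ 1 + (1 + p.offset) / p.ζ c := by
      have h8 : r ≤ 1 + (1 + p.offset) / ((k : ℝ) + p.ζ c) := by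
        rw [hr, div_le_iff₀ hkζ, add_mul, div_mul_cancel₀ _ hkζ.ne']
        linarith
      have h9 : (1 + p.offset) / ((k : ℝ) + p.ζ c) ≤ (1 + p.offset) / p.ζ c := by
        gcongr
        linarith
      linarith
    have h10 : 1 + (1 + p.offset) / p.ζ c ≤ B :=
      Finset.single_le_sum (f := fun c => 1 + (1 + p.offset) / p.ζ c) (fun c _ => hterm c)
        (Finset.mem_univ c)
    rw [h4]
    exact mul_le_mul_of_nonneg_right (h6.trans (h7.trans h10)) (hp.κ_pos _).le
  calc |p.ε k c - p.ε (k + 1) c| ≤ p.ε k c / ((k : ℝ) + p.ζ c + 1) := h1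
    _ ≤ p.ε k c / ((k : ℝ) + 1) :=
        div_le_div_of_nonneg_left (hp.ε_pos k c).le (by linarith) (by linarith)
    _ ≤ B * p.κ (k + 1) / ((k : ℝ) + 1) := by gcongr
    _ = _ := by ring

end Params

end Rates

/-! ### The one-step estimate. -/

namespace SGNEP

variable {N n m d : ℕ} {S : SGNEP N n m d} {p : Params N n m} {G : SimpleGraph (Fin N)}

/-- One step of the algorithm, measured at a solution of the regularized problem. -/
theorem exists_distSq_step_le (hcq : S.ConstraintQualification) (hg : S.ConvexCoupling)
    (hF : S.MonotoneLipschitz) (hw : IsWeightMatrix G p.w) (hp : p.Valid) :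
    ∃ K : ℝ, 0 ≤ K ∧ ∀ (k : ℕ) (s : Fin N → Vec d), ∀ u ∈ S.dom, ∀ y ∈ S.dom,
      (∀ v ∈ S.dom, 0 ≤ S.lagBif p.w y v + ∑ c, p.ε k c * coordEquiv N n m y c *
        (coordEquiv N n m v c - coordEquiv N n m y c)) →
      p.distSq (S.step p k s u) y ≤ p.distSq u y
        - 2 * p.α k * ∑ c, p.ε k c * (coordEquiv N n m u c - coordEquiv N n m y c) ^ 2
        + 2 * p.α k * ∑ i, inner ℝ (S.F u.1 i - S.partialGrad i u.1 (s i)) (u.1 i - y.1 i)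
        + p.α k ^ 2 * (K * ((1 + ‖u‖) ^ 2 +
          ∑ i, (p.γ i)⁻¹ * ‖S.F u.1 i - S.partialGrad i u.1 (s i)‖ ^ 2)) := by
  obtain ⟨E, hE, hε⟩ := hp.exists_abs_ε_le
  obtain ⟨K, hK, hdir⟩ := exists_norm_dir_le hcq hg hF hE hε
  have h0 : ∀ i, 0 < p.γ i ∧ 0 < p.ν i ∧ 0 < p.τ i := fun i =>
    ⟨hp.γ_pos i, hp.ν_pos i, hp.τ_pos i⟩
  set Γ := ∑ i, (p.γ i + p.ν i + p.τ i) with hΓ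
  have hΓle : ∀ i, p.γ i + p.ν i + p.τ i ≤ Γ := fun i =>
    Finset.single_le_sum (f := fun i => p.γ i + p.ν i + p.τ i)
      (fun i _ => by have := h0 i; linarith) (Finset.mem_univ i)
  have hΓ0 : 0 ≤ Γ := Finset.sum_nonneg fun i _ => by have := h0 i; linarith
  refine ⟨N * (2 * Γ * K ^ 2) + 2 * Γ ^ 2, by positivity, fun k s u hu y hy hys => ?_⟩
  set δ : Profile N n := fun i => S.F u.1 i - S.partialGrad i u.1 (s i) with hδ
  set α := p.α k with hα
  set U := (1 + ‖u‖) ^ 2 with hU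
  have hU0 : 0 ≤ U := sq_nonneg _
  have hterm : ∀ i, (p.γ i)⁻¹ * ‖(S.step p k s u).1 i - y.1 i‖ ^ 2 +
      (p.ν i)⁻¹ * ‖(S.step p k s u).2.1 i - y.2.1 i‖ ^ 2 +
      (p.τ i)⁻¹ * ‖(S.step p k s u).2.2 i - y.2.2 i‖ ^ 2 ≤
      ((p.γ i)⁻¹ * ‖u.1 i - y.1 i‖ ^ 2 + (p.ν i)⁻¹ * ‖u.2.1 i - y.2.1 i‖ ^ 2 +
        (p.τ i)⁻¹ * ‖u.2.2 i - y.2.2 i‖ ^ 2)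
      - 2 * α * (inner ℝ (S.dirX p k u i) (u.1 i - y.1 i) +
        inner ℝ (p.dirZ k u i) (u.2.1 i - y.2.1 i) +
        inner ℝ (S.dirL p k u i) (u.2.2 i - y.2.2 i))
      + 2 * α * inner ℝ (δ i) (u.1 i - y.1 i)
      + α ^ 2 * (2 * Γ * K ^ 2 * U + 2 * Γ ^ 2 * ((p.γ i)⁻¹ * ‖δ i‖ ^ 2)) := by
    intro i
    obtain ⟨hγ, hν, hτ⟩ := h0 i
    have hle := hΓle i
    have e1 := norm_sq_proj_sub_le (hcq.closed i) (hcq.convex i) (u.1 i) (S.dirX p k u i - δ i)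
      (hy.1 i) (a := α) hγ
    -- The update of the auxiliary variable is a projected step onto the whole space.
    have e2 := norm_sq_proj_sub_le isClosed_univ convex_univ (u.2.1 i) (p.dirZ k u i)
      (Set.mem_univ (y.2.1 i)) (a := α) hν
    have e3 := norm_sq_proj_sub_le isClosed_orthant convex_orthant (u.2.2 i) (S.dirL p k u i)
      (hy.2 i) (a := α) hτ
    rw [proj_of_mem isClosed_univ (Set.mem_univ _), ← step_snd_fst k s u i] at e2
    rw [← step_fst] at e1
    rw [← step_snd_snd k s u i] at e3
    obtain ⟨d1, d2, d3⟩ := hdir k u hu i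
    have hsq : ∀ {r : ℝ}, 0 ≤ r → r ≤ K * (1 + ‖u‖) → r ^ 2 ≤ K ^ 2 * U := by
      intro r hr0 hr
      rw [hU, ← mul_pow]
      exact pow_le_pow_left₀ hr0 hr 2
    have q1 := hsq (norm_nonneg _) d1
    have q2 := hsq (norm_nonneg _) d2
    have q3 := hsq (norm_nonneg _) d3
    have hKU : 0 ≤ K ^ 2 * U := by positivity
    have n1 : ‖S.dirX p k u i - δ i‖ ^ 2 ≤ 2 * (K ^ 2 * U) + 2 * ‖δ i‖ ^ 2 := by
      have h1 := norm_sub_le (S.dirX p k u i) (δ i)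
      have h2 : ‖S.dirX p k u i - δ i‖ ^ 2 ≤ (‖S.dirX p k u i‖ + ‖δ i‖) ^ 2 := by gcongr
      nlinarith [sq_nonneg (‖S.dirX p k u i‖ - ‖δ i‖)]
    have b1 : p.γ i * ‖S.dirX p k u i - δ i‖ ^ 2 ≤
        2 * p.γ i * (K ^ 2 * U) + 2 * Γ ^ 2 * ((p.γ i)⁻¹ * ‖δ i‖ ^ 2) := by
      have h1 := mul_le_mul_of_nonneg_left n1 hγ.le
      have h2 : p.γ i ^ 2 ≤ Γ ^ 2 := pow_le_pow_left₀ hγ.le (by linarith) 2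
      have h3 : p.γ i * ‖δ i‖ ^ 2 = p.γ i ^ 2 * ((p.γ i)⁻¹ * ‖δ i‖ ^ 2) := by
        field_simp
      have h4 : p.γ i ^ 2 * ((p.γ i)⁻¹ * ‖δ i‖ ^ 2) ≤ Γ ^ 2 * ((p.γ i)⁻¹ * ‖δ i‖ ^ 2) := by
        gcongr
      linarith
    have b2 := mul_le_mul_of_nonneg_left q2 hν.le
    have b3 := mul_le_mul_of_nonneg_left q3 hτ.le
    have b4 : (p.γ i + p.ν i + p.τ i) * (K ^ 2 * U) ≤ Γ * (K ^ 2 * U) := by gcongr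
    have b5 : p.γ i * ‖S.dirX p k u i - δ i‖ ^ 2 + p.ν i * ‖p.dirZ k u i‖ ^ 2 +
        p.τ i * ‖S.dirL p k u i‖ ^ 2 ≤
        2 * Γ * K ^ 2 * U + 2 * Γ ^ 2 * ((p.γ i)⁻¹ * ‖δ i‖ ^ 2) := by
      have : 0 ≤ p.ν i * (K ^ 2 * U) := by positivity
      have : 0 ≤ p.τ i * (K ^ 2 * U) := by positivity
      linarith
    have b6 := mul_le_mul_of_nonneg_left b5 (sq_nonneg α)
    rw [inner_sub_left] at e1
    linarith
  have hsum : p.distSq (S.step p k s u) y ≤ _ :=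
    Finset.sum_le_sum fun i (_ : i ∈ Finset.univ) => hterm i
  rw [Finset.sum_add_distrib, Finset.sum_add_distrib, Finset.sum_sub_distrib, ← Finset.mul_sum,
    ← Finset.mul_sum, ← Finset.mul_sum, Finset.sum_add_distrib (f := fun _ => 2 * Γ * K ^ 2 * U),
    ← Finset.mul_sum] at hsum
  simp only [Finset.sum_const, Finset.card_univ, Fintype.card_fin, nsmul_eq_mul] at hsum
  change p.distSq (S.step p k s u) y ≤ p.distSq u y - _ + _ + _ at hsum
  set X := ∑ i, (inner ℝ (S.dirX p k u i) (u.1 i - y.1 i) +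
        inner ℝ (p.dirZ k u i) (u.2.1 i - y.2.1 i) +
        inner ℝ (S.dirL p k u i) (u.2.2 i - y.2.2 i)) with hX
  -- Three facts combine: the directions dominate `-B u y` plus the regularization at `u`,
  -- monotonicity gives `-B u y ≥ B y u`, and the regularized problem at `y` is tested with `u`. The
  -- two regularizations combine into the weighted square of the difference, which is the strong
  -- monotonicity behind the contraction.
  have h1 := le_sum_inner_dir (p := p) hg k hu (y := y)
  rw [← hX] at h1
  have h2 := hys u hu
  have h3 := (isMonotoneBifunction_lagBif hcq hg hF hw).monotone u hu y hy
  have h4 : ∑ c, p.ε k c * (coordEquiv N n m u c - coordEquiv N n m y c) ^ 2 =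
      ∑ c, p.ε k c * coordEquiv N n m u c * (coordEquiv N n m u c - coordEquiv N n m y c) -
      ∑ c, p.ε k c * coordEquiv N n m y c * (coordEquiv N n m u c - coordEquiv N n m y c) := by
    rw [← Finset.sum_sub_distrib]
    exact Finset.sum_congr rfl fun c _ => by ring
  have h5 : ∑ c, p.ε k c * (coordEquiv N n m u c - coordEquiv N n m y c) ^ 2 ≤ X := by
    rw [h4]; linarith
  have h6 := mul_le_mul_of_nonneg_left h5 (mul_nonneg two_pos.le (hp.α_pos k).le)
  refine hsum.trans ?_
  change _ ≤ p.distSq u y - 2 * α * _ + 2 * α * ∑ i, inner ℝ (δ i) (u.1 i - y.1 i) +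
    α ^ 2 * (_ * (U + ∑ i, (p.γ i)⁻¹ * ‖δ i‖ ^ 2))
  rw [← Finset.mul_sum]
  have h7 : (N : ℝ) * (2 * Γ * K ^ 2 * U) + 2 * Γ ^ 2 * ∑ i, (p.γ i)⁻¹ * ‖δ i‖ ^ 2 ≤
      (N * (2 * Γ * K ^ 2) + 2 * Γ ^ 2) * (U + ∑ i, (p.γ i)⁻¹ * ‖δ i‖ ^ 2) := by
    have hS : 0 ≤ ∑ i, (p.γ i)⁻¹ * ‖δ i‖ ^ 2 := Finset.sum_nonneg fun i _ => by
      have := (h0 i).1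
      positivity
    have t1 : 0 ≤ (N : ℝ) * (2 * Γ * K ^ 2) * ∑ i, (p.γ i)⁻¹ * ‖δ i‖ ^ 2 := by positivity
    have t2 : 0 ≤ 2 * Γ ^ 2 * U := by positivity
    linarith
  have h8 := mul_le_mul_of_nonneg_left h7 (sq_nonneg α)
  linarith

end SGNEP

/-! ### Information, independence and measurability of the iterates. -/

/-- Adjoining to an independent family a further σ-algebra that is independent of it. -/
theorem iIndep_option {Θ ι : Type*} {mΘ : MeasurableSpace Θ} {μ : Measure Θ}
    {m : ι → MeasurableSpace Θ} {m₀ : MeasurableSpace Θ}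
    (hm : iIndep m μ) (h0 : Indep m₀ (⨆ q, m q) μ) :
    iIndep (fun o : Option ι => o.elim m₀ m) μ := by
  classical
  rw [iIndep_iff] at hm ⊢
  rw [Indep_iff] at h0
  intro s f hf
  set t := Finset.eraseNone s with ht
  have hsome : ∀ q ∈ t, MeasurableSet[m q] (f (some q)) := fun q hq =>
    hf (some q) (Finset.mem_eraseNone.1 hq)
  have h1 := hm t (f := fun q => f (some q)) hsome
  by_cases hn : none ∈ s
  · have hs : s = Finset.insertNone t := by
      ext o; cases o <;> simp [ht, hn]
    have h2 : ⋂ o ∈ s, f o = f none ∩ ⋂ q ∈ t, f (some q) := by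
      ext θ
      simp [hs, Option.forall]
    have h3 : MeasurableSet[⨆ q, m q] (⋂ q ∈ t, f (some q)) :=
      Finset.measurableSet_biInter t fun q hq => le_iSup m q _ (hsome q hq)
    rw [h2, h0 _ _ (hf none hn) h3, h1, hs, Finset.prod_insertNone]
  · have hs : s = t.map Function.Embedding.some := by
      ext o; cases o <;> simp [ht, hn]
    have h2 : ⋂ o ∈ s, f o = ⋂ q ∈ t, f (some q) := by
      ext θ
      simp [hs]
    rw [h2, h1, hs, Finset.prod_map]
    rfl

theorem info_mono {N n m d : ℕ} {Θ : Type*} 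
    (X₀ : Θ → State N n m) (ξ : ℕ → Fin N → Θ → Vec d) : Monotone (info X₀ ξ) := by
  intro k l hkl
  refine sup_le_sup_left (iSup_mono fun j => ?_) _
  exact iSup_le fun hj => le_iSup_of_le (hj.trans_le hkl) le_rfl

theorem measurable_sample_info {N n m d : ℕ} {Θ : Type*} 
    (X₀ : Θ → State N n m) (ξ : ℕ → Fin N → Θ → Vec d) (k : ℕ) :
    Measurable[info X₀ ξ (k + 1)] fun θ i => ξ k i θ := by
  refine @measurable_pi_lambda _ _ _ (info X₀ ξ (k + 1)) _ _ fun i => ?_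
  refine Measurable.of_comap_le (le_sup_of_le_right ?_)
  exact le_iSup_of_le k (le_iSup_of_le k.lt_succ_self (le_iSup_of_le i le_rfl))

section Sampling

variable {N n m d : ℕ} {S : SGNEP N n m d} {p : Params N n m} {Θ : Type*} [MeasurableSpace Θ]
  {μ : Measure Θ} {X₀ : Θ → State N n m} {ξ : ℕ → Fin N → Θ → Vec d}

theorem IsSampling.info_le (hξ : IsSampling S μ X₀ ξ) (k : ℕ) :
    info X₀ ξ k ≤ (inferInstance : MeasurableSpace Θ) :=
  sup_le hξ.measurable_init.comap_le <| iSup_le fun j => iSup_le fun _ => iSup_le fun i =>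
    (hξ.measurable_sample j i).comap_le

/-- The filtration of the available information. -/
def IsSampling.filtration (hξ : IsSampling S μ X₀ ξ) :
    Filtration ℕ (inferInstance : MeasurableSpace Θ) where
  seq := info X₀ ξ
  mono' := info_mono X₀ ξ
  le' := hξ.info_le

/-- The past and the current samples come from disjoint blocks of one independent family, with the
initial state as the additional member `none`. Taking the identity, valued in `Θ` with the σ-algebra
`info X₀ ξ k`, lets every quantity known at time `k` be a function of one variable. -/
theorem IsSampling.indepFun_info (hξ : IsSampling S μ X₀ ξ) (k : ℕ) :
    @IndepFun _ _ _ _ (info X₀ ξ k) _ id (fun θ i => ξ k i θ) μ := by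
  set c : ℕ × Fin N → MeasurableSpace Θ :=
    fun q => MeasurableSpace.comap (ξ q.1 q.2) inferInstance with hc
  have hle : ∀ q, c q ≤ (inferInstance : MeasurableSpace Θ) := fun q =>
    (hξ.measurable_sample q.1 q.2).comap_le
  have h0 : Indep (MeasurableSpace.comap X₀ inferInstance) (⨆ q, c q) μ := by
    have h := hξ.indep_init
    rw [IndepFun_iff_Indep] at h
    convert h using 1
    simp only [MeasurableSpace.pi, MeasurableSpace.comap_iSup, MeasurableSpace.comap_comp, hc]
    rfl
  have h1 := iIndep_option (m := c) hξ.indep.iIndep h0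
  set P : Set (Option (ℕ × Fin N)) := {o | ∀ q ∈ o, q.1 < k} with hP
  set T : Set (Option (ℕ × Fin N)) := {o | ∃ i, o = some (k, i)} with hT
  have hdisj : Disjoint P T := by
    rw [Set.disjoint_left]
    rintro _ h ⟨i, rfl⟩
    exact lt_irrefl k (h (k, i) rfl)
  have h2 := indep_iSup_of_disjoint (fun o => by
    cases o with
    | none => exact hξ.measurable_init.comap_le
    | some q => exact hle q) h1 hdisj
  rw [@IndepFun_iff_Indep]
  refine indep_of_indep_of_le_left (indep_of_indep_of_le_right h2 ?_) ?_
  · simp only [MeasurableSpace.pi, MeasurableSpace.comap_iSup, MeasurableSpace.comap_comp]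
    refine iSup_le fun i => ?_
    exact le_iSup₂_of_le (some (k, i)) ⟨i, rfl⟩ le_rfl
  · rw [MeasurableSpace.comap_id]
    refine sup_le ?_ (iSup_le fun j => iSup_le fun hj => iSup_le fun i => ?_)
    · exact le_iSup₂_of_le (f := fun (o : Option (ℕ × Fin N)) (_ : o ∈ P) =>
        o.elim (MeasurableSpace.comap X₀ inferInstance) c) none (by simp [hP]) le_rfl
    · exact le_iSup₂_of_le (f := fun (o : Option (ℕ × Fin N)) (_ : o ∈ P) =>
        o.elim (MeasurableSpace.comap X₀ inferInstance) c) (some (j, i)) (by simpa [hP] using hj)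
        le_rfl

namespace SGNEP

theorem continuous_tik {q : ℕ} (e : Fin q → ℝ) : Continuous (tik e) := by
  refine (PiLp.continuous_toLp 2 _).comp (continuous_pi fun l => ?_)
  fun_prop

theorem measurable_adjoint_fderiv (S : SGNEP N n m d) (i : Fin N) :
    Measurable fun q : Vec n × Vec m =>
      ContinuousLinearMap.adjoint (fderiv ℝ (S.g i) q.1) q.2 := by
  have h : ∀ l, Measurable fun q : Vec n × Vec m =>
      (ContinuousLinearMap.adjoint (fderiv ℝ (S.g i) q.1) q.2) l := by
    intro l
    have h1 : ∀ q : Vec n × Vec m, (ContinuousLinearMap.adjoint (fderiv ℝ (S.g i) q.1) q.2) l =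
        inner ℝ (fderiv ℝ (S.g i) q.1 (EuclideanSpace.single l 1)) q.2 := by
      intro q
      rw [← ContinuousLinearMap.adjoint_inner_right, EuclideanSpace.inner_single_left]
      simp
    simp only [h1]
    exact ((measurable_fderiv_apply_const ℝ (S.g i) _).comp measurable_fst).inner measurable_snd
  exact (WithLp.measurable_toLp 2 (Fin n → ℝ)).comp (measurable_pi_lambda _ h)

/-- On admissible states a step is a jointly measurable function of the state and the samples. -/
theorem exists_measurable_step (hJ : S.RegularSampleCost) (hcq : S.ConstraintQualification)
    (hg : S.ConvexCoupling) (k : ℕ) :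
    ∃ f : State N n m × (Fin N → Vec d) → State N n m, Measurable f ∧
      ∀ s, ∀ u ∈ S.dom, f (u, s) = S.step p k s u := by
  set D : Fin N → Profile N n × Vec d → Vec n := fun i =>
    Set.indicator {q : Profile N n × Vec d | q.1 ∈ S.localSet} fun q => S.partialGrad i q.1 q.2
    with hD
  refine ⟨fun q => (fun i => proj (S.Ω i) (q.1.1 i - (p.α k * p.γ i) •
      (D i (q.1.1, q.2 i) + ContinuousLinearMap.adjoint (fderiv ℝ (S.g i) (q.1.1 i)) (q.1.2.2 i)
        + tik (fun l => p.ε k (.inl (i, l))) (q.1.1 i))),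
    -- The auxiliary and dual updates do not use the samples, so an arbitrary sample `0` may be
    -- inserted.
    (S.step p k 0 q.1).2), ?_, fun s u hu => ?_⟩
  · have hx : ∀ i, Measurable fun q : State N n m × (Fin N → Vec d) => q.1.1 i := fun i =>
      (measurable_pi_apply i).comp (measurable_fst.comp measurable_fst)
    have hz : ∀ i, Measurable fun q : State N n m × (Fin N → Vec d) => q.1.2.1 i := fun i =>
      (measurable_pi_apply i).comp (measurable_fst.comp (measurable_snd.comp measurable_fst))
    have hl : ∀ i, Measurable fun q : State N n m × (Fin N → Vec d) => q.1.2.2 i := fun i =>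
      (measurable_pi_apply i).comp (measurable_snd.comp (measurable_snd.comp measurable_fst))
    have hs : ∀ i, Measurable fun q : State N n m × (Fin N → Vec d) => q.2 i := fun i =>
      (measurable_pi_apply i).comp measurable_snd
    refine Measurable.prodMk (measurable_pi_lambda _ fun i => ?_)
      (Measurable.prodMk (measurable_pi_lambda _ fun i => ?_) (measurable_pi_lambda _ fun i => ?_))
    · refine (continuous_proj (hcq.nonempty i) (hcq.closed i) (hcq.convex i)).measurable.comp ?_
      have h1 := (hJ.measurable_indicator_partialGrad hcq i).comp
        ((measurable_fst.comp measurable_fst).prodMk (hs i))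
      have h2 := (measurable_adjoint_fderiv S i).comp ((hx i).prodMk (hl i))
      have h3 := (continuous_tik fun l => p.ε k (.inl (i, l))).measurable.comp (hx i)
      exact (hx i).sub (((h1.add h2).add h3).const_smul (p.α k * p.γ i))
    · have h3 := (continuous_tik fun l => p.ε k (.inr (.inl (i, l)))).measurable.comp (hz i)
      refine (hz i).sub (Measurable.const_smul (Measurable.add ?_ h3) (p.α k * p.ν i))
      exact Finset.measurable_fun_sum _ fun j _ => ((hl i).sub (hl j)).const_smul (p.w i j)
    · refine (continuous_proj ⟨0, zero_mem_orthant⟩ isClosed_orthant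
        convex_orthant).measurable.comp ?_
      have h3 := (continuous_tik fun l => p.ε k (.inr (.inr (i, l)))).measurable.comp (hl i)
      have h4 := (hg.continuous i).measurable.comp (hx i)
      refine (hl i).add (Measurable.const_smul (Measurable.add (h4.sub h3) ?_) (p.α k * p.τ i))
      exact Finset.measurable_fun_sum _ fun j _ =>
        (((hz i).sub (hz j)).sub ((hl i).sub (hl j))).const_smul (p.w i j)
  · have hmem : ∀ i, ((u.1, s i) : Profile N n × Vec d) ∈
        {q : Profile N n × Vec d | q.1 ∈ S.localSet} := fun i => hu.1
    simp only [hD, Set.indicator_of_mem (hmem _)]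
    rfl

theorem iterates_mem_dom (hcq : S.ConstraintQualification) (hξ : IsSampling S μ X₀ ξ) (k : ℕ)
    (θ : Θ) : S.iterates p X₀ ξ k θ ∈ S.dom := by
  cases k with
  | zero => exact ⟨hξ.init_primal θ, hξ.init_dual θ⟩
  | succ k => exact step_mem_dom hcq k _ _

theorem measurable_iterates (hJ : S.RegularSampleCost) (hcq : S.ConstraintQualification)
    (hg : S.ConvexCoupling) (hξ : IsSampling S μ X₀ ξ) (k : ℕ) :
    Measurable[info X₀ ξ k] (S.iterates p X₀ ξ k) := by
  induction k with
  | zero => exact Measurable.of_comap_le le_sup_left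
  | succ k ih =>
    obtain ⟨f, hf, hfs⟩ := exists_measurable_step (p := p) hJ hcq hg k
    have h1 : S.iterates p X₀ ξ (k + 1) =
        fun θ => f (S.iterates p X₀ ξ k θ, fun i => ξ k i θ) := by
      funext θ
      rw [hfs _ _ (iterates_mem_dom hcq hξ k θ)]
      rfl
    rw [h1]
    exact hf.comp (Measurable.prodMk (ih.mono (info_mono X₀ ξ k.le_succ) le_rfl)
      (measurable_sample_info X₀ ξ k))

/-- Joint measurability of the stochastic error. -/
theorem measurable_F_sub_partialGrad (hJ : S.RegularSampleCost)
    (hcq : S.ConstraintQualification) (hF : S.MonotoneLipschitz) {𝒴 : Type*} [MeasurableSpace 𝒴]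
    {x : 𝒴 → Profile N n} (hx : Measurable x) (hxm : ∀ y, x y ∈ S.localSet) (i : Fin N) :
    Measurable fun q : 𝒴 × (Fin N → Vec d) =>
      S.F (x q.1) i - S.partialGrad i (x q.1) (q.2 i) := by
  have h1 : Measurable fun y => S.F (x y) := by
    -- Continuity of `F` is available on the local set only, so measurability is obtained by
    -- factoring through that subtype.
    have h := (continuousOn_iff_continuous_domRestrict.1 hF.continuousOn).measurable.comp
      (hx.subtype_mk (h := hxm))
    exact h
  have hpair : Measurable fun q : 𝒴 × (Fin N → Vec d) => (x q.1, q.2 i) :=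
    (hx.comp measurable_fst).prodMk ((measurable_pi_apply i).comp measurable_snd)
  have h2 := (hJ.measurable_indicator_partialGrad hcq i).comp hpair
  have h3 : (Set.indicator {q : Profile N n × Vec d | q.1 ∈ S.localSet}
      fun q => S.partialGrad i q.1 q.2) ∘ (fun q : 𝒴 × (Fin N → Vec d) => (x q.1, q.2 i)) =
      fun q => S.partialGrad i (x q.1) (q.2 i) := by
    funext q
    have hmem : ((x q.1, q.2 i) : Profile N n × Vec d) ∈
        {q : Profile N n × Vec d | q.1 ∈ S.localSet} := hxm q.1
    simp only [Function.comp_apply, Set.indicator_of_mem hmem]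
  rw [h3] at h2
  exact ((measurable_pi_apply i).comp (h1.comp measurable_fst)).sub h2

/-- The stochastic error is centred given an independent state. -/
theorem integral_sum_inner_error_eq_zero [IsProbabilityMeasure μ] (hJ : S.RegularSampleCost)
    (hcq : S.ConstraintQualification) (hF : S.MonotoneLipschitz) {𝒴 : Type*}
    [m𝒴 : MeasurableSpace 𝒴] {Y : Θ → 𝒴} {Z : Θ → Fin N → Vec d} (hY : Measurable Y)
    (hZ : Measurable Z) (hind : IndepFun Y Z μ) (hlaw : ∀ i, μ.map (fun θ => Z θ i) = S.P)
    {x : 𝒴 → Profile N n} (hx : Measurable x) (hxm : ∀ y, x y ∈ S.localSet)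
    {W : 𝒴 → Profile N n} (hW : Measurable W)
    (hint : Integrable (fun θ => ∑ i, inner ℝ (S.F (x (Y θ)) i -
      S.partialGrad i (x (Y θ)) (Z θ i)) (W (Y θ) i)) μ) :
    ∫ θ, ∑ i, inner ℝ (S.F (x (Y θ)) i - S.partialGrad i (x (Y θ)) (Z θ i)) (W (Y θ) i) ∂μ = 0 := by
  have hmap : ∀ i, (μ.map Z).map (fun s : Fin N → Vec d => s i) = S.P := fun i => by
    rw [Measure.map_map (measurable_pi_apply i) hZ, ← hlaw i]
    rfl
  refine integral_eq_zero_of_indepFun hY hZ hind (f := fun q => ∑ i, inner ℝ (S.F (x q.1) i -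
    S.partialGrad i (x q.1) (q.2 i)) (W q.1 i)) ?_ hint fun y => ?_
  · refine Finset.measurable_fun_sum _ fun i _ => ?_
    exact (measurable_F_sub_partialGrad hJ hcq hF hx hxm i).inner
      ((measurable_pi_apply i).comp (hW.comp measurable_fst))
  · have hprob : IsProbabilityMeasure (μ.map Z) :=
      Measure.isProbabilityMeasure_map hZ.aemeasurable
    -- For a frozen state each summand depends on the sample of one agent, whose marginal law is
    -- `P`, so the mean of its gradient is `F` by definition.
    have hgi : ∀ i, Integrable (fun s : Fin N → Vec d => S.partialGrad i (x y) (s i)) (μ.map Z) := by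
      intro i
      have h := (hJ.integrable_partialGrad_and_hasGradientAt hcq i (hxm y)).1
      rw [← hmap i] at h
      exact h.comp_measurable (measurable_pi_apply i)
    have hgv : ∀ i, ∫ s : Fin N → Vec d, S.partialGrad i (x y) (s i) ∂(μ.map Z) =
        S.F (x y) i := by
      intro i
      rw [F, ← hmap i, integral_map (measurable_pi_apply i).aemeasurable]
      exact (hJ.measurable_partialGrad hcq i (hxm y)).aestronglyMeasurable
    have hi : ∀ i, Integrable
        (fun s : Fin N → Vec d => S.F (x y) i - S.partialGrad i (x y) (s i)) (μ.map Z) :=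
      fun i => (integrable_const _).sub (hgi i)
    have h1 : ∀ i, ∀ s : Fin N → Vec d,
        inner ℝ (S.F (x y) i - S.partialGrad i (x y) (s i)) (W y i) =
          inner ℝ (W y i) (S.F (x y) i - S.partialGrad i (x y) (s i)) := fun i s =>
      real_inner_comm _ _
    simp only [h1]
    rw [integral_finsetSum _ fun i _ => (hi i).const_inner (W y i)]
    refine Finset.sum_eq_zero fun i _ => ?_
    rw [integral_inner (hi i) (W y i), integral_sub (integrable_const _) (hgi i), hgv i]
    simp

end SGNEP

end Sampling

/-! ### Tracking the Tikhonov trajectory. -/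

namespace SGNEP

variable {N n m d : ℕ} {S : SGNEP N n m d} {p : Params N n m} {G : SimpleGraph (Fin N)}

/-- The Tikhonov trajectory: solutions of the regularized problems, converging to a solution of
the unregularized one. -/
theorem exists_tikhonov_trajectory (hcq : S.ConstraintQualification) (hg : S.ConvexCoupling)
    (hF : S.MonotoneLipschitz) (hw : IsWeightMatrix G p.w) (hG : G.Connected) (hp : p.Valid)
    (hsol : ∃ x, S.IsSVISolution x) :
    ∃ y : ℕ → State N n m, (∀ k, y k ∈ S.dom) ∧
      (∀ k, ∀ v ∈ S.dom, 0 ≤ S.lagBif p.w (y k) v + ∑ c, p.ε k c * coordEquiv N n m (y k) c *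
        (coordEquiv N n m v c - coordEquiv N n m (y k) c)) ∧
      ∃ l ∈ S.dom, (∀ v ∈ S.dom, 0 ≤ S.lagBif p.w l v) ∧ Tendsto y atTop (𝓝 l) := by
  obtain ⟨x, hx⟩ := hsol
  obtain ⟨u, hu, hus⟩ := hx.exists_lagBif_nonneg hcq hg hw hG
  have hB := isMonotoneBifunction_lagBif hcq hg hF hw
  choose y hy hys using fun k => hB.exists_regularized (coordCLE N n m) (hp.ε_pos k)
  exact ⟨y, hy, hys, hB.exists_tendsto_regularized (coordCLE N n m) hp.κ_pos hp.tendsto_κ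
    hp.tendsto_ε_div_κ hy hys hu hus⟩

/-- The Tikhonov trajectory drifts at rate `1 / k`. -/
theorem exists_distSq_drift_le (hcq : S.ConstraintQualification) (hg : S.ConvexCoupling)
    (hF : S.MonotoneLipschitz) (hw : IsWeightMatrix G p.w) (hp : p.Valid)
    {y : ℕ → State N n m} (hy : ∀ k, y k ∈ S.dom)
    (hys : ∀ k, ∀ v ∈ S.dom, 0 ≤ S.lagBif p.w (y k) v + ∑ c, p.ε k c *
      coordEquiv N n m (y k) c * (coordEquiv N n m v c - coordEquiv N n m (y k) c))
    {l : State N n m} (hl : Tendsto y atTop (𝓝 l)) :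
    ∃ D : ℝ, 0 ≤ D ∧ ∀ k : ℕ, p.distSq (y k) (y (k + 1)) ≤ D / ((k : ℝ) + 1) ^ 2 := by
  have hB := isMonotoneBifunction_lagBif hcq hg hF hw
  obtain ⟨B, hB0, hBε⟩ := hp.exists_abs_ε_sub_le
  obtain ⟨C, hC, hCd⟩ := hp.exists_distSq_le
  have hcont : Continuous fun u : State N n m => ∑ c, coordEquiv N n m u c ^ 2 :=
    continuous_finsetSum _ fun c _ =>
      (((continuous_apply c).comp (coordCLE N n m).continuous).pow 2)
  obtain ⟨R, hR⟩ := ((hcont.tendsto l).comp hl).bddAbove_range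
  have hR' : ∀ k, ∑ c, coordEquiv N n m (y k) c ^ 2 ≤ R := fun k => hR ⟨k, rfl⟩
  have hR0 : 0 ≤ R := (Finset.sum_nonneg fun c _ => sq_nonneg _).trans (hR' 0)
  refine ⟨C * (B ^ 2 * R), by positivity, fun k => ?_⟩
  have hκ := hp.κ_pos (k + 1)
  -- Both the lower bound of the new parameters and the bound of their variation contain `κ (k +
  -- 1)`, which cancels and leaves `1 / (k + 1)²`.
  have h := hB.sum_sq_sub_le (coordCLE N n m) (hy k) (hy (k + 1)) (hys k) (hys (k + 1)) hκ
    (hp.κ_le_ε (k + 1)) (hBε k)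
  have h' : p.κ (k + 1) ^ 2 * ∑ c, (coordEquiv N n m (y (k + 1)) c - coordEquiv N n m (y k) c) ^ 2
      ≤ p.κ (k + 1) ^ 2 * (B ^ 2 * R / ((k : ℝ) + 1) ^ 2) := by
    refine h.trans ?_
    calc (B / ((k : ℝ) + 1) * p.κ (k + 1)) ^ 2 * ∑ c, coordEquiv N n m (y k) c ^ 2
        ≤ (B / ((k : ℝ) + 1) * p.κ (k + 1)) ^ 2 * R := by gcongr; exact hR' k
      _ = p.κ (k + 1) ^ 2 * (B ^ 2 * R / ((k : ℝ) + 1) ^ 2) := by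
        rw [mul_pow, div_pow]; ring
  have h2 := le_of_mul_le_mul_left h' (pow_pos hκ 2)
  refine (hCd _ _).trans ?_
  rw [mul_div_assoc]
  gcongr
  refine le_trans (le_of_eq (Finset.sum_congr rfl fun c _ => ?_)) h2
  ring

/-- The one-step recursion for the distance of the iterates to the Tikhonov trajectory. -/
theorem exists_tracking_recursion (hcq : S.ConstraintQualification) (hg : S.ConvexCoupling)
    (hF : S.MonotoneLipschitz) (hw : IsWeightMatrix G p.w) (hp : p.Valid)
    {y : ℕ → State N n m} (hy : ∀ k, y k ∈ S.dom)
    (hys : ∀ k, ∀ v ∈ S.dom, 0 ≤ S.lagBif p.w (y k) v + ∑ c, p.ε k c *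
      coordEquiv N n m (y k) c * (coordEquiv N n m v c - coordEquiv N n m (y k) c))
    {l : State N n m} (hl : Tendsto y atTop (𝓝 l)) :
    ∃ (ρ c : ℕ → ℝ) (A : ℝ), 0 ≤ A ∧ (∀ k, 0 < ρ k) ∧ (∀ k, ρ k ≤ 1) ∧
      Tendsto (fun k => ∑ j ∈ Finset.range k, ρ j) atTop atTop ∧
      Tendsto (fun k => c k / ρ k) atTop (𝓝 0) ∧
      ∀ k s, ∀ u ∈ S.dom, p.distSq (S.step p k s u) (y (k + 1)) ≤
        (1 - ρ k) * p.distSq u (y k) + c k * (1 + p.distSq u (y k)) +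
        (1 + ρ k) * (2 * p.α k) * ∑ i, inner ℝ (S.F u.1 i - S.partialGrad i u.1 (s i))
          (u.1 i - (y k).1 i) +
        A * p.α k ^ 2 * ∑ i, (p.γ i)⁻¹ * ‖S.F u.1 i - S.partialGrad i u.1 (s i)‖ ^ 2 := by
  obtain ⟨K, hK, hstep⟩ := exists_distSq_step_le hcq hg hF hw hp
  obtain ⟨D, hD, hdrift⟩ := exists_distSq_drift_le hcq hg hF hw hp hy hys hl
  obtain ⟨C, hC, hCd⟩ := hp.exists_distSq_le
  obtain ⟨C', hC', hnorm⟩ := hp.exists_norm_sq_le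
  obtain ⟨R, hR⟩ := ((continuous_norm.tendsto l).comp hl).bddAbove_range
  have hR' : ∀ k, ‖y k‖ ≤ R := fun k => hR ⟨k, rfl⟩
  have hR0 : 0 ≤ R := (norm_nonneg _).trans (hR' 0)
  have hακ : Tendsto (fun k => p.α k * p.κ k) atTop (𝓝 0) := by
    have h := (hp.tendsto_α_div_κ.mul hp.tendsto_κ).mul hp.tendsto_κ
    rw [zero_mul, zero_mul] at h
    refine h.congr fun k => ?_
    have := (hp.κ_pos k).ne'
    field_simp
  obtain ⟨M, hM⟩ := hακ.bddAbove_range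
  have hM' : ∀ k, p.α k * p.κ k ≤ M := fun k => hM ⟨k, rfl⟩
  have hpos : ∀ k, 0 < p.α k * p.κ k := fun k => mul_pos (hp.α_pos k) (hp.κ_pos k)
  have hM0 : 0 < M := (hpos 0).trans_le (hM' 0)
  -- `C` converts the coordinate distance into the weighted one, and `M` bounds `α * κ`; their sum
  -- keeps `ρ = r * α * κ` at most one.
  set r : ℝ := 1 / (C + M) with hr
  have hr0 : 0 < r := by positivity
  set K' : ℝ := 2 * (1 + R) ^ 2 + 2 * C' with hK'
  have hρ0 : ∀ k, 0 < r * (p.α k * p.κ k) := fun k => mul_pos hr0 (hpos k)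
  have hρle : ∀ k, r * (p.α k * p.κ k) ≤ 1 := fun k => by
    rw [hr, one_div_mul_eq_div, div_le_one (by positivity)]
    linarith [hM' k]
  refine ⟨fun k => r * (p.α k * p.κ k), fun k => 2 * (K * K') * p.α k ^ 2 +
    2 * D / (r * (p.α k * p.κ k) * ((k : ℝ) + 1) ^ 2), 2 * K, by positivity, hρ0, hρle,
    ?_, ?_, fun k s u hu => ?_⟩
  · simp only [← Finset.mul_sum]
    exact hp.tendsto_sum_α_mul_κ.const_mul_atTop hr0
  -- After division by `ρ` the second order part is a multiple of `α / κ`, and the drift part a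
  -- multiple of the square of `1 / ((k + 1) * α * κ)`.
  · have h1 := (hp.tendsto_α_div_κ.const_mul (2 * (K * K') / r)).add
      ((hp.tendsto_inv_mul_α_mul_κ.pow 2).const_mul (2 * D / r ^ 2))
    norm_num at h1
    refine (h1.congr fun k => ?_)
    have := hp.κ_pos k
    have := hp.α_pos k
    field_simp
  · set ρ := r * (p.α k * p.κ k) with hρ
    have hρ1 : ρ ≤ 1 := hρle k
    have hρ0' : 0 < ρ := hρ0 k
    set v := p.distSq u (y k) with hv
    set e := ∑ i, (p.γ i)⁻¹ * ‖S.F u.1 i - S.partialGrad i u.1 (s i)‖ ^ 2 with he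
    set I := ∑ i, inner ℝ (S.F u.1 i - S.partialGrad i u.1 (s i)) (u.1 i - (y k).1 i) with hI
    have hv0 : 0 ≤ v := hp.distSq_nonneg _ _
    have he0 : 0 ≤ e := Finset.sum_nonneg fun i _ =>
      mul_nonneg (inv_nonneg.2 (hp.γ_pos i).le) (sq_nonneg _)
    have hα := hp.α_pos k
    have hκ := hp.κ_pos k
    have h1 := hstep k s u hu (y k) (hy k) (hys k)
    have h2 : p.κ k * (r * v) ≤
        ∑ c, p.ε k c * (coordEquiv N n m u c - coordEquiv N n m (y k) c) ^ 2 := by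
      have h3 : r * v ≤ ∑ c, (coordEquiv N n m u c - coordEquiv N n m (y k) c) ^ 2 := by
        rw [hr, one_div_mul_eq_div, div_le_iff₀ (by positivity)]
        have h4 := hCd u (y k)
        have h5 : 0 ≤ ∑ c, (coordEquiv N n m u c - coordEquiv N n m (y k) c) ^ 2 :=
          Finset.sum_nonneg fun c _ => sq_nonneg _
        nlinarith [mul_nonneg h5 hM0.le]
      refine (mul_le_mul_of_nonneg_left h3 hκ.le).trans ?_
      rw [Finset.mul_sum]
      exact Finset.sum_le_sum fun c _ =>
        mul_le_mul_of_nonneg_right (hp.κ_le_ε k c) (sq_nonneg _)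
    have h3 : (1 + ‖u‖) ^ 2 ≤ K' * (1 + v) := by
      have h4 : ‖u‖ ≤ ‖u - y k‖ + R := by
        have := norm_add_le (u - y k) (y k)
        rw [sub_add_cancel] at this
        linarith [hR' k]
      have h5 := hnorm u (y k)
      have h6 : (1 + ‖u‖) ^ 2 ≤ ((1 + R) + ‖u - y k‖) ^ 2 :=
        pow_le_pow_left₀ (by positivity) (by linarith) 2
      have h7 := add_sq_le (a := 1 + R) (b := ‖u - y k‖)
      have h8 : 0 ≤ 2 * (1 + R) ^ 2 * v := by positivity
      rw [hK']
      linarith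
    have h4 : p.distSq (S.step p k s u) (y k) ≤ (1 - 2 * ρ) * v + 2 * p.α k * I +
        p.α k ^ 2 * (K * K') * (1 + v) + p.α k ^ 2 * K * e := by
      have h5 := mul_le_mul_of_nonneg_left h2 hα.le
      have h6 := mul_le_mul_of_nonneg_left h3 (mul_nonneg (sq_nonneg (p.α k)) hK)
      have h7 : p.α k * (p.κ k * (r * v)) = ρ * v := by rw [hρ]; ring
      rw [h7] at h5
      linarith
    -- The estimate at `y k` contracts by `1 - 2ρ`; changing to `y (k + 1)` costs a factor `1 + ρ`,
    -- and `(1 + ρ) * (1 - 2ρ) ≤ 1 - ρ`.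
    have h5 := hp.distSq_le_add_mul (S.step p k s u) (y k) (y (k + 1)) hρ0'
    have h6 : (1 + 1 / ρ) * p.distSq (y k) (y (k + 1)) ≤ 2 * D / (ρ * ((k : ℝ) + 1) ^ 2) := by
      have h7 : 1 + 1 / ρ ≤ 2 / ρ := by
        rw [le_div_iff₀ hρ0', add_mul, one_div_mul_cancel hρ0'.ne']
        linarith
      calc _ ≤ 2 / ρ * (D / ((k : ℝ) + 1) ^ 2) :=
            mul_le_mul h7 (hdrift k) (hp.distSq_nonneg _ _) (by positivity)
        _ = _ := by rw [div_mul_div_comm]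
    have h7 : 0 ≤ 2 * D / (ρ * ((k : ℝ) + 1) ^ 2) * v := by positivity
    have h8 := mul_le_mul_of_nonneg_left h4 (by linarith : (0 : ℝ) ≤ 1 + ρ)
    have h9 : 0 ≤ (1 - ρ) * (p.α k ^ 2 * (K * K') * (1 + v)) := by
      have : 0 ≤ 1 - ρ := by linarith
      positivity
    have h10 : 0 ≤ (1 - ρ) * (p.α k ^ 2 * K * e) := by
      have : 0 ≤ 1 - ρ := by linarith
      positivity
    have h11 : 0 ≤ ρ ^ 2 * v := by positivity
    linarith

end SGNEP

/-! ### The noise of the algorithm. -/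

namespace SGNEP

theorem errorSq_nonneg {N n m d : ℕ} {S : SGNEP N n m d} {p : Params N n m} {Θ : Type*}
    {X₀ : Θ → State N n m} {ξ : ℕ → Fin N → Θ → Vec d} (hp : p.Valid) (k : ℕ) (θ : Θ) : 0 ≤ S.errorSq p X₀ ξ k θ :=
  Finset.sum_nonneg fun i _ => mul_nonneg (inv_nonneg.2 (hp.γ_pos i).le) (sq_nonneg _)

variable {N n m d : ℕ} {S : SGNEP N n m d} {p : Params N n m} {Θ : Type*} [MeasurableSpace Θ]
  {μ : Measure Θ} {X₀ : Θ → State N n m} {ξ : ℕ → Fin N → Θ → Vec d}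

theorem measurable_F_sub_partialGrad_comp {N n m d : ℕ} {S : SGNEP N n m d}
    (hJ : S.RegularSampleCost) (hcq : S.ConstraintQualification) (hF : S.MonotoneLipschitz)
    {𝒴 : Type*} [MeasurableSpace 𝒴] {x : 𝒴 → Profile N n} (hx : Measurable x)
    (hxm : ∀ y, x y ∈ S.localSet) {s : 𝒴 → Fin N → Vec d} (hs : Measurable s) (i : Fin N) :
    Measurable fun y => S.F (x y) i - S.partialGrad i (x y) (s y i) := by
  have h := measurable_F_sub_partialGrad hJ hcq hF hx hxm i
  have hpair : Measurable fun y => (y, s y) := measurable_id.prodMk hs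
  exact Measurable.comp (g := fun q : 𝒴 × (Fin N → Vec d) =>
    S.F (x q.1) i - S.partialGrad i (x q.1) (q.2 i)) (f := fun y => (y, s y)) h hpair

/-- The error of an iteration is known once its samples are. -/
theorem measurable_error (hJ : S.RegularSampleCost) (hcq : S.ConstraintQualification)
    (hg : S.ConvexCoupling) (hF : S.MonotoneLipschitz) (hξ : IsSampling S μ X₀ ξ) (k : ℕ)
    (i : Fin N) : Measurable[info X₀ ξ (k + 1)] fun θ => S.error p X₀ ξ k θ i := by
  have hu : Measurable[info X₀ ξ (k + 1)] (S.iterates p X₀ ξ k) :=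
    (measurable_iterates hJ hcq hg hξ k).mono (info_mono X₀ ξ k.le_succ) le_rfl
  have hx : Measurable[info X₀ ξ (k + 1)] fun θ => (S.iterates p X₀ ξ k θ).1 :=
    measurable_fst.comp hu
  have hxm : ∀ θ, (S.iterates p X₀ ξ k θ).1 ∈ S.localSet := fun θ =>
    (iterates_mem_dom hcq hξ k θ).1
  exact @measurable_F_sub_partialGrad_comp _ _ _ _ S hJ hcq hF Θ (info X₀ ξ (k + 1)) _ hx hxm _
    (measurable_sample_info X₀ ξ k) i

theorem measurable_errorSq (hJ : S.RegularSampleCost) (hcq : S.ConstraintQualification)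
    (hg : S.ConvexCoupling) (hF : S.MonotoneLipschitz) (hξ : IsSampling S μ X₀ ξ) (k : ℕ) :
    Measurable (S.errorSq p X₀ ξ k) :=
  Finset.measurable_fun_sum _ fun i _ => (((measurable_error hJ hcq hg hF hξ k i).mono
    (hξ.info_le (k + 1)) le_rfl).norm.pow_const 2).const_mul _

theorem ae_tsum_condLExp_lt_top (herr : ErrorConditions S p μ X₀ ξ) :
    ∀ᵐ θ ∂μ, ∑' k, condLExp (info X₀ ξ k) μ
      (fun θ' => ENNReal.ofReal (p.α k ^ 2 * S.errorSq p X₀ ξ k θ')) θ < ∞ := by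
  have h : ∀ k, condLExp (info X₀ ξ k) μ
      (fun θ' => ENNReal.ofReal (p.α k ^ 2 * S.errorSq p X₀ ξ k θ')) =ᵐ[μ]
      ENNReal.ofReal (p.α k ^ 2) • condLExp (info X₀ ξ k) μ
        (fun θ' => ENNReal.ofReal (S.errorSq p X₀ ξ k θ')) := fun k => by
    have h1 := condLExp_smul' (mΩ := info X₀ ξ k) (P := μ)
      (fun θ' => ENNReal.ofReal (S.errorSq p X₀ ξ k θ')) (c := ENNReal.ofReal (p.α k ^ 2))
      ENNReal.ofReal_ne_top
    convert h1 using 2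
    funext θ
    exact ENNReal.ofReal_mul (sq_nonneg _)
  filter_upwards [herr.summable, ae_all_iff.2 h] with θ hθ h'
  simpa only [h', Pi.smul_apply, smul_eq_mul] using hθ

theorem ae_summable_sq_mul_errorSq [IsProbabilityMeasure μ] (hJ : S.RegularSampleCost)
    (hcq : S.ConstraintQualification) (hg : S.ConvexCoupling) (hF : S.MonotoneLipschitz)
    (hp : p.Valid) (hξ : IsSampling S μ X₀ ξ) (herr : ErrorConditions S p μ X₀ ξ) :
    ∀ᵐ θ ∂μ, Summable fun k => p.α k ^ 2 * S.errorSq p X₀ ξ k θ := by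
  have h := ae_tsum_lt_top_of_condLExp (μ := μ) (ℱ := hξ.filtration)
    (fun k => ((measurable_errorSq hJ hcq hg hF hξ k).const_mul (p.α k ^ 2)).ennreal_ofReal)
    (ae_tsum_condLExp_lt_top herr)
  filter_upwards [h] with θ hθ
  have h1 := ENNReal.summable_toReal hθ.ne
  refine h1.congr fun k => ?_
  exact ENNReal.toReal_ofReal (mul_nonneg (sq_nonneg _) (errorSq_nonneg hp k θ))

/-- Cauchy–Schwarz with weights `γ⁻¹` and `γ`; bounding `γ` by `Γ² γ⁻¹` returns to the weights of
the metric. -/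
theorem sum_inner_sq_le {x : Profile N n} (hp : p.Valid) (e : Profile N n) {Γ : ℝ}
    (hΓ : ∀ i, p.γ i ≤ Γ) : (∑ i, inner ℝ (e i) (x i)) ^ 2 ≤
      (∑ i, (p.γ i)⁻¹ * ‖e i‖ ^ 2) * (Γ ^ 2 * ∑ i, (p.γ i)⁻¹ * ‖x i‖ ^ 2) := by
  have h := Finset.sum_sq_le_sum_mul_sum_of_sq_le_mul Finset.univ
    (r := fun i => inner ℝ (e i) (x i)) (f := fun i => (p.γ i)⁻¹ * ‖e i‖ ^ 2)
    (g := fun i => p.γ i * ‖x i‖ ^ 2)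
    (fun i _ => mul_nonneg (inv_nonneg.2 (hp.γ_pos i).le) (sq_nonneg _))
    (fun i _ => mul_nonneg (hp.γ_pos i).le (sq_nonneg _)) fun i _ => by
      have h1 : (p.γ i)⁻¹ * ‖e i‖ ^ 2 * (p.γ i * ‖x i‖ ^ 2) = (‖e i‖ * ‖x i‖) ^ 2 := by
        have := (hp.γ_pos i).ne'
        field_simp
      rw [h1]
      exact sq_le_sq' (neg_le_of_abs_le (abs_real_inner_le_norm _ _))
        (real_inner_le_norm _ _)
  refine h.trans (mul_le_mul_of_nonneg_left ?_ (Finset.sum_nonneg fun i _ =>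
    mul_nonneg (inv_nonneg.2 (hp.γ_pos i).le) (sq_nonneg _)))
  rw [Finset.mul_sum]
  refine Finset.sum_le_sum fun i _ => ?_
  rw [← mul_assoc]
  refine mul_le_mul_of_nonneg_right ?_ (sq_nonneg _)
  have h0 := hp.γ_pos i
  rw [← div_eq_mul_inv, le_div_iff₀ h0, ← sq]
  exact pow_le_pow_left₀ h0.le (hΓ i) 2

/-- The normalized martingale transform of the errors converges almost surely. -/
theorem ae_exists_tendsto_sum_noise [IsProbabilityMeasure μ] (hJ : S.RegularSampleCost)
    (hcq : S.ConstraintQualification) (hg : S.ConvexCoupling) (hF : S.MonotoneLipschitz)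
    (hp : p.Valid) (hξ : IsSampling S μ X₀ ξ) (herr : ErrorConditions S p μ X₀ ξ)
    (y : ℕ → State N n m) {ρ : ℕ → ℝ} (hρ0 : ∀ k, 0 < ρ k) (hρ1 : ∀ k, ρ k ≤ 1) {r : ℝ}
    (hr : 0 < r) :
    ∀ᵐ θ ∂μ, ∃ l, Tendsto (fun q => ∑ k ∈ Finset.range q, (1 + ρ k) * (2 * p.α k) *
      (∑ i, inner ℝ (S.error p X₀ ξ k θ i) ((S.iterates p X₀ ξ k θ).1 i - (y k).1 i)) /
      (r + p.distSq (S.iterates p X₀ ξ k θ) (y k))) atTop (𝓝 l) := by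
  set u := S.iterates p X₀ ξ with hu
  -- The whole factor multiplying the error, including the normalization, is known at time `k`, so
  -- the centring of the error survives.
  set W : ℕ → Θ → Profile N n := fun k θ i =>
    ((1 + ρ k) * (2 * p.α k) / (r + p.distSq (u k θ) (y k))) • ((u k θ).1 i - (y k).1 i) with hW
  have hv0 : ∀ k θ, 0 ≤ p.distSq (u k θ) (y k) := fun k θ => hp.distSq_nonneg _ _
  have hWm : ∀ k, Measurable[info X₀ ξ k] (W k) := fun k => by
    have hum := measurable_iterates (p := p) hJ hcq hg hξ k
    have hd : Measurable fun q : State N n m => p.distSq q (y k) :=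
      (p.continuous_distSq.comp (Continuous.prodMk_left (y k))).measurable
    have h1 : Measurable fun q : State N n m => fun i =>
        ((1 + ρ k) * (2 * p.α k) / (r + p.distSq q (y k))) • (q.1 i - (y k).1 i) :=
      measurable_pi_lambda _ fun i => ((hd.const_add r).const_div _).smul
        (((measurable_pi_apply i).comp measurable_fst).sub_const _)
    exact h1.comp hum
  have heq : ∀ k θ, (1 + ρ k) * (2 * p.α k) *
      (∑ i, inner ℝ (S.error p X₀ ξ k θ i) ((u k θ).1 i - (y k).1 i)) /
      (r + p.distSq (u k θ) (y k)) = ∑ i, inner ℝ (S.error p X₀ ξ k θ i) (W k θ i) := by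
    intro k θ
    simp only [hW, real_inner_smul_right, ← Finset.mul_sum]
    ring
  simp only [heq]
  set Γ := ∑ i, p.γ i with hΓ
  have hΓi : ∀ i, p.γ i ≤ Γ := fun i =>
    Finset.single_le_sum (fun j _ => (hp.γ_pos j).le) (Finset.mem_univ i)
  refine ae_exists_tendsto_sum_of_condLExp (μ := μ) (ℱ := hξ.filtration)
    (ae_tsum_condLExp_lt_top herr) (K := ENNReal.ofReal (16 * Γ ^ 2 / r)) ENNReal.ofReal_ne_top
    (fun k => ?_) (fun k θ => ?_) fun k A hA hint => ?_
  · refine Measurable.stronglyMeasurable ?_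
    refine Finset.measurable_fun_sum _ fun i _ => ?_
    exact (measurable_error hJ hcq hg hF hξ k i).inner
      ((measurable_pi_apply i).comp ((hWm k).mono (info_mono X₀ ξ k.le_succ) le_rfl))
  · rw [← ENNReal.ofReal_mul (by positivity), ← heq]
    refine ENNReal.ofReal_le_ofReal ?_
    set v := p.distSq (u k θ) (y k) with hv
    have hvk : 0 ≤ v := hv0 k θ
    have h1 := sum_inner_sq_le (x := (u k θ).1 - (y k).1) hp (S.error p X₀ ξ k θ) hΓi
    have h2 : ∑ i, (p.γ i)⁻¹ * ‖((u k θ).1 - (y k).1) i‖ ^ 2 ≤ v := by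
      refine Finset.sum_le_sum fun i _ => ?_
      have h3 := mul_nonneg (inv_nonneg.2 (hp.ν_pos i).le)
        (sq_nonneg ‖(u k θ).2.1 i - (y k).2.1 i‖)
      have h4 := mul_nonneg (inv_nonneg.2 (hp.τ_pos i).le)
        (sq_nonneg ‖(u k θ).2.2 i - (y k).2.2 i‖)
      simp only [Pi.sub_apply]
      linarith
    have hα := hp.α_pos k
    have he := errorSq_nonneg (S := S) (X₀ := X₀) (ξ := ξ) hp k θ
    have h3 : (1 + ρ k) * (2 * p.α k) ≤ 4 * p.α k := by nlinarith [hρ1 k]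
    have h4 : 0 ≤ (1 + ρ k) * (2 * p.α k) := by have := hρ0 k; positivity
    set I := ∑ i, inner ℝ (S.error p X₀ ξ k θ i) ((u k θ).1 i - (y k).1 i) with hI
    have h5 : I ^ 2 ≤ S.errorSq p X₀ ξ k θ * (Γ ^ 2 * v) :=
      h1.trans (mul_le_mul_of_nonneg_left (mul_le_mul_of_nonneg_left h2 (sq_nonneg _)) he)
    -- This is the purpose of the normalization: the bound of the squared term no longer involves
    -- the state.
    have h6 : v / (r + v) ^ 2 ≤ 1 / r := by
      rw [div_le_div_iff₀ (by positivity) hr]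
      nlinarith [mul_nonneg hr.le hvk, sq_nonneg v, sq_nonneg r]
    calc ((1 + ρ k) * (2 * p.α k) * I / (r + v)) ^ 2
        = ((1 + ρ k) * (2 * p.α k)) ^ 2 * I ^ 2 / (r + v) ^ 2 := by rw [div_pow, mul_pow]
      _ ≤ (4 * p.α k) ^ 2 * (S.errorSq p X₀ ξ k θ * (Γ ^ 2 * v)) / (r + v) ^ 2 := by gcongr
      _ = 16 * Γ ^ 2 * (p.α k ^ 2 * S.errorSq p X₀ ξ k θ) * (v / (r + v) ^ 2) := by ring
      _ ≤ 16 * Γ ^ 2 * (p.α k ^ 2 * S.errorSq p X₀ ξ k θ) * (1 / r) := by gcongr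
      _ = _ := by ring
  · have hA' : MeasurableSet A := hξ.info_le k A hA
    -- An event known at time `k` is moved into the direction `W`, which reduces conditional
    -- centring to a vanishing mean.
    have hind : ∀ θ, A.indicator (fun θ => ∑ i, inner ℝ (S.error p X₀ ξ k θ i) (W k θ i)) θ =
        ∑ i, inner ℝ (S.error p X₀ ξ k θ i) (A.indicator (W k) θ i) := by
      intro θ
      by_cases h : θ ∈ A <;> simp [h]
    rw [← integral_indicator hA', integral_congr_ae (ae_of_all _ hind)]
    have hint' := (integrable_indicator_iff hA').2 hint
    have hx : Measurable[info X₀ ξ k] fun θ => (u k θ).1 :=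
      measurable_fst.comp (measurable_iterates hJ hcq hg hξ k)
    refine @integral_sum_inner_error_eq_zero N n m d S Θ _ μ _ hJ hcq hF Θ (info X₀ ξ k) id
      (fun θ i => ξ k i θ) (measurable_id.mono (hξ.info_le k) le_rfl)
      (measurable_pi_lambda _ fun i => hξ.measurable_sample k i) (hξ.indepFun_info k)
      (hξ.law k) (fun θ => (u k θ).1) hx (fun θ => (iterates_mem_dom hcq hξ k θ).1)
      (A.indicator (W k)) ((hWm k).indicator hA) ?_
    exact hint'.congr (ae_of_all _ hind)

end SGNEP

/-! ### Conclusion. -/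

/-- Almost sure convergence of the distributed single-sample Tikhonov-regularized
forward-backward algorithm to a variational stochastic generalized Nash equilibrium. -/
theorem theorem1 {N n m d : ℕ} (S : SGNEP N n m d) [IsProbabilityMeasure S.P]
    (hcq : S.ConstraintQualification) (hg : S.ConvexCoupling) (hJ : S.RegularSampleCost)
    (hcost : S.ConvexCost) (hsol : ∃ x, S.IsSVISolution x)
    (p : Params N n m) (hp : p.Valid)
    (G : SimpleGraph (Fin N)) (hG : G.Connected) (hw : IsWeightMatrix G p.w)
    (hF : S.MonotoneLipschitz)
    {Θ : Type*} [MeasurableSpace Θ] (μ : Measure Θ) [IsProbabilityMeasure μ]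
    (X₀ : Θ → State N n m) (ξ : ℕ → Fin N → Θ → Vec d)
    (hξ : IsSampling S μ X₀ ξ) (herr : ErrorConditions S p μ X₀ ξ) :
    ∃ x : Profile N n, S.IsVSGNE x ∧
      ∀ᵐ θ ∂μ, Tendsto (fun k => (S.iterates p X₀ ξ k θ).1) atTop (𝓝 x) := by
  obtain ⟨y, hy, hys, l, hl, hls, hyl⟩ :=
    SGNEP.exists_tikhonov_trajectory hcq hg hF hw hG hp hsol
  refine ⟨l.1, (SGNEP.isSVISolution_of_lagBif_nonneg hw hG hl hls).isVSGNE hJ hcq hcost, ?_⟩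
  obtain ⟨ρ, c, A, hA, hρ0, hρ1, hρ, hc, hrec⟩ :=
    SGNEP.exists_tracking_recursion hcq hg hF hw hp hy hys hyl
  obtain ⟨C, hC, hnorm⟩ := hp.exists_norm_sq_le
  -- The levels `1/(q+1)` are countably many, so one null set serves all of them and the rest is
  -- deterministic for fixed `θ`.
  have hnoise := ae_all_iff.2 fun q : ℕ =>
    SGNEP.ae_exists_tendsto_sum_noise hJ hcq hg hF hp hξ herr y hρ0 hρ1
      (r := 1 / ((q : ℝ) + 1)) (by positivity)
  filter_upwards [hnoise, SGNEP.ae_summable_sq_mul_errorSq hJ hcq hg hF hp hξ herr] with θ hM hs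
  have hv : Tendsto (fun k => p.distSq (S.iterates p X₀ ξ k θ) (y k)) atTop (𝓝 0) := by
    refine tendsto_zero_of_recursion (fun k => hp.distSq_nonneg _ _) hρ0 hρ1 hρ hc
      (hs.mul_left A) (fun k => mul_nonneg hA (mul_nonneg (sq_nonneg _)
        (SGNEP.errorSq_nonneg hp k θ))) (fun k => ?_) hM
    refine (hrec k (fun i => ξ k i θ) _ (SGNEP.iterates_mem_dom hcq hξ k θ)).trans (le_of_eq ?_)
    rw [← mul_assoc A]
    rfl
  have hsq : Tendsto (fun k => ‖S.iterates p X₀ ξ k θ - y k‖ ^ 2) atTop (𝓝 0) := by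
    refine squeeze_zero (fun k => sq_nonneg _) (fun k => hnorm _ _) ?_
    simpa using hv.const_mul C
  have hdiff : Tendsto (fun k => S.iterates p X₀ ξ k θ - y k) atTop (𝓝 0) := by
    rw [tendsto_zero_iff_norm_tendsto_zero]
    simpa using hsq.sqrt
  have hlim := hdiff.add hyl
  simp only [sub_add_cancel, zero_add] at hlim
  exact (continuous_fst.tendsto l).comp hlim
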